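/- **Setting.** Let $N\ge 2$, $\mathbb T^N=\mathbb R^N/\mathbb Z^N$, $L^2_v=L^2(\mathbb R^N)$, $L^2_x=L^2(\mathbb T^N)$, $L^2_{x,v}=L^2(\mathbb T^N\times\mathbb R^N)$ (real valued). For multi-indices $j,l\in\mathbb N^N$ put $\partial^j_l=\partial_{v_j}\partial_{x_l}$ (weak derivatives) and let $\delta_i$ be the $i$-th unit multi-index. $H^k_{x,v}$ is the Sobolev space with $\|f\|^2_{H^k_{x,v}}=\sum_{|j|+|l|\le k}\|\partial^j_lf\|^2_{L^2_{x,v}}$, and $\|f\|^2_{H^k_xL^2_v}=\sum_{|l|\le k}\|\partial^0_lf\|^2_{L^2_{x,v}}$. Operators on $L^2_v$ (possibly unbounded, with a domain) act on functions of $(x,v)$ in the variable $v$ only, for almost every $x$. Whenever an expression contains $\partial^j_l A(f)$, it is understood that $f$ is in the domain of $A$ and that $A(f)$ has the regularity needed ($A(f)\in H^k_{x,v}$, $k=|j|+|l|$, in (H1'), (H2')). Norms $\|\cdot\|_{\Lambda_v}$ on $L^2_v$ may take the value $+\infty$; a lower bound by such a norm includes its finiteness, and upper bounds by $\|\cdot\|_{\Lambda}$-type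 norms are required where these are finite. **Assumptions on $L$.** (H1) $L$ is a closed self-adjoint operator on $L^2_v$, $L=K-\Lambda$, and there are a (measurable) norm $\|\cdot\|_{\Lambda_v}$ on $L^2_v$ and constants $\nu_0,\dots,\nu_4,C^L>0$ with - $\nu_0\|u\|^2_{L^2_v}\le\nu_1\|u\|^2_{\Lambda_v}$ for $u\in L^2_v$, and $\nu_1\|u\|^2_{\Lambda_v}\le\langle\Lambda u,u\rangle_{L^2_v}\le\nu_2\|u\|^2_{\Lambda_v}<\infty$ for $u\in \mathrm{Dom}(\Lambda)$, - $\langle\nabla_v\Lambda u,\nabla_vu\rangle_{L^2_v}\ge\nu_3\|\nabla_vu\|^2_{\Lambda_v}-\nu_4\|u\|^2_{\Lambda_v}$ for $u\in H^1_v$, - $\langle Lu,w\rangle_{L^2_v}\le C^L\|u\|_{\Lambda_v}\|w\|_{\Lambda_v}$. Put $\|f\|_\Lambda=\big\|\,\|f(x,\cdot)\|_{\Lambda_v}\big\|_{L^2_x}$ and $\|f\|^2_{H^k_\Lambda}=\sum_{|j|+|l|\le k}\|\partial^j_lf\|^2_\Lambda$. (H1') (H1) holds and for every $k\ge1$ there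 are $\nu_5,\nu_6>0$ such that for all $|j|+|l|=k$ with $|j|\ge1$ and all $f\in H^k_{x,v}$: $\langle\partial^j_l\Lambda f,\partial^j_lf\rangle_{L^2_{x,v}}\ge\nu_5\|\partial^j_lf\|^2_\Lambda-\nu_6\|f\|^2_{H^{k-1}_{x,v}}$. (H2') For all $k\ge1$, $|j|+|l|=k$ with $|j|\ge1$ and $\delta>0$ there is $C(\delta)>0$ such that for all $f\in H^k_{x,v}$: $\langle\partial^j_lKf,\partial^j_lf\rangle_{L^2_{x,v}}\le C(\delta)\|f\|^2_{H^{k-1}_{x,v}}+\delta\|\partial^j_lf\|^2_{L^2_{x,v}}$. (H3) $\mathrm{Ker}(L)$ has a finite orthonormal basis $\phi_1,\dots,\phi_d$ with $\phi_i(v)=P_i(v)e^{-|v|^2/4}$, $P_i$ polynomials, and there is $\lambda>0$ with $\langle Lu,u\rangle_{L^2_v}\le-\lambda\|u^\perp\|^2_{\Lambda_v}$ for all $u\in\mathrm{Dom}(L)$, where $u^\perp=u-\sum_i\langle\phi_i,u\rangle\phi_i$. **Assumptions on $\Gamma$.** $\Gamma$ is an $L^2_v$-valued bilinear operator defined on $\mathrm{Dom}(\Gamma)\times\mathrm{Dom}(\Gamma)$,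 $\mathrm{Dom}(\Gamma)$ a subspace of $L^2_v$. (H4) $\Gamma$ is symmetric, and there are functionals $\mathcal G^k_{x,v},\mathcal G^k_x$ of pairs of functions, with values in $[0,\infty]$ and nondecreasing in $k$, such that for all $k\ge0$, $|j|+|l|\le k$, all $g,h\in H^k_{x,v}$ for which $\Gamma(g,h)\in H^k_{x,v}$ is defined, and all $f\in L^2_{x,v}$ with $\|f\|_\Lambda<\infty$: $|\langle\partial^j_l\Gamma(g,h),f\rangle_{L^2_{x,v}}|\le\mathcal G^k_{x,v}(g,h)\|f\|_\Lambda$ if $j\ne0$, and $\le\mathcal G^k_x(g,h)\|f\|_\Lambda$ if $j=0$. Moreover there is $k_0$ such that for every $k\ge k_0$ there is $C_\Gamma>0$ with, for all $g,h\in H^k_{x,v}$ with finite $H^k_\Lambda$ norms, $\mathcal G^k_{x,v}(g,h)\le C_\Gamma(\|g\|_{H^k_{x,v}}\|h\|_{H^k_\Lambda}+\|h\|_{H^k_{x,v}}\|g\|_{H^k_\Lambda})$ and $\mathcal G^k_x(g,h)\le C_\Gamma(\|h\|_{H^k_xL^2_v}\|g\|_{H^k_\Lambda}+\|g\|_{H^k_xL^2_v}\|h\|_{H^k_\Lambda})$.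 (H5) $\Gamma(g,h)\in\mathrm{Ker}(L)^\perp$ for all $g,h\in\mathrm{Dom}(\Gamma)$. **Functional.** For positive coefficients and $0<\varepsilon\le1$, $$\|f\|^2_{\mathcal H^k_\varepsilon}=\sum_{|j|+|l|\le k,\,|j|\ge1}b^{(k)}_{j,l}\varepsilon^2\|\partial^j_lf\|^2_{L^2_{x,v}}+\sum_{|l|\le k}\alpha^{(k)}_l\|\partial^0_lf\|^2_{L^2_{x,v}}+\sum_{|l|\le k,\ i:\,l_i>0}a^{(k)}_{i,l}\,\varepsilon\,\langle\partial^{\delta_i}_{l-\delta_i}f,\partial^0_lf\rangle_{L^2_{x,v}}.$$ Let $G_\varepsilon=\varepsilon^{-2}L-\varepsilon^{-1}v\cdot\nabla_x$, acting on $H^1_{x,v}$; orthogonality to $\mathrm{Ker}(G_\varepsilon)$ is in $L^2_{x,v}$. **Proposition.** Let $L$ satisfy (H1'), (H2'), (H3). There is $0<\varepsilon_N\le1$ such that for every integer $k\ge1$ there are $K_0^{(k)},K_1^{(k)},K_2^{(k)}>0$ and positive coefficients $b^{(k)}_{j,l},\alpha^{(k)}_l,a^{(k)}_{i,l}$, all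 independent of $\varepsilon$ and of $\Gamma$, such that: 1. there are $c,C>0$ such that for all $0<\varepsilon\le\varepsilon_N$ and $f\in H^k_{x,v}$, $\ c\,W\le\|f\|^2_{\mathcal H^k_\varepsilon}\le C\,W$, where $$W=\|f\|^2_{L^2_{x,v}}+\sum_{|l|\le k}\|\partial^0_lf\|^2_{L^2_{x,v}}+\varepsilon^2\sum_{|j|+|l|\le k,\,|j|\ge1}\|\partial^j_lf\|^2_{L^2_{x,v}};$$ 2. for every $\Gamma$ satisfying (H4) and (H5), every $0<\varepsilon\le\varepsilon_N$, every $h_{in}\in H^k_{x,v}\cap\mathrm{Ker}(G_\varepsilon)^\perp$, every $g=g(t)$ with values in $\mathrm{Dom}(\Gamma)\cap H^k_{x,v}$, and every strong solution $h$ in $H^k_{x,v}$ on a time interval $[0,T)$, with $h(0)=h_{in}$, of $$\partial_th+\tfrac1\varepsilon v\cdot\nabla_xh=\tfrac1{\varepsilon^2}L(h)+\tfrac1\varepsilon\Gamma(g,h),$$ one has for all $t\in(0,T)$ that $\|h(t)\|_{H^k_\Lambda}<\infty$, that $\|h\|^2_{\mathcal H^k_\varepsilon}$ is differentiable at $t$,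 and $$\frac{d}{dt}\|h\|^2_{\mathcal H^k_\varepsilon}\le-K_0^{(k)}\|h\|^2_{H^k_\Lambda}+K_1^{(k)}\big(\mathcal G^k_x(g,h)\big)^2+\varepsilon^2K_2^{(k)}\big(\mathcal G^k_{x,v}(g,h)\big)^2 .$$ Here a strong solution is a function $h:[0,T)\to H^k_{x,v}$ which is continuous in $L^2_{x,v}$, differentiable on $(0,T)$ for the norm of $H^k_{x,v}$, for which $L(h)$, $\Lambda(h)$ and $\Gamma(g,h)$ are defined and lie in $H^k_{x,v}$ at each $t\in(0,T)$, and which satisfies the equation almost everywhere. -/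

import Mathlib

open MeasureTheory Set
open scoped ENNReal ContDiff InnerProductSpace

noncomputable section

namespace Hypo

/-! ### Phase space, Lebesgue spaces, slices -/

/-- The flat torus `𝕋^N = ℝ^N / ℤ^N`. -/
abbrev Tor (N : ℕ) := UnitAddTorus (Fin N)

/-- The velocity space `ℝ^N`. -/
abbrev Vel (N : ℕ) := EuclideanSpace ℝ (Fin N)

/-- `L²_v = L²(ℝ^N)`. -/
abbrev L2v (N : ℕ) := Lp ℝ 2 (volume : Measure (Vel N))

/-- `L²_{x,v} = L²(𝕋^N × ℝ^N)`. -/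
abbrev L2xv (N : ℕ) := Lp ℝ 2 (volume : Measure (Tor N × Vel N))

open Classical in
/-- The slice `f(x,·)` of `f ∈ L²_{x,v}`, as an element of `L²_v`. By Fubini the slice is square
integrable for almost every `x`; the value `0` is used on the remaining null set. -/
def slice {N : ℕ} (f : L2xv N) (x : Tor N) : L2v N :=
  if h : MemLp (fun v => f (x, v)) 2 (volume : Measure (Vel N)) then h.toLp _ else 0

/-! ### Weak derivatives and Sobolev spaces -/

/-- Classical partial derivative `∂_{x_i}` of a function on `𝕋^N × ℝ^N`. -/
def xD {N : ℕ} (i : Fin N) (ψ : Tor N × Vel N → ℝ) : Tor N × Vel N → ℝ :=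
  fun p => deriv (fun s : ℝ => ψ (p.1 + Pi.single i (s : UnitAddCircle), p.2)) 0

/-- Classical partial derivative `∂_{v_i}` of a function on `𝕋^N × ℝ^N`. -/
def vD {N : ℕ} (i : Fin N) (ψ : Tor N × Vel N → ℝ) : Tor N × Vel N → ℝ :=
  fun p => deriv (fun s : ℝ => ψ (p.1, p.2 + s • EuclideanSpace.single i (1 : ℝ))) 0

/-- Classical derivative `∂^j_l = ∂_{v_j} ∂_{x_l}` for multi-indices `j` (in `v`) and
`l` (in `x`). It is only applied to smooth functions. -/
def classD {N : ℕ} (j l : Fin N → ℕ) (ψ : Tor N × Vel N → ℝ) : Tor N × Vel N → ℝ :=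
  (List.finRange N).foldr (fun i χ => (vD i)^[j i] ((xD i)^[l i] χ)) ψ

/-- Test functions on `𝕋^N × ℝ^N`: smooth (the lift to `ℝ^N × ℝ^N` is `C^∞`), with compact
support. -/
def IsTest {N : ℕ} (ψ : Tor N × Vel N → ℝ) : Prop :=
  ContDiff ℝ ∞ (fun p : (Fin N → ℝ) × Vel N => ψ ((fun i => (p.1 i : UnitAddCircle)), p.2)) ∧
    HasCompactSupport ψ

/-- The length `|j|` of a multi-index. -/
def len {N : ℕ} (j : Fin N → ℕ) : ℕ := ∑ i, j i

/-- `g = ∂^j_l f` in the weak sense. -/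
def HasWeakDeriv {N : ℕ} (j l : Fin N → ℕ) (f g : L2xv N) : Prop :=
  ∀ ψ : Tor N × Vel N → ℝ, IsTest ψ →
    ∫ p, f p * classD j l ψ p = (-1 : ℝ) ^ (len j + len l) * ∫ p, g p * ψ p

open Classical in
/-- The weak derivative `∂^j_l f ∈ L²_{x,v}` (the value is `0` if it does not exist). -/
def pd {N : ℕ} (j l : Fin N → ℕ) (f : L2xv N) : L2xv N :=
  if h : ∃ g, HasWeakDeriv j l f g then h.choose else 0

/-- `f ∈ H^k_{x,v}`. -/
def MemH {N : ℕ} (k : ℕ) (f : L2xv N) : Prop :=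
  ∀ j l : Fin N → ℕ, len j + len l ≤ k → ∃ g, HasWeakDeriv j l f g

/-- `w = ∂_{v_i} u` in the weak sense, for functions of `v` only. -/
def HasWeakDerivV {N : ℕ} (i : Fin N) (u w : L2v N) : Prop :=
  ∀ ψ : Vel N → ℝ, ContDiff ℝ ∞ ψ → HasCompactSupport ψ →
    ∫ v, u v * fderiv ℝ ψ v (EuclideanSpace.single i (1 : ℝ)) = - ∫ v, w v * ψ v

/-- The finite set of multi-indices `l` with `|l| ≤ k`. -/
def midx (N k : ℕ) : Finset (Fin N → ℕ) :=
  (Fintype.piFinset fun _ => Finset.range (k + 1)).filter fun l => len l ≤ k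

/-- The finite set of pairs `(j, l)` of multi-indices with `|j| + |l| ≤ k`. -/
def midx2 (N k : ℕ) : Finset ((Fin N → ℕ) × (Fin N → ℕ)) :=
  (midx N k ×ˢ midx N k).filter fun m => len m.1 + len m.2 ≤ k

/-- The multi-index `δ_i`. -/
def dl {N : ℕ} (i : Fin N) : Fin N → ℕ := Pi.single i 1

/-- The norm of `H^k_{x,v}`. -/
def hNorm {N : ℕ} (k : ℕ) (f : L2xv N) : ℝ :=
  √(∑ m ∈ midx2 N k, ‖pd m.1 m.2 f‖ ^ 2)

/-- The norm of `H^k_x L²_v`. -/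
def hxNorm {N : ℕ} (k : ℕ) (f : L2xv N) : ℝ :=
  √(∑ l ∈ midx N k, ‖pd 0 l f‖ ^ 2)

/-! ### The `Λ`-norms -/

/-- A (measurable) norm defined on a subspace of `L²_v`, extended by `∞`. (That it separates points
is part of the coercivity assumption below.) -/
structure IsExtNorm {N : ℕ} (nΛ : L2v N → ℝ≥0∞) : Prop where
  add_le : ∀ u w, nΛ (u + w) ≤ nΛ u + nΛ w
  smul : ∀ (c : ℝ) (u), nΛ (c • u) = ‖c‖ₑ * nΛ u
  measurable : @Measurable _ _ (borel (L2v N)) _ nΛ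

/-- `‖f‖_Λ`, the `L²_x`-norm of `x ↦ ‖f(x,·)‖_{Λ_v}`. -/
def lamNorm {N : ℕ} (nΛ : L2v N → ℝ≥0∞) (f : L2xv N) : ℝ≥0∞ :=
  (∫⁻ x, nΛ (slice f x) ^ 2) ^ (1 / 2 : ℝ)

/-- `‖f‖_{H^k_Λ}`. -/
def hLamNorm {N : ℕ} (nΛ : L2v N → ℝ≥0∞) (k : ℕ) (f : L2xv N) : ℝ≥0∞ :=
  (∑ m ∈ midx2 N k, lamNorm nΛ (pd m.1 m.2 f) ^ 2) ^ (1 / 2 : ℝ)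

/-! ### Operators acting on the velocity variable -/

/-- `A f = q`, where the operator `A` of `L²_v` acts on `f ∈ L²_{x,v}` in the variable `v` only. -/
def Acts {N : ℕ} (A : L2v N →ₗ.[ℝ] L2v N) (f q : L2xv N) : Prop :=
  ∀ᵐ x : Tor N, ∃ hx : slice f x ∈ A.domain, A ⟨slice f x, hx⟩ = slice q x

/-- `Γ(g, h) = r`, where the bilinear operator `Γ` with domain `D ⊆ L²_v` acts on functions of
`(x, v)` in the variable `v` only. -/
def ActsBilin {N : ℕ} {D : Submodule ℝ (L2v N)} (Γ : D →ₗ[ℝ] D →ₗ[ℝ] L2v N)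
    (g h r : L2xv N) : Prop :=
  ∀ᵐ x : Tor N, ∃ (hg : slice g x ∈ D) (hh : slice h x ∈ D),
    Γ ⟨slice g x, hg⟩ ⟨slice h x, hh⟩ = slice r x

/-- The kernel of an operator of `L²_v`. -/
def InKer {N : ℕ} (A : L2v N →ₗ.[ℝ] L2v N) (u : L2v N) : Prop :=
  ∃ hu : u ∈ A.domain, A ⟨u, hu⟩ = 0

/-- The function `v · ∇_x f` for `f ∈ H^1_{x,v}`. -/
def transport {N : ℕ} (f : L2xv N) (p : Tor N × Vel N) : ℝ :=
  ∑ i, p.2 i * pd 0 (dl i) f p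

/-- The kernel of `G_ε = ε⁻² L - ε⁻¹ v · ∇_x`, acting on `H^1_{x,v}`. -/
def InKerG {N : ℕ} (L : L2v N →ₗ.[ℝ] L2v N) (ε : ℝ) (f : L2xv N) : Prop :=
  MemH 1 f ∧ ∃ q, Acts L f q ∧
    ∀ᵐ p : Tor N × Vel N, (ε ^ 2)⁻¹ * q p - ε⁻¹ * transport f p = 0

/-! ### Assumptions on the linear operator -/

/-- (H1): coercivity and general controls. -/
structure H1 {N : ℕ} (L K Λ : L2v N →ₗ.[ℝ] L2v N) (nΛ : L2v N → ℝ≥0∞) : Prop where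
  closed : L.IsClosed
  selfAdjoint : IsSelfAdjoint L
  decomp : L = K - Λ
  norm : IsExtNorm nΛ
  coercive : ∃ ν₀ ν₁ ν₂ : ℝ, 0 < ν₀ ∧ 0 < ν₁ ∧ 0 < ν₂ ∧
    (∀ u : L2v N, ENNReal.ofReal (ν₀ * ‖u‖ ^ 2) ≤ ENNReal.ofReal ν₁ * nΛ u ^ 2) ∧
    ∀ u : Λ.domain, nΛ u ≠ ⊤ ∧ ν₁ * (nΛ u).toReal ^ 2 ≤ ⟪Λ u, (u : L2v N)⟫_ℝ ∧
      ⟪Λ u, (u : L2v N)⟫_ℝ ≤ ν₂ * (nΛ u).toReal ^ 2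
  defect : ∃ ν₃ ν₄ : ℝ, 0 < ν₃ ∧ 0 < ν₄ ∧
    ∀ (u : Λ.domain) (du dΛu : Fin N → L2v N), (∀ i, HasWeakDerivV i u (du i)) →
      (∀ i, HasWeakDerivV i (Λ u) (dΛu i)) →
      (∀ i, nΛ (du i) ≠ ⊤) ∧
      ν₃ * ∑ i, (nΛ (du i)).toReal ^ 2 - ν₄ * (nΛ u).toReal ^ 2 ≤ ∑ i, ⟪dΛu i, du i⟫_ℝ
  bound : ∃ C : ℝ, 0 < C ∧ ∀ (u : L.domain) (w : L2v N), nΛ w ≠ ⊤ →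
    ⟪L u, w⟫_ℝ ≤ C * (nΛ u).toReal * (nΛ w).toReal

/-- (H1'): (H1) together with the defect of coercivity for higher derivatives. -/
structure H1' {N : ℕ} (L K Λ : L2v N →ₗ.[ℝ] L2v N) (nΛ : L2v N → ℝ≥0∞) : Prop where
  h1 : H1 L K Λ nΛ
  defect : ∀ k : ℕ, 1 ≤ k → ∃ ν₅ ν₆ : ℝ, 0 < ν₅ ∧ 0 < ν₆ ∧
    ∀ j l : Fin N → ℕ, len j + len l = k → 1 ≤ len j →
      ∀ f Λf : L2xv N, MemH k f → Acts Λ f Λf → MemH k Λf →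
        lamNorm nΛ (pd j l f) ≠ ⊤ ∧
        ν₅ * (lamNorm nΛ (pd j l f)).toReal ^ 2 - ν₆ * hNorm (k - 1) f ^ 2
          ≤ ⟪pd j l Λf, pd j l f⟫_ℝ

/-- (H2'): mixing properties. -/
def H2' {N : ℕ} (K : L2v N →ₗ.[ℝ] L2v N) : Prop :=
  ∀ k : ℕ, 1 ≤ k → ∀ j l : Fin N → ℕ, len j + len l = k → 1 ≤ len j →
    ∀ δ : ℝ, 0 < δ → ∃ C : ℝ, 0 < C ∧
      ∀ f Kf : L2xv N, MemH k f → Acts K f Kf → MemH k Kf →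
        ⟪pd j l Kf, pd j l f⟫_ℝ ≤ C * hNorm (k - 1) f ^ 2 + δ * ‖pd j l f‖ ^ 2

/-- (H3): relaxation to equilibrium. The vector `u - ∑ i, ⟪φ i, u⟫ φ i` is the microscopic part
`u^⊥` of `u`, since `φ` is an orthonormal basis of `Ker L`. -/
def H3 {N : ℕ} (L : L2v N →ₗ.[ℝ] L2v N) (nΛ : L2v N → ℝ≥0∞) : Prop :=
  ∃ (d : ℕ) (φ : Fin d → L2v N) (P : Fin d → MvPolynomial (Fin N) ℝ),
    Orthonormal ℝ φ ∧
    (∀ u, InKer L u ↔ u ∈ Submodule.span ℝ (Set.range φ)) ∧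
    (∀ i, ∀ᵐ v : Vel N,
      φ i v = MvPolynomial.eval (fun m => v m) (P i) * Real.exp (-‖v‖ ^ 2 / 4)) ∧
    ∃ lam : ℝ, 0 < lam ∧ ∀ u : L.domain,
      nΛ ((u : L2v N) - ∑ i, ⟪φ i, (u : L2v N)⟫_ℝ • φ i) ≠ ⊤ ∧
      ⟪L u, (u : L2v N)⟫_ℝ ≤
        -lam * (nΛ ((u : L2v N) - ∑ i, ⟪φ i, (u : L2v N)⟫_ℝ • φ i)).toReal ^ 2

/-! ### Assumptions on the bilinear operator -/

/-- (H4): `Γ` is symmetric and controlled by the functionals `𝒢^k_{x,v}` and `𝒢^k_x`. -/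
structure H4 {N : ℕ} (nΛ : L2v N → ℝ≥0∞) {D : Submodule ℝ (L2v N)}
    (Γ : D →ₗ[ℝ] D →ₗ[ℝ] L2v N) (Gxv Gx : ℕ → L2xv N → L2xv N → ℝ≥0∞) : Prop where
  symm : ∀ u w : D, Γ u w = Γ w u
  control : ∀ (k : ℕ) (g h r : L2xv N), MemH k g → MemH k h → ActsBilin Γ g h r → MemH k r →
    ∀ j l : Fin N → ℕ, len j + len l ≤ k → ∀ f : L2xv N, lamNorm nΛ f ≠ ⊤ →
      (j ≠ 0 → ENNReal.ofReal |⟪pd j l r, f⟫_ℝ| ≤ Gxv k g h * lamNorm nΛ f) ∧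
      (j = 0 → ENNReal.ofReal |⟪pd j l r, f⟫_ℝ| ≤ Gx k g h * lamNorm nΛ f)
  mono_xv : ∀ k g h, Gxv k g h ≤ Gxv (k + 1) g h
  mono_x : ∀ k g h, Gx k g h ≤ Gx (k + 1) g h
  bound : ∃ k₀ : ℕ, ∀ k, k₀ ≤ k → ∃ C : ℝ, 0 < C ∧
    ∀ g h : L2xv N, MemH k g → MemH k h → hLamNorm nΛ k g ≠ ⊤ → hLamNorm nΛ k h ≠ ⊤ →
      Gxv k g h ≤ ENNReal.ofReal (C * (hNorm k g * (hLamNorm nΛ k h).toReal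
        + hNorm k h * (hLamNorm nΛ k g).toReal)) ∧
      Gx k g h ≤ ENNReal.ofReal (C * (hxNorm k h * (hLamNorm nΛ k g).toReal
        + hxNorm k g * (hLamNorm nΛ k h).toReal))

/-- (H5): `Γ(g, h)` is orthogonal to `Ker L`. -/
def H5 {N : ℕ} (L : L2v N →ₗ.[ℝ] L2v N) {D : Submodule ℝ (L2v N)}
    (Γ : D →ₗ[ℝ] D →ₗ[ℝ] L2v N) : Prop :=
  ∀ g h : D, ∀ u : L2v N, InKer L u → ⟪u, Γ g h⟫_ℝ = 0

/-! ### The functional and the solutions -/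

/-- The square of the functional `‖f‖_{ℋ^k_ε}` with coefficients `b`, `α`, `a`. -/
def hEpsSq {N : ℕ} (k : ℕ) (b : (Fin N → ℕ) → (Fin N → ℕ) → ℝ) (α : (Fin N → ℕ) → ℝ)
    (a : Fin N → (Fin N → ℕ) → ℝ) (ε : ℝ) (f : L2xv N) : ℝ :=
  (∑ m ∈ (midx2 N k).filter (fun m => 1 ≤ len m.1), b m.1 m.2 * ε ^ 2 * ‖pd m.1 m.2 f‖ ^ 2)
  + (∑ l ∈ midx N k, α l * ‖pd 0 l f‖ ^ 2)
  + ∑ l ∈ midx N k, ∑ i ∈ Finset.univ.filter (fun i => 0 < l i),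
      a i l * ε * ⟪pd (dl i) (l - dl i) f, pd 0 l f⟫_ℝ

/-- The square of the `ε`-weighted Sobolev norm. -/
def weightedSq {N : ℕ} (k : ℕ) (ε : ℝ) (f : L2xv N) : ℝ :=
  ‖f‖ ^ 2 + (∑ l ∈ midx N k, ‖pd 0 l f‖ ^ 2)
  + ε ^ 2 * ∑ m ∈ (midx2 N k).filter (fun m => 1 ≤ len m.1), ‖pd m.1 m.2 f‖ ^ 2

/-- `h` is a (strong) solution in `H^k_{x,v}`, on the time interval `[0, T)` and with initial
datum `hin`, of
`∂_t h + ε⁻¹ v · ∇_x h = ε⁻² L h + ε⁻¹ Γ(g, h)`: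
it takes values in `H^k_{x,v}`, is continuous in `L²_{x,v}`, is differentiable in time for the
topology of `H^k_{x,v}`, the terms `L h`, `Λ h` and `Γ(g, h)` are defined and belong to
`H^k_{x,v}`, and the equation holds almost everywhere. -/
structure IsSolution {N : ℕ} (k : ℕ) (ε T : ℝ) (L Λ : L2v N →ₗ.[ℝ] L2v N)
    {D : Submodule ℝ (L2v N)} (Γ : D →ₗ[ℝ] D →ₗ[ℝ] L2v N)
    (hin : L2xv N) (g h : ℝ → L2xv N) : Prop where
  init : h 0 = hin
  cont : ContinuousOn h (Ico 0 T)
  mem : ∀ t ∈ Ico 0 T, MemH k (h t)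
  eqn : ∀ t ∈ Ioo 0 T, ∃ ht Lh Λh Γgh : L2xv N,
    MemH k ht ∧ MemH k Lh ∧ MemH k Λh ∧ MemH k Γgh ∧
    (∀ j l : Fin N → ℕ, len j + len l ≤ k →
      HasDerivAt (fun s => pd j l (h s)) (pd j l ht) t) ∧
    Acts L (h t) Lh ∧ Acts Λ (h t) Λh ∧ ActsBilin Γ (g t) (h t) Γgh ∧
    ∀ᵐ p : Tor N × Vel N,
      ht p + ε⁻¹ * transport (h t) p = (ε ^ 2)⁻¹ * Lh p + ε⁻¹ * Γgh p

end Hypo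

end

open Hypo

noncomputable section

namespace Hypo

open Filter Topology

/-! ### Calculus of test functions along affine flows -/

/-! The operator `L` damps only the microscopic part of `h`. The part lying fibrewise in `Ker L` is
damped through the interaction of `L` with transport: since `[∂_{v_i}, v·∇_x] = ∂_{x_i}`, the time
derivative of `ε⟨∂^{δ_i}_{l-δ_i} h, ∂^0_l h⟩` contains `-‖∂^0_l h‖²`. The mixed terms of the
functional are there to produce this quantity.

Three inequalities at a fixed time carry the estimate. `Snapshot.energy_x` gives the dissipation
`-λε⁻²‖(∂^0_l h)^⊥‖_Λ²`, because transport is skew and `Γ` sees only microscopic parts.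
`Snapshot.energy_mixed` gives `-‖∂^0_l h‖²` at the price of a small multiple of one `v`-derivative
and a large multiple of the microscopic dissipation. `exists_energy_v` bounds `ε²` times the
derivative of `‖∂^j_l h‖²`, `j ≠ 0`, by a coercive term plus terms that either have lower total
order or trade a `v`-derivative for an `x`-derivative.

All coefficients are powers of one small `r`, with exponents `wt` ordered first by total order, then
by the number of `v`-derivatives. Every error of the `v`-estimates then has a strictly smaller
exponent than the term it comes from, hence gains a factor `r`. The mixed terms are weighted so that
Young's inequality with parameter `r²` also gains `r`, and the coefficient `r⁻³` of the
`x`-derivatives pays for the microscopic errors, of size `r⁻²ε⁻²`. `energy_combine` does this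
bookkeeping; the same powers make the mixed terms harmless in `hEpsSq_equiv`. No smallness of `ε`
beyond `ε ≤ 1` is needed.

The order zero norm has no mixed term. It is recovered by a Poincaré inequality (`norm_sq_le_perp`),
which needs the moments of `h` along `Ker L` to have mean zero in `x`. They do initially, by
orthogonality to `Ker G_ε`, and they are conserved (`IsSolution.inner_constX_eq_zero`).

All derivatives are weak, and `v·∇_x` has unbounded coefficients. The fields `∂_{x_i}`, `∂_{v_i}`
and `v·∇_x` are therefore treated uniformly as generators of explicit measure preserving flows. By
`Drift.Weak.strong`, a weak derivative in `L²` is a norm derivative of the translates; integration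
by parts then becomes the differentiation of an inner product (`Drift.Strong.inner_eq`,
`Drift.Strong.inner_swap`), without cutoffs or approximation by smooth functions. Commutators are
computed on test functions and transferred by duality (`weak_tField_pd`). That `L` commutes with
`x`-derivatives is closedness of its graph combined with invariance under translations in `x`
(`pd_mem_fiberSub`). -/

/-- The projection `ℝ^N → 𝕋^N`. -/
def mkT {N : ℕ} (y : Fin N → ℝ) : Tor N := fun i => (y i : UnitAddCircle)

lemma mkT_add {N : ℕ} (y z : Fin N → ℝ) : mkT (y + z) = mkT y + mkT z := by
  ext i; simp [mkT]

lemma mkT_zero {N : ℕ} : mkT (0 : Fin N → ℝ) = 0 := by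
  ext i; simp [mkT]

lemma mkT_surjective {N : ℕ} : Function.Surjective (mkT (N := N)) := by
  intro x
  choose y hy using fun i => QuotientAddGroup.mk_surjective (x i)
  exact ⟨y, funext hy⟩

lemma continuous_mkT {N : ℕ} : Continuous (mkT (N := N)) :=
  continuous_pi fun i => (AddCircle.continuous_mk' 1).comp (continuous_apply i)

lemma isOpenQuotientMap_mkT {N : ℕ} : IsOpenQuotientMap (mkT (N := N)) :=
  IsOpenQuotientMap.piMap fun _ => QuotientAddGroup.isOpenQuotientMap_mk

/-- The lift of a function on `𝕋^N × ℝ^N` to `ℝ^N × ℝ^N`. -/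
def lift {N : ℕ} (ψ : Tor N × Vel N → ℝ) (p : (Fin N → ℝ) × Vel N) : ℝ := ψ (mkT p.1, p.2)

lemma lift_injective {N : ℕ} : Function.Injective (lift (N := N)) := by
  intro ψ χ h
  funext ⟨x, v⟩
  obtain ⟨y, rfl⟩ := mkT_surjective x
  exact congrFun h (y, v)

lemma continuous_of_lift {N : ℕ} {ψ : Tor N × Vel N → ℝ} (h : Continuous (lift ψ)) :
    Continuous ψ := by
  have hq : IsOpenQuotientMap (Prod.map (mkT (N := N)) (id : Vel N → Vel N)) :=
    isOpenQuotientMap_mkT.prodMap IsOpenQuotientMap.id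
  exact hq.isQuotientMap.continuous_iff.2 h

lemma isTest_iff {N : ℕ} {ψ : Tor N × Vel N → ℝ} :
    IsTest ψ ↔ ContDiff ℝ ∞ (lift ψ) ∧ ∃ R : ℝ, ∀ x v, R < ‖v‖ → ψ (x, v) = 0 := by
  refine and_congr Iff.rfl ⟨fun h => ?_, ?_⟩
  · obtain ⟨R, hR⟩ := (h.isCompact.image continuous_snd).isBounded.exists_norm_le
    refine ⟨R, fun x v hv => ?_⟩
    by_contra hne
    exact absurd (hR v ⟨(x, v), subset_tsupport _ hne, rfl⟩) (not_le.2 hv)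
  · rintro ⟨R, hR⟩
    refine HasCompactSupport.of_support_subset_isCompact
      (isCompact_univ.prod (isCompact_closedBall (0 : Vel N) R)) ?_
    rintro ⟨x, v⟩ hp
    refine ⟨mem_univ _, ?_⟩
    rw [mem_closedBall_zero_iff]
    by_contra hne
    exact hp (hR x v (not_le.1 hne))

lemma IsTest.contDiff {N : ℕ} {ψ : Tor N × Vel N → ℝ} (h : IsTest ψ) : ContDiff ℝ ∞ (lift ψ) := h.1

lemma IsTest.continuous {N : ℕ} {ψ : Tor N × Vel N → ℝ} (h : IsTest ψ) : Continuous ψ :=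
  continuous_of_lift h.contDiff.continuous

lemma IsTest.bounded {N : ℕ} {ψ : Tor N × Vel N → ℝ} (h : IsTest ψ) :
    ∃ M : ℝ, 0 ≤ M ∧ ∀ p, |ψ p| ≤ M := by
  obtain ⟨M, hM⟩ := h.continuous.bounded_above_of_compact_support h.2
  exact ⟨M, (norm_nonneg _).trans (hM 0), hM⟩

lemma IsTest.add {N : ℕ} {ψ χ : Tor N × Vel N → ℝ} (h : IsTest ψ) (h' : IsTest χ) :
    IsTest (ψ + χ) :=
  ⟨h.1.add h'.1, h.2.add h'.2⟩

lemma IsTest.smul {N : ℕ} {ψ : Tor N × Vel N → ℝ} (h : IsTest ψ) (c : ℝ) :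
    IsTest (c • ψ) :=
  ⟨contDiff_const.smul h.1, h.2.mono (Function.support_const_smul_subset c ψ)⟩

lemma isTest_zero {N : ℕ} : IsTest (0 : Tor N × Vel N → ℝ) :=
  ⟨contDiff_const, HasCompactSupport.zero⟩

/-- Data of the affine vector field `(a + B v) · ∇_x + w · ∇_v` on `𝕋^N × ℝ^N`. -/
structure Drift (N : ℕ) where
  a : Fin N → ℝ
  B : Vel N →L[ℝ] (Fin N → ℝ)
  w : Vel N
  hw : B w = 0

/-- The flow of an affine vector field. -/
def Drift.flow {N : ℕ} (X : Drift N) (s : ℝ) (p : Tor N × Vel N) : Tor N × Vel N :=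
  (p.1 + mkT (s • (X.a + X.B p.2)), p.2 + s • X.w)

/-- The derivative along an affine vector field. -/
def Drift.D {N : ℕ} (X : Drift N) (ψ : Tor N × Vel N → ℝ) (p : Tor N × Vel N) : ℝ :=
  deriv (fun s : ℝ => ψ (X.flow s p)) 0

/-- The field `∂_{x_i}`. -/
def xField {N : ℕ} (i : Fin N) : Drift N := ⟨Pi.single i 1, 0, 0, by simp⟩

/-- The field `∂_{v_i}`. -/
def vField {N : ℕ} (i : Fin N) : Drift N := ⟨0, 0, EuclideanSpace.single i 1, by simp⟩

/-- The field `v · ∇_x`. -/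
def tField {N : ℕ} : Drift N := ⟨0, EuclideanSpace.equiv (Fin N) ℝ, 0, by simp⟩

lemma xD_eq {N : ℕ} (i : Fin N) : xD (N := N) i = (xField i).D := by
  funext ψ p
  simp only [xD, Drift.D, Drift.flow, xField]
  congr 1
  funext s
  congr 2
  · congr 1
    ext m
    by_cases h : m = i
    · subst h; simp [mkT]
    · simp [mkT, h]
  · simp

lemma vD_eq {N : ℕ} (i : Fin N) : vD (N := N) i = (vField i).D := by
  funext ψ p
  simp [vD, Drift.D, Drift.flow, vField, mkT_zero]

lemma Drift.flow_zero {N : ℕ} (X : Drift N) (p : Tor N × Vel N) : X.flow 0 p = p := by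
  simp [Drift.flow, mkT_zero]

/-- Here `B w = 0` matters: the velocity of `x`, which is `a + B v`, does not change while `v` moves
along `w`, so the flow is affine in time. -/
lemma Drift.flow_add {N : ℕ} (X : Drift N) (s t : ℝ) (p : Tor N × Vel N) :
    X.flow s (X.flow t p) = X.flow (s + t) p := by
  simp only [Drift.flow, map_add, map_smul, X.hw, smul_zero, add_zero, add_smul, mkT_add]
  ext1
  · simp only; abel
  · simp only; abel

lemma Drift.lift_flow {N : ℕ} (X : Drift N) (s : ℝ) (ψ : Tor N × Vel N → ℝ)
    (q : (Fin N → ℝ) × Vel N) :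
    ψ (X.flow s (mkT q.1, q.2)) = lift ψ (q + s • (X.a + X.B q.2, X.w)) := by
  simp [Drift.flow, lift, mkT_add]

/-- The lifted affine vector field. -/
def Drift.dir {N : ℕ} (X : Drift N) (q : (Fin N → ℝ) × Vel N) : (Fin N → ℝ) × Vel N :=
  (X.a + X.B q.2, X.w)

lemma Drift.contDiff_dir {N : ℕ} (X : Drift N) : ContDiff ℝ ∞ X.dir := by
  unfold Drift.dir
  fun_prop

lemma Drift.hasDerivAt_zero {N : ℕ} (X : Drift N) {ψ : Tor N × Vel N → ℝ}
    (h : Differentiable ℝ (lift ψ)) (q : (Fin N → ℝ) × Vel N) :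
    HasDerivAt (fun s => ψ (X.flow s (mkT q.1, q.2))) (fderiv ℝ (lift ψ) q (X.dir q)) 0 := by
  have h1 : HasDerivAt (fun s : ℝ => q + s • X.dir q) (X.dir q) 0 := by
    simpa using ((hasDerivAt_id (0 : ℝ)).smul_const (X.dir q)).const_add q
  have h2 := (h (q + (0 : ℝ) • X.dir q)).hasFDerivAt.comp_hasDerivAt (0 : ℝ) h1
  simp only [zero_smul, add_zero] at h2
  refine h2.congr_of_eventuallyEq (Eventually.of_forall fun s => ?_)
  simp only [Function.comp]
  exact X.lift_flow s ψ q

lemma Drift.lift_D {N : ℕ} (X : Drift N) {ψ : Tor N × Vel N → ℝ}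
    (h : Differentiable ℝ (lift ψ)) :
    lift (X.D ψ) = fun q => fderiv ℝ (lift ψ) q (X.dir q) := by
  funext q
  exact (X.hasDerivAt_zero h q).deriv

lemma IsTest.differentiable {N : ℕ} {ψ : Tor N × Vel N → ℝ} (h : IsTest ψ) :
    Differentiable ℝ (lift ψ) := h.contDiff.differentiable (by simp)

lemma Drift.hasDerivAt_flow {N : ℕ} (X : Drift N) {ψ : Tor N × Vel N → ℝ} (h : IsTest ψ)
    (p : Tor N × Vel N) (s : ℝ) :
    HasDerivAt (fun r => ψ (X.flow r p)) (X.D ψ (X.flow s p)) s := by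
  obtain ⟨y, hy⟩ := mkT_surjective (X.flow s p).1
  have h0 := X.hasDerivAt_zero h.differentiable (y, (X.flow s p).2)
  rw [← h0.deriv] at h0
  simp only [hy] at h0
  have h1 : HasDerivAt (fun r => ψ (X.flow r (X.flow s p))) (X.D ψ (X.flow s p)) (s - s) := by
    rw [sub_self]; exact h0
  have := h1.comp_sub_const s s
  refine this.congr_of_eventuallyEq (Eventually.of_forall fun r => ?_)
  simp [Drift.flow_add]

lemma IsTest.D {N : ℕ} {ψ : Tor N × Vel N → ℝ} (h : IsTest ψ) (X : Drift N) :
    IsTest (X.D ψ) := by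
  rw [isTest_iff]
  constructor
  · rw [X.lift_D h.differentiable]
    exact (h.contDiff.fderiv_right (m := ∞) (by simp)).clm_apply X.contDiff_dir
  · obtain ⟨R, hR⟩ := (isTest_iff.1 h).2
    refine ⟨R, fun x v hv => ?_⟩
    have : (fun s : ℝ => ψ (X.flow s (x, v))) =ᶠ[𝓝 0] fun _ => 0 := by
      have hc : Continuous fun s : ℝ => ‖v + s • X.w‖ := by fun_prop
      have := (hc.tendsto 0).eventually_const_lt (u := R) (by simpa using hv)
      filter_upwards [this] with s hs
      exact hR _ _ hs
    unfold Drift.D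
    rw [this.deriv_eq, deriv_const]

lemma IsTest.comp_flow {N : ℕ} {ψ : Tor N × Vel N → ℝ} (h : IsTest ψ) (X : Drift N) (s : ℝ) :
    IsTest (fun p => ψ (X.flow s p)) := by
  rw [isTest_iff]
  constructor
  · have : lift (fun p => ψ (X.flow s p)) = fun q => lift ψ (q + s • X.dir q) :=
      funext fun q => X.lift_flow s ψ q
    rw [this]
    exact h.contDiff.comp (contDiff_id.add (X.contDiff_dir.const_smul s))
  · obtain ⟨R, hR⟩ := (isTest_iff.1 h).2
    refine ⟨R + ‖s • X.w‖, fun x v hv => hR _ _ ?_⟩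
    have := norm_le_norm_add_norm_sub' v (v + s • X.w)
    simp only [sub_add_cancel_left, norm_neg] at this
    linarith

lemma Drift.D_comp_flow {N : ℕ} (X : Drift N) (ψ : Tor N × Vel N → ℝ) (s : ℝ) :
    X.D (fun p => ψ (X.flow s p)) = fun p => X.D ψ (X.flow s p) := by
  funext p
  simp only [Drift.D, Drift.flow_add, add_comm]

/-- The commutator of a constant vector field with an affine one. -/
lemma Drift.D_comm {N : ℕ} (X Y : Drift N) (hY : Y.B = 0) {ψ : Tor N × Vel N → ℝ} (h : IsTest ψ) :
    Y.D (X.D ψ) = X.D (Y.D ψ) + Drift.D ⟨X.B Y.w, 0, 0, by simp⟩ ψ := by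
  apply lift_injective
  have hd : ∀ q, Y.dir q = (Y.a, Y.w) := fun q => by simp [Drift.dir, hY]
  have h2 : Differentiable ℝ (fderiv ℝ (lift ψ)) :=
    (h.contDiff.fderiv_right (m := ∞) (by simp)).differentiable (by simp)
  have e (χ χ' : Tor N × Vel N → ℝ) : lift (χ + χ') = lift χ + lift χ' := rfl
  rw [e, Y.lift_D (h.D X).differentiable, X.lift_D (h.D Y).differentiable,
    X.lift_D h.differentiable, Y.lift_D h.differentiable, Drift.lift_D _ h.differentiable]
  funext q
  have hsym : IsSymmSndFDerivAt ℝ (lift ψ) q :=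
    h.contDiff.contDiffAt.isSymmSndFDerivAt
      (by simpa using ENat.LEInfty.out)
  have hX : HasFDerivAt X.dir
      ((X.B.comp (ContinuousLinearMap.snd ℝ (Fin N → ℝ) (Vel N))).prod 0) q := by
    unfold Drift.dir
    refine HasFDerivAt.prodMk ?_ (hasFDerivAt_const _ _)
    exact (X.B.comp (ContinuousLinearMap.snd ℝ (Fin N → ℝ) (Vel N))).hasFDerivAt.const_add X.a
  have h3 := (h2 q).hasFDerivAt.clm_apply hX
  have h4 := (h2 q).hasFDerivAt.clm_apply (hasFDerivAt_const (Y.a, Y.w) q)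
  simp only [hd, Pi.add_apply]
  rw [h3.fderiv, h4.fderiv]
  simp only [add_apply, ContinuousLinearMap.comp_apply,
    ContinuousLinearMap.flip_apply, ContinuousLinearMap.prod_apply, ContinuousLinearMap.coe_snd',
    zero_apply, map_zero, zero_add, Drift.dir, add_zero]
  -- The second order parts agree by symmetry of the Hessian; what remains is the derivative of the
  -- coefficient of `X` in the direction `Y`, namely `(B Y.w, 0)`.
  rw [hsym.eq (X.a + X.B q.2, X.w) (Y.a, Y.w), add_comm]

lemma Drift.D_const_comm {N : ℕ} (X Y : Drift N) (hX : X.B = 0) (hY : Y.B = 0)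
    {ψ : Tor N × Vel N → ℝ} (h : IsTest ψ) : Y.D (X.D ψ) = X.D (Y.D ψ) := by
  rw [X.D_comm Y hY h]
  have : Drift.D ⟨X.B Y.w, 0, 0, by simp⟩ ψ = 0 := by
    funext p
    simp [Drift.D, Drift.flow, hX, mkT_zero]
  rw [this, add_zero]

lemma vD_tField {N : ℕ} (i : Fin N) {ψ : Tor N × Vel N → ℝ} (h : IsTest ψ) :
    vD i (tField.D ψ) = tField.D (vD i ψ) + xD i ψ := by
  rw [vD_eq, xD_eq, tField.D_comm (vField i) rfl h]
  congr 2

lemma xD_tField {N : ℕ} (i : Fin N) {ψ : Tor N × Vel N → ℝ} (h : IsTest ψ) :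
    xD i (tField.D ψ) = tField.D (xD i ψ) := by
  rw [xD_eq, tField.D_comm (xField i) rfl h]
  have : Drift.D ⟨tField.B (xField i).w, 0, 0, by simp⟩ ψ = 0 := by
    funext p
    simp [Drift.D, Drift.flow, xField, mkT_zero]
  rw [this, add_zero]

/-- `v_i ψ` is a test function. -/
lemma IsTest.coord_mul {N : ℕ} (i : Fin N) {ψ : Tor N × Vel N → ℝ} (h : IsTest ψ) :
    IsTest (fun p => p.2 i * ψ p) := by
  refine ⟨?_, h.2.mul_left⟩
  have : ContDiff ℝ ∞ fun p : (Fin N → ℝ) × Vel N => p.2 i :=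
    ((EuclideanSpace.proj i : Vel N →L[ℝ] ℝ).contDiff).comp contDiff_snd
  exact this.mul h.1

/-- `v · ∇_x ψ = ∑ i, ∂_{x_i} (v_i ψ)` for a test function `ψ`. -/
lemma tField_D_eq {N : ℕ} {ψ : Tor N × Vel N → ℝ} (h : IsTest ψ) :
    tField.D ψ = ∑ i, xD i (fun p => p.2 i * ψ p) := by
  have hx (i : Fin N) : xD i (fun p => p.2 i * ψ p) = fun p => p.2 i * xD i ψ p := by
    funext p
    simp only [xD, deriv_const_mul_field']
  apply lift_injective
  rw [tField.lift_D h.differentiable]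
  funext q
  have h1 : lift (∑ i, xD i fun p => p.2 i * ψ p) q = ∑ i, q.2 i * lift (xD i ψ) q := by
    simp [lift, Finset.sum_apply, hx]
  rw [h1]
  simp_rw [xD_eq, Drift.lift_D _ h.differentiable]
  have h2 : tField.dir q = ∑ i, q.2 i • (xField i).dir q := by
    simp only [Drift.dir, tField, xField]
    ext m
    · simp [Prod.fst_sum, Finset.sum_apply, Pi.single_apply]
    · simp [Prod.snd_sum]
  rw [h2, map_sum]
  simp

/-! ### Iterated classical derivatives -/

/-- The classical derivative over a list of coordinates. -/
def listD {N : ℕ} (s : List (Fin N)) (j l : Fin N → ℕ) (ψ : Tor N × Vel N → ℝ) :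
    Tor N × Vel N → ℝ :=
  s.foldr (fun i χ => (vD i)^[j i] ((xD i)^[l i] χ)) ψ

lemma IsTest.xD {N : ℕ} {ψ : Tor N × Vel N → ℝ} (h : IsTest ψ) (i : Fin N) : IsTest (xD i ψ) := by
  rw [xD_eq]; exact h.D _

lemma IsTest.vD {N : ℕ} {ψ : Tor N × Vel N → ℝ} (h : IsTest ψ) (i : Fin N) : IsTest (vD i ψ) := by
  rw [vD_eq]; exact h.D _

lemma IsTest.iterate {N : ℕ} {F : (Tor N × Vel N → ℝ) → Tor N × Vel N → ℝ}
    (hF : ∀ ψ, IsTest ψ → IsTest (F ψ)) {ψ : Tor N × Vel N → ℝ} (h : IsTest ψ) (n : ℕ) :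
    IsTest (F^[n] ψ) := by
  induction n with
  | zero => exact h
  | succ n ih => rw [Function.iterate_succ_apply']; exact hF _ ih

lemma iterate_comm_of_isTest {N : ℕ} {F G : (Tor N × Vel N → ℝ) → Tor N × Vel N → ℝ}
    (hF : ∀ ψ, IsTest ψ → IsTest (F ψ)) (hFG : ∀ ψ, IsTest ψ → G (F ψ) = F (G ψ))
    {ψ : Tor N × Vel N → ℝ} (h : IsTest ψ) (n : ℕ) :
    G (F^[n] ψ) = F^[n] (G ψ) := by
  induction n with
  | zero => rfl
  | succ n ih =>
    rw [Function.iterate_succ_apply', Function.iterate_succ_apply', hFG _ (h.iterate hF n), ih]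

lemma IsTest.listD {N : ℕ} {ψ : Tor N × Vel N → ℝ} (h : IsTest ψ) (s : List (Fin N))
    (j l : Fin N → ℕ) : IsTest (listD s j l ψ) := by
  induction s with
  | nil => exact h
  | cons i s ih =>
    exact (ih.iterate (fun _ h => h.xD i) _).iterate (fun _ h => h.vD i) _

lemma listD_comm {N : ℕ} {ψ : Tor N × Vel N → ℝ} (h : IsTest ψ) (s : List (Fin N))
    (j l : Fin N → ℕ) (Y : Drift N) (hY : Y.B = 0) :
    Y.D (listD s j l ψ) = listD s j l (Y.D ψ) := by
  induction s with
  | nil => rfl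
  | cons i s ih =>
    have ht := h.listD s j l
    have hxt := ht.iterate (fun _ h => h.xD i) (l i)
    have hx : ∀ χ, IsTest χ → Y.D (xD i χ) = xD i (Y.D χ) := fun χ hχ => by
      rw [xD_eq]; exact Drift.D_const_comm _ _ rfl hY hχ
    have hv : ∀ χ, IsTest χ → Y.D (vD i χ) = vD i (Y.D χ) := fun χ hχ => by
      rw [vD_eq]; exact Drift.D_const_comm _ _ rfl hY hχ
    change Y.D ((vD i)^[j i] ((xD i)^[l i] (listD s j l ψ))) =
      (vD i)^[j i] ((xD i)^[l i] (listD s j l (Y.D ψ)))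
    rw [iterate_comm_of_isTest (fun _ h => h.vD i) hv hxt,
      iterate_comm_of_isTest (fun _ h => h.xD i) hx ht, ih]

lemma listD_congr {N : ℕ} (s : List (Fin N)) {j l j' l' : Fin N → ℕ} (hj : ∀ i ∈ s, j i = j' i)
    (hl : ∀ i ∈ s, l i = l' i) (ψ : Tor N × Vel N → ℝ) : listD s j l ψ = listD s j' l' ψ := by
  induction s with
  | nil => rfl
  | cons i s ih =>
    change (vD i)^[j i] ((xD i)^[l i] (listD s j l ψ)) = (vD i)^[j' i] ((xD i)^[l' i] _)
    rw [hj i (by simp), hl i (by simp), ih (fun i hi => hj i (by simp [hi]))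
      (fun i hi => hl i (by simp [hi]))]
    rfl

/-- The additional derivative is produced in the middle of the ordered product and commuted to the
innermost place, where duality can pass it to the function being differentiated weakly. `Nodup`
ensures that the index is met exactly once. -/
lemma listD_add_v {N : ℕ} {ψ : Tor N × Vel N → ℝ} (h : IsTest ψ) (s : List (Fin N))
    (hs : s.Nodup) (j l : Fin N → ℕ) (m : Fin N) (hm : m ∈ s) :
    listD s (j + dl m) l ψ = listD s j l (vD m ψ) := by
  induction s with
  | nil => simp at hm
  | cons i s ih =>
    have ht := h.listD s j l
    have hxt := ht.iterate (fun _ h => h.xD i) (l i)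
    rw [List.nodup_cons] at hs
    change (vD i)^[(j + dl m) i] ((xD i)^[l i] (listD s (j + dl m) l ψ)) =
      (vD i)^[j i] ((xD i)^[l i] (listD s j l (vD m ψ)))
    by_cases him : i = m
    · subst him
      have e1 : (j + dl i) i = j i + 1 := by simp [dl]
      have e2 : listD s (j + dl i) l ψ = listD s j l ψ := by
        refine listD_congr s (fun a ha => ?_) (fun _ _ => rfl) ψ
        have : a ≠ i := fun e => hs.1 (e ▸ ha)
        simp [dl, this]
      rw [e1, e2, Function.iterate_succ_apply,
        iterate_comm_of_isTest (G := vD i) (fun _ h => h.xD i) (fun χ hχ => ?_) ht, vD_eq,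
        listD_comm h s j l _ rfl]
      rw [xD_eq, vD_eq]; exact Drift.D_const_comm _ _ rfl rfl hχ
    · have hm' : m ∈ s := by simpa [Ne.symm him] using hm
      have e1 : (j + dl m) i = j i := by simp [dl, him]
      rw [e1, ih hs.2 hm']

lemma listD_add_x {N : ℕ} {ψ : Tor N × Vel N → ℝ} (h : IsTest ψ) (s : List (Fin N))
    (hs : s.Nodup) (j l : Fin N → ℕ) (m : Fin N) (hm : m ∈ s) :
    listD s j (l + dl m) ψ = listD s j l (xD m ψ) := by
  induction s with
  | nil => simp at hm
  | cons i s ih =>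
    have ht := h.listD s j l
    rw [List.nodup_cons] at hs
    change (vD i)^[j i] ((xD i)^[(l + dl m) i] (listD s j (l + dl m) ψ)) =
      (vD i)^[j i] ((xD i)^[l i] (listD s j l (xD m ψ)))
    by_cases him : i = m
    · subst him
      have e1 : (l + dl i) i = l i + 1 := by simp [dl]
      have e2 : listD s j (l + dl i) ψ = listD s j l ψ := by
        refine listD_congr s (fun _ _ => rfl) (fun a ha => ?_) ψ
        have : a ≠ i := fun e => hs.1 (e ▸ ha)
        simp [dl, this]
      rw [e1, e2, Function.iterate_succ_apply, xD_eq, listD_comm h s j l _ rfl]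
    · have hm' : m ∈ s := by simpa [Ne.symm him] using hm
      have e1 : (l + dl m) i = l i := by simp [dl, him]
      rw [e1, ih hs.2 hm']

lemma IsTest.classD {N : ℕ} {ψ : Tor N × Vel N → ℝ} (h : IsTest ψ) (j l : Fin N → ℕ) :
    IsTest (classD j l ψ) := h.listD _ j l

lemma classD_add_v {N : ℕ} {ψ : Tor N × Vel N → ℝ} (h : IsTest ψ) (j l : Fin N → ℕ) (m : Fin N) :
    classD (j + dl m) l ψ = classD j l (vD m ψ) :=
  listD_add_v h _ (List.nodup_finRange N) j l m (List.mem_finRange m)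

lemma classD_add_x {N : ℕ} {ψ : Tor N × Vel N → ℝ} (h : IsTest ψ) (j l : Fin N → ℕ) (m : Fin N) :
    classD j (l + dl m) ψ = classD j l (xD m ψ) :=
  listD_add_x h _ (List.nodup_finRange N) j l m (List.mem_finRange m)

lemma classD_zero {N : ℕ} (ψ : Tor N × Vel N → ℝ) : classD 0 0 ψ = ψ := by
  change listD (List.finRange N) 0 0 ψ = ψ
  induction List.finRange N with
  | nil => rfl
  | cons i s ih => exact ih

/-! ### Slices -/

instance fact_two_ne_top : Fact ((2 : ℝ≥0∞) ≠ ⊤) := ⟨by simp⟩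

lemma eLpNorm_two_sq {α E : Type*} [MeasurableSpace α] [NormedAddCommGroup E] (μ : Measure α)
    (f : α → E) : eLpNorm f 2 μ ^ 2 = ∫⁻ x, ‖f x‖ₑ ^ 2 ∂μ := by
  rw [eLpNorm_eq_lintegral_rpow_enorm_toReal (by simp) (by simp), ← ENNReal.rpow_natCast,
    ← ENNReal.rpow_mul]
  simp

lemma memLp_two_iff {α E : Type*} [MeasurableSpace α] [NormedAddCommGroup E] {μ : Measure α}
    {f : α → E} (hf : AEStronglyMeasurable f μ) : MemLp f 2 μ ↔ ∫⁻ x, ‖f x‖ₑ ^ 2 ∂μ < ⊤ := by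
  rw [← eLpNorm_two_sq, MemLp, and_iff_right hf]
  simp

lemma enorm_sq_eq_lintegral {α E : Type*} [MeasurableSpace α] [NormedAddCommGroup E]
    {μ : Measure α} (f : Lp E 2 μ) : ‖f‖ₑ ^ 2 = ∫⁻ x, ‖f x‖ₑ ^ 2 ∂μ := by
  rw [Lp.enorm_def, eLpNorm_two_sq]

/-- A map into a separable metric space with measurable preimages of balls is strongly
measurable. -/
lemma stronglyMeasurable_of_ball {α E : Type*} [MeasurableSpace α] [PseudoMetricSpace E]
    [SecondCountableTopology E] {F : α → E}
    (h : ∀ (w : E) (r : ℝ), MeasurableSet {x | dist (F x) w < r}) : StronglyMeasurable F := by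
  have hb : TopologicalSpace.IsTopologicalBasis {s : Set E | ∃ w r, s = Metric.ball w r} := by
    refine TopologicalSpace.isTopologicalBasis_of_isOpen_of_nhds ?_ fun a u ha hu => ?_
    · rintro _ ⟨w, r, rfl⟩; exact Metric.isOpen_ball
    · obtain ⟨r, hr, hru⟩ := Metric.isOpen_iff.1 hu a ha
      exact ⟨_, ⟨a, r, rfl⟩, Metric.mem_ball_self hr, hru⟩
  have hF : @Measurable α E _ (borel E) F := by
    rw [hb.borel_eq_generateFrom]
    refine measurable_generateFrom ?_
    rintro _ ⟨w, r, rfl⟩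
    exact h w r
  let _ : MeasurableSpace E := borel E
  have : BorelSpace E := ⟨rfl⟩
  exact hF.stronglyMeasurable

lemma volume_tor_vel {N : ℕ} : (volume : Measure (Tor N × Vel N)) = volume.prod volume := rfl

lemma ae_memLp_slice {N : ℕ} (f : L2xv N) :
    ∀ᵐ x : Tor N, MemLp (fun v => f (x, v)) 2 (volume : Measure (Vel N)) := by
  have hm : Measurable fun p : Tor N × Vel N => ‖f p‖ₑ ^ 2 :=
    ((Lp.stronglyMeasurable f).measurable.enorm).pow_const 2
  have h : ∫⁻ x : Tor N, ∫⁻ v : Vel N, ‖f (x, v)‖ₑ ^ 2 < ⊤ := by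
    rw [← lintegral_prod _ hm.aemeasurable, ← volume_tor_vel, ← enorm_sq_eq_lintegral]
    simp
  filter_upwards [ae_lt_top hm.lintegral_prod_right' h.ne] with x hx
  refine (memLp_two_iff ?_).2 hx
  exact ((Lp.stronglyMeasurable f).comp_measurable measurable_prodMk_left).aestronglyMeasurable

lemma ae_coeFn_slice {N : ℕ} (f : L2xv N) :
    ∀ᵐ x : Tor N, (slice f x : Vel N → ℝ) =ᵐ[volume] fun v => f (x, v) := by
  filter_upwards [ae_memLp_slice f] with x hx
  rw [slice, dif_pos hx]
  exact hx.coeFn_toLp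

/-- Characterisation of slices by the functions of `v`. -/
lemma ae_slice_eq {N : ℕ} {f : L2xv N} {F : Tor N → L2v N}
    (h : ∀ᵐ x : Tor N, (fun v => f (x, v)) =ᵐ[volume] F x) : ∀ᵐ x : Tor N, slice f x = F x := by
  filter_upwards [h, ae_coeFn_slice f] with x h1 h2
  exact Lp.ext (h2.trans h1)

/-- By separability of `L²_v` it suffices to see that the distance to a fixed `w` is measurable in
`x`, and where the slice is square integrable this distance is an integral in `v`, covered by
Tonelli. -/
lemma stronglyMeasurable_slice {N : ℕ} (f : L2xv N) : StronglyMeasurable (slice f) := by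
  have hf := (Lp.stronglyMeasurable f).measurable
  have hS : MeasurableSet {x : Tor N | MemLp (fun v => f (x, v)) 2 (volume : Measure (Vel N))} := by
    have : {x : Tor N | MemLp (fun v => f (x, v)) 2 (volume : Measure (Vel N))} =
        {x : Tor N | ∫⁻ v : Vel N, ‖f (x, v)‖ₑ ^ 2 < ⊤} := by
      ext x
      exact memLp_two_iff
        ((Lp.stronglyMeasurable f).comp_measurable measurable_prodMk_left).aestronglyMeasurable
    rw [this]
    exact measurableSet_lt ((hf.enorm.pow_const 2).lintegral_prod_right') measurable_const
  refine stronglyMeasurable_of_ball fun w r => ?_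
  have hm : Measurable fun x : Tor N => ∫⁻ v : Vel N, ‖f (x, v) - w v‖ₑ ^ 2 := by
    have : Measurable fun p : Tor N × Vel N => ‖f p - w p.2‖ₑ ^ 2 :=
      ((hf.sub ((Lp.stronglyMeasurable w).measurable.comp measurable_snd)).enorm).pow_const 2
    exact this.lintegral_prod_right'
  have hd : Measurable fun x : Tor N =>
      ((∫⁻ v : Vel N, ‖f (x, v) - w v‖ₑ ^ 2) ^ (1 / 2 : ℝ)).toReal :=
    (hm.pow_const _).ennreal_toReal
  have : {x | dist (slice f x) w < r} =
      ({x : Tor N | MemLp (fun v => f (x, v)) 2 (volume : Measure (Vel N))} ∩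
        {x | ((∫⁻ v : Vel N, ‖f (x, v) - w v‖ₑ ^ 2) ^ (1 / 2 : ℝ)).toReal < r}) ∪
      ({x : Tor N | MemLp (fun v => f (x, v)) 2 (volume : Measure (Vel N))}ᶜ ∩
        {_x | dist 0 w < r}) := by
    ext x
    by_cases hx : MemLp (fun v => f (x, v)) 2 (volume : Measure (Vel N))
    · have : dist (slice f x) w =
          ((∫⁻ v : Vel N, ‖f (x, v) - w v‖ₑ ^ 2) ^ (1 / 2 : ℝ)).toReal := by
        rw [slice, dif_pos hx, dist_eq_norm, Lp.norm_def,
          eLpNorm_eq_lintegral_rpow_enorm_toReal (by simp) (by simp)]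
        simp only [ENNReal.toReal_ofNat, ENNReal.rpow_ofNat]
        congr 2
        refine lintegral_congr_ae ?_
        filter_upwards [Lp.coeFn_sub (hx.toLp _) w, hx.coeFn_toLp] with v h1 h2
        rw [h1, Pi.sub_apply, h2]
      simp [hx, this]
    · have : slice f x = 0 := by rw [slice, dif_neg hx]
      simp [hx, this]
  rw [this]
  exact (hS.inter (hd measurableSet_Iio)).union (hS.compl.inter (MeasurableSet.const _))

lemma lintegral_slice {N : ℕ} (f : L2xv N) :
    ∫⁻ x : Tor N, ‖slice f x‖ₑ ^ 2 = ‖f‖ₑ ^ 2 := by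
  have hm : Measurable fun p : Tor N × Vel N => ‖f p‖ₑ ^ 2 :=
    ((Lp.stronglyMeasurable f).measurable.enorm).pow_const 2
  rw [enorm_sq_eq_lintegral f]
  refine Eq.trans ?_ (lintegral_prod _ hm.aemeasurable).symm
  refine lintegral_congr_ae ?_
  filter_upwards [ae_coeFn_slice f] with x hx
  rw [enorm_sq_eq_lintegral]
  refine lintegral_congr_ae ?_
  filter_upwards [hx] with v hv
  rw [hv]

lemma memLp_slice {N : ℕ} (f : L2xv N) : MemLp (slice f) 2 (volume : Measure (Tor N)) := by
  rw [memLp_two_iff (stronglyMeasurable_slice f).aestronglyMeasurable, lintegral_slice]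
  simp

lemma ae_ae_of_ae {N : ℕ} {P : Tor N × Vel N → Prop} (h : ∀ᵐ p, P p) :
    ∀ᵐ x : Tor N, ∀ᵐ v : Vel N, P (x, v) :=
  Measure.ae_ae_of_ae_prod h

lemma slice_add {N : ℕ} (f g : L2xv N) :
    ∀ᵐ x : Tor N, slice (f + g) x = slice f x + slice g x := by
  refine ae_slice_eq ?_
  filter_upwards [ae_ae_of_ae (Lp.coeFn_add f g), ae_coeFn_slice f, ae_coeFn_slice g]
    with x h1 h2 h3
  filter_upwards [h1, h2, h3, Lp.coeFn_add (slice f x) (slice g x)] with v h1 h2 h3 h4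
  rw [h4, h1, Pi.add_apply, Pi.add_apply, h2, h3]

lemma slice_smul {N : ℕ} (c : ℝ) (f : L2xv N) :
    ∀ᵐ x : Tor N, slice (c • f) x = c • slice f x := by
  refine ae_slice_eq ?_
  filter_upwards [ae_ae_of_ae (Lp.coeFn_smul c f), ae_coeFn_slice f] with x h1 h2
  filter_upwards [h1, h2, Lp.coeFn_smul c (slice f x)] with v h1 h2 h3
  rw [h3, h1, Pi.smul_apply, Pi.smul_apply, h2]

/-- The isometry `f ↦ (x ↦ f(x,·))` from `L²_{x,v}` to `L²(𝕋^N; L²_v)`. -/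
def sliceLI (N : ℕ) : L2xv N →ₗᵢ[ℝ] Lp (L2v N) 2 (volume : Measure (Tor N)) where
  toFun f := (memLp_slice f).toLp _
  map_add' f g := by
    refine Lp.ext ?_
    filter_upwards [(memLp_slice (f + g)).coeFn_toLp, (memLp_slice f).coeFn_toLp,
      (memLp_slice g).coeFn_toLp, slice_add f g,
      Lp.coeFn_add ((memLp_slice f).toLp _) ((memLp_slice g).toLp _)] with x h1 h2 h3 h4 h5
    rw [h5, h1, h4, Pi.add_apply, h2, h3]
  map_smul' c f := by
    refine Lp.ext ?_
    filter_upwards [(memLp_slice (c • f)).coeFn_toLp, (memLp_slice f).coeFn_toLp,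
      slice_smul c f, Lp.coeFn_smul c ((memLp_slice f).toLp _)] with x h1 h2 h3 h4
    rw [RingHom.id_apply, h4, h1, h3, Pi.smul_apply, h2]
  norm_map' f := by
    have h : ‖(memLp_slice f).toLp (slice f)‖ₑ ^ 2 = ‖f‖ₑ ^ 2 := by
      rw [Lp.enorm_toLp, eLpNorm_two_sq, lintegral_slice]
    have h' := (ENNReal.pow_right_strictMono (two_ne_zero)).injective h
    change ‖(memLp_slice f).toLp (slice f)‖ = ‖f‖
    rw [← toReal_enorm, h', toReal_enorm]

lemma coeFn_sliceLI {N : ℕ} (f : L2xv N) : sliceLI N f =ᵐ[volume] slice f :=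
  (memLp_slice f).coeFn_toLp

lemma inner_eq_integral_slice {N : ℕ} (f g : L2xv N) :
    ⟪f, g⟫_ℝ = ∫ x : Tor N, ⟪slice f x, slice g x⟫_ℝ := by
  rw [← (sliceLI N).inner_map_map, L2.inner_def]
  refine integral_congr_ae ?_
  filter_upwards [coeFn_sliceLI f, coeFn_sliceLI g] with x h1 h2
  rw [h1, h2]

lemma integrable_inner_slice {N : ℕ} (f g : L2xv N) :
    Integrable (fun x : Tor N => ⟪slice f x, slice g x⟫_ℝ) := by
  refine (L2.integrable_inner (𝕜 := ℝ) (sliceLI N f) (sliceLI N g)).congr ?_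
  filter_upwards [coeFn_sliceLI f, coeFn_sliceLI g] with x h1 h2
  rw [h1, h2]

lemma eq_of_ae_slice_eq {N : ℕ} {f g : L2xv N} (h : ∀ᵐ x : Tor N, slice f x = slice g x) :
    f = g := by
  refine (sliceLI N).injective (Lp.ext ?_)
  filter_upwards [coeFn_sliceLI f, coeFn_sliceLI g, h] with x h1 h2 h3
  rw [h1, h2, h3]

lemma slice_sub {N : ℕ} (f g : L2xv N) :
    ∀ᵐ x : Tor N, slice (f - g) x = slice f x - slice g x := by
  have e : f - g = f + (-1 : ℝ) • g := by rw [neg_one_smul, sub_eq_add_neg]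
  rw [e]
  filter_upwards [slice_add f ((-1 : ℝ) • g), slice_smul (-1) g] with x h1 h2
  rw [h1, h2, neg_one_smul, sub_eq_add_neg]

lemma slice_zero {N : ℕ} : ∀ᵐ x : Tor N, slice (0 : L2xv N) x = 0 := by
  filter_upwards [slice_smul 0 (0 : L2xv N)] with x h
  rwa [smul_zero, zero_smul] at h

lemma slice_sum {N : ℕ} {ι : Type*} (s : Finset ι) (f : ι → L2xv N) :
    ∀ᵐ x : Tor N, slice (∑ i ∈ s, f i) x = ∑ i ∈ s, slice (f i) x := by
  classical
  induction s using Finset.induction_on with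
  | empty => simpa using slice_zero
  | insert i s hi ih =>
    rw [Finset.sum_insert hi]
    filter_upwards [ih, slice_add (f i) (∑ i ∈ s, f i)] with x h1 h2
    rw [h2, h1, Finset.sum_insert hi]

/-- Convergence in `L²_{x,v}` implies convergence of the slices along a subsequence. -/
lemma exists_subseq_slice_tendsto {N : ℕ} {f : ℕ → L2xv N} {g : L2xv N}
    (h : Tendsto f atTop (𝓝 g)) :
    ∃ ns : ℕ → ℕ, StrictMono ns ∧
      ∀ᵐ x : Tor N, Tendsto (fun n => slice (f (ns n)) x) atTop (𝓝 (slice g x)) := by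
  have h' := ((sliceLI N).continuous.tendsto g).comp h
  obtain ⟨ns, hns, hx⟩ := (tendstoInMeasure_of_tendsto_Lp h').exists_seq_tendsto_ae
  refine ⟨ns, hns, ?_⟩
  filter_upwards [hx, coeFn_sliceLI g, ae_all_iff.2 fun n => coeFn_sliceLI (f n)] with x h1 h2 h3
  simpa only [h2, h3, Function.comp] using h1

/-! ### Tensor products -/

lemma memLp_tens {N : ℕ} {a : Tor N → ℝ} (ha : MemLp a 2 (volume : Measure (Tor N)))
    (u : L2v N) : MemLp (fun p : Tor N × Vel N => a p.1 * u p.2) 2 volume := by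
  have hu := Lp.memLp u
  have hm : AEStronglyMeasurable (fun p : Tor N × Vel N => a p.1 * u p.2) volume :=
    (ha.1.comp_quasiMeasurePreserving Measure.quasiMeasurePreserving_fst).mul
      (hu.1.comp_quasiMeasurePreserving Measure.quasiMeasurePreserving_snd)
  rw [memLp_two_iff hm]
  simp only [enorm_mul, mul_pow]
  rw [volume_tor_vel, lintegral_prod_mul (ha.1.aemeasurable.enorm.pow_const 2)
    (hu.1.aemeasurable.enorm.pow_const 2)]
  exact ENNReal.mul_lt_top ((memLp_two_iff ha.1).1 ha) ((memLp_two_iff hu.1).1 hu)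

/-- The function `a(x) u(v)`. -/
def tens {N : ℕ} {a : Tor N → ℝ} (ha : MemLp a 2 (volume : Measure (Tor N))) (u : L2v N) :
    L2xv N := (memLp_tens ha u).toLp _

lemma coeFn_tens {N : ℕ} {a : Tor N → ℝ} (ha : MemLp a 2 (volume : Measure (Tor N))) (u : L2v N) :
    tens ha u =ᵐ[volume] fun p : Tor N × Vel N => a p.1 * u p.2 := (memLp_tens ha u).coeFn_toLp

lemma slice_tens {N : ℕ} {a : Tor N → ℝ} (ha : MemLp a 2 (volume : Measure (Tor N))) (u : L2v N) :
    ∀ᵐ x : Tor N, slice (tens ha u) x = a x • u := by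
  refine ae_slice_eq ?_
  filter_upwards [ae_ae_of_ae (coeFn_tens ha u)] with x h1
  filter_upwards [h1, Lp.coeFn_smul (a x) u] with v h1 h2
  rw [h1, h2, Pi.smul_apply, smul_eq_mul]

lemma inner_tens {N : ℕ} {a : Tor N → ℝ} (ha : MemLp a 2 (volume : Measure (Tor N))) (u : L2v N)
    (f : L2xv N) : ⟪tens ha u, f⟫_ℝ = ∫ x : Tor N, a x * ⟪u, slice f x⟫_ℝ := by
  rw [inner_eq_integral_slice]
  refine integral_congr_ae ?_
  filter_upwards [slice_tens ha u] with x h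
  rw [h, real_inner_smul_left]

lemma memLp_inner_slice {N : ℕ} (u : L2v N) (f : L2xv N) :
    MemLp (fun x : Tor N => ⟪u, slice f x⟫_ℝ) 2 volume :=
  (memLp_slice f).const_inner u

/-! ### Fourier coefficients in the space variable -/

-- The torus has unit periods, so Lebesgue measure is the product of the Haar probability measures
-- for which the characters form a Hilbert basis.
open UnitAddTorus in
lemma parseval {N : ℕ} {F : Tor N → ℂ} (hF : MemLp F 2 (volume : Measure (Tor N))) :
    HasSum (fun n : Fin N → ℤ => ‖∫ x, mFourier (-n) x * F x‖ ^ 2) (∫ x, ‖F x‖ ^ 2) := by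
  have hv : (volume : Measure (Tor N)) =
      Measure.pi fun _ : Fin N => (AddCircle.haarAddCircle : Measure UnitAddCircle) := by
    rw [volume_pi]
    congr 1
    funext i
    rw [AddCircle.volume_eq_smul_haarAddCircle]
    simp
  rw [hv] at hF ⊢
  have h := hasSum_sq_mFourierCoeff (hF.toLp F)
  have hae := hF.coeFn_toLp
  convert! h using 1
  · funext n
    congr 2
    refine integral_congr_ae ?_
    filter_upwards [hae] with x hx
    rw [smul_eq_mul]
    exact congrArg _ hx.symm
  · refine integral_congr_ae ?_
    filter_upwards [hae] with x hx
    exact congrArg (fun z => ‖z‖ ^ 2) hx.symm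

lemma ae_eq_zero_of_fourier {N : ℕ} {F : Tor N → ℂ} (hF : MemLp F 2 (volume : Measure (Tor N)))
    (h : ∀ n : Fin N → ℤ, ∫ x, UnitAddTorus.mFourier n x * F x = 0) : ∀ᵐ x, F x = 0 := by
  have h0 := parseval hF
  simp only [h, norm_zero, ne_eq, OfNat.ofNat_ne_zero, not_false_eq_true, zero_pow] at h0
  have h1 := h0.unique hasSum_zero
  have h2 := (integral_eq_zero_iff_of_nonneg (fun x => by positivity) hF.integrable_norm_pow').1 h1
  filter_upwards [h2] with x hx
  simpa using hx

/-- Real part of a character of the torus. -/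
def cosT {N : ℕ} (n : Fin N → ℤ) (x : Tor N) : ℝ := (UnitAddTorus.mFourier n x).re

/-- Imaginary part of a character of the torus. -/
def sinT {N : ℕ} (n : Fin N → ℤ) (x : Tor N) : ℝ := (UnitAddTorus.mFourier n x).im

lemma mFourier_mkT {N : ℕ} (n : Fin N → ℤ) (y : Fin N → ℝ) :
    UnitAddTorus.mFourier n (mkT y) = ∏ i, Complex.exp (2 * Real.pi * Complex.I * n i * y i) := by
  simp [UnitAddTorus.mFourier, mkT]

lemma contDiff_mFourier {N : ℕ} (n : Fin N → ℤ) :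
    ContDiff ℝ ∞ fun y : Fin N → ℝ => UnitAddTorus.mFourier n (mkT y) := by
  simp only [mFourier_mkT]
  refine contDiff_prod fun i _ => ?_
  refine ContDiff.cexp (contDiff_const.mul ?_)
  exact (Complex.ofRealCLM.contDiff).comp (contDiff_apply ℝ ℝ i)

lemma contDiff_cosT {N : ℕ} (n : Fin N → ℤ) : ContDiff ℝ ∞ fun y : Fin N → ℝ => cosT n (mkT y) :=
  Complex.reCLM.contDiff.comp (contDiff_mFourier n)

lemma contDiff_sinT {N : ℕ} (n : Fin N → ℤ) : ContDiff ℝ ∞ fun y : Fin N → ℝ => sinT n (mkT y) :=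
  Complex.imCLM.contDiff.comp (contDiff_mFourier n)

lemma memLp_cosT {N : ℕ} (n : Fin N → ℤ) : MemLp (cosT n) 2 (volume : Measure (Tor N)) := by
  have hc : Continuous (cosT n) := Complex.continuous_re.comp (UnitAddTorus.mFourier n).continuous
  exact hc.memLp_of_hasCompactSupport (HasCompactSupport.of_compactSpace _)

lemma memLp_sinT {N : ℕ} (n : Fin N → ℤ) : MemLp (sinT n) 2 (volume : Measure (Tor N)) := by
  have hc : Continuous (sinT n) := Complex.continuous_im.comp (UnitAddTorus.mFourier n).continuous
  exact hc.memLp_of_hasCompactSupport (HasCompactSupport.of_compactSpace _)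

/-- The Fourier coefficient of `x ↦ ⟨u, f(x,·)⟩` for the character `n`. -/
def fcoef {N : ℕ} (n : Fin N → ℤ) (u : L2v N) (f : L2xv N) : ℂ :=
  ⟪tens (memLp_cosT n) u, f⟫_ℝ + ⟪tens (memLp_sinT n) u, f⟫_ℝ * Complex.I

lemma memLp_inner_slice_ofReal {N : ℕ} (u : L2v N) (f : L2xv N) :
    MemLp (fun x : Tor N => (⟪u, slice f x⟫_ℝ : ℂ)) 2 volume :=
  (memLp_inner_slice u f).ofReal

/-- The definition by two real inner products makes the coefficient differentiable along `L²`-valued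
curves; the integral form connects it with Parseval and with translations. -/
lemma fcoef_eq_integral {N : ℕ} (n : Fin N → ℤ) (u : L2v N) (f : L2xv N) :
    fcoef n u f = ∫ x, UnitAddTorus.mFourier n x * (⟪u, slice f x⟫_ℝ : ℂ) := by
  rw [fcoef, inner_tens, inner_tens]
  have h1 := (memLp_cosT n).integrable_mul (memLp_inner_slice u f)
  have h2 := (memLp_sinT n).integrable_mul (memLp_inner_slice u f)
  rw [← integral_complex_ofReal, ← integral_complex_ofReal, ← integral_mul_const,
    ← integral_add h1.ofReal (h2.ofReal.mul_const _)]
  refine integral_congr_ae (Eventually.of_forall fun x => ?_)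
  change _ = UnitAddTorus.mFourier n x * _
  conv_rhs => rw [← Complex.re_add_im (UnitAddTorus.mFourier n x)]
  simp only [cosT, sinT]
  push_cast
  ring

lemma isTest_mul {N : ℕ} {η : Tor N → ℝ} (hη : ContDiff ℝ ∞ fun y : Fin N → ℝ => η (mkT y))
    {ρ : Vel N → ℝ} (hρ : ContDiff ℝ ∞ ρ) (hc : HasCompactSupport ρ) :
    IsTest (fun p : Tor N × Vel N => η p.1 * ρ p.2) := by
  rw [isTest_iff]
  constructor
  · exact (hη.comp contDiff_fst).mul (hρ.comp contDiff_snd)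
  · obtain ⟨R, hR⟩ := hc.isCompact.isBounded.exists_norm_le
    refine ⟨R, fun x v hv => ?_⟩
    have : ρ v = 0 := by
      by_contra hne
      exact absurd (hR v (subset_tsupport _ hne)) (not_le.2 hv)
    simp [this]

/-- For fixed `η`, the pairing is the inner product of `u` with the Bochner integral `∫ η(x) f(x,·)
dx` in `L²_v`. Products of `η` with bump functions of `v` are test functions, so this integral
vanishes. -/
lemma inner_tens_eq_zero {N : ℕ} {f : L2xv N}
    (h : ∀ ψ : Tor N × Vel N → ℝ, IsTest ψ → ∫ p, f p * ψ p = 0) {η : Tor N → ℝ}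
    (hη : ContDiff ℝ ∞ fun y : Fin N → ℝ => η (mkT y)) (hη2 : MemLp η 2 (volume : Measure (Tor N)))
    (u : L2v N) : ⟪tens hη2 u, f⟫_ℝ = 0 := by
  have hi : Integrable (fun x : Tor N => η x • slice f x) := by
    have := (memLp_slice f).smul hη2 (r := 1)
    exact memLp_one_iff_integrable.1 this
  have key : ∀ w : L2v N, ⟪tens hη2 w, f⟫_ℝ = ⟪w, ∫ x : Tor N, η x • slice f x⟫_ℝ := by
    intro w
    rw [inner_tens, ← integral_inner hi]
    simp only [real_inner_smul_right]
  rw [key]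
  suffices hm : ∫ x : Tor N, η x • slice f x = 0 by rw [hm, inner_zero_right]
  refine Lp.ext ?_
  refine EventuallyEq.trans ?_ (Lp.coeFn_zero ℝ 2 (volume : Measure (Vel N))).symm
  refine ae_eq_zero_of_integral_contDiff_smul_eq_zero
    ((Lp.memLp _).locallyIntegrable (by norm_num)) fun ρ hρ hc => ?_
  have hρ2 : MemLp ρ 2 (volume : Measure (Vel N)) := hρ.continuous.memLp_of_hasCompactSupport hc
  have h1 := key (hρ2.toLp ρ)
  rw [L2.inner_def, L2.inner_def] at h1
  have h2 : ∫ p : Tor N × Vel N, ⟪tens hη2 (hρ2.toLp ρ) p, f p⟫_ℝ =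
      ∫ p, f p * (η p.1 * ρ p.2) := by
    refine integral_congr_ae ?_
    have hq : ∀ᵐ p : Tor N × Vel N, hρ2.toLp ρ p.2 = ρ p.2 :=
      Measure.quasiMeasurePreserving_snd.ae hρ2.coeFn_toLp
    filter_upwards [coeFn_tens hη2 (hρ2.toLp ρ), hq] with p h3 h4
    rw [h3, h4]
    simp
  rw [h2, h _ (isTest_mul hη hρ hc)] at h1
  rw [h1]
  refine integral_congr_ae ?_
  filter_upwards [hρ2.coeFn_toLp] with v hv
  rw [hv]
  simp [mul_comm]

/-- Test functions separate the points of `L²_{x,v}`. -/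
theorem eq_zero_of_test {N : ℕ} {f : L2xv N}
    (h : ∀ ψ : Tor N × Vel N → ℝ, IsTest ψ → ∫ p, f p * ψ p = 0) : f = 0 := by
  have h1 : ∀ u : L2v N, ∀ᵐ x : Tor N, ⟪u, slice f x⟫_ℝ = 0 := by
    intro u
    have := ae_eq_zero_of_fourier (memLp_inner_slice_ofReal u f) fun n => by
      rw [← fcoef_eq_integral, fcoef, inner_tens_eq_zero h (contDiff_cosT n),
        inner_tens_eq_zero h (contDiff_sinT n)]
      simp
    filter_upwards [this] with x hx
    exact_mod_cast hx
  refine eq_of_ae_slice_eq ?_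
  -- The exceptional null set depends on `u`; a countable dense family of `u` is enough and leaves
  -- one null set.
  filter_upwards [ae_all_iff.2 fun m => h1 (TopologicalSpace.denseSeq (L2v N) m), slice_zero]
    with x hx h0
  rw [h0]
  refine (TopologicalSpace.denseRange_denseSeq (L2v N)).eq_zero_of_inner_left ℝ fun m => ?_
  rw [real_inner_comm]
  exact hx m

/-! ### The flows on `L²` -/

/-- With the factors exchanged this is a skew product: a translation in `v`, and for each `v` a
translation in `x`. -/
lemma measurePreserving_flow {N : ℕ} (X : Drift N) (s : ℝ) :
    MeasurePreserving (X.flow s) (volume : Measure (Tor N × Vel N)) volume := by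
  have h1 : MeasurePreserving (fun p : Vel N × Tor N =>
      (p.1 + s • X.w, p.2 + mkT (s • (X.a + X.B p.1)))) (volume.prod volume)
      (volume.prod volume) := by
    refine (measurePreserving_add_right volume (s • X.w)).skew_product
      (g := fun v x => x + mkT (s • (X.a + X.B v))) ?_ ?_
    · have := continuous_mkT (N := N)
      have hc : Continuous fun p : Vel N × Tor N => p.2 + mkT (s • (X.a + X.B p.1)) := by fun_prop
      exact hc.measurable
    · exact Eventually.of_forall fun v => (measurePreserving_add_right volume _).map_eq
  exact (Measure.measurePreserving_swap.comp h1).comp Measure.measurePreserving_swap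

/-- Translation along the flow, as an isometry of `L²_{x,v}`. -/
def Drift.U {N : ℕ} (X : Drift N) (s : ℝ) : L2xv N →ₗᵢ[ℝ] L2xv N :=
  Lp.compMeasurePreservingₗᵢ ℝ (X.flow s) (measurePreserving_flow X s)

lemma Drift.coeFn_U {N : ℕ} (X : Drift N) (s : ℝ) (f : L2xv N) :
    X.U s f =ᵐ[volume] fun p => f (X.flow s p) :=
  Lp.coeFn_compMeasurePreserving f (measurePreserving_flow X s)

lemma Drift.U_add {N : ℕ} (X : Drift N) (s t : ℝ) (f : L2xv N) :
    X.U s (X.U t f) = X.U (t + s) f := by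
  refine Lp.ext ?_
  filter_upwards [X.coeFn_U s (X.U t f), X.coeFn_U (t + s) f,
    (measurePreserving_flow X s).quasiMeasurePreserving.ae (X.coeFn_U t f)] with p h1 h2 h3
  rw [h1, h2, h3, X.flow_add]

lemma Drift.U_zero {N : ℕ} (X : Drift N) (f : L2xv N) : X.U 0 f = f := by
  refine Lp.ext ?_
  filter_upwards [X.coeFn_U 0 f] with p h1
  rw [h1, X.flow_zero]

lemma Drift.inner_U {N : ℕ} (X : Drift N) (s : ℝ) (f g : L2xv N) :
    ⟪X.U s f, g⟫_ℝ = ⟪f, X.U (-s) g⟫_ℝ := by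
  rw [← (X.U (-s)).inner_map_map, X.U_add]
  simp [X.U_zero]

lemma xField_flow {N : ℕ} (i : Fin N) (s : ℝ) (p : Tor N × Vel N) :
    (xField i).flow s p = (p.1 + mkT (s • Pi.single i 1), p.2) := by
  simp [Drift.flow, xField]

lemma slice_xField_U {N : ℕ} (i : Fin N) (s : ℝ) (f : L2xv N) :
    ∀ᵐ x : Tor N, slice ((xField i).U s f) x = slice f (x + mkT (s • Pi.single i 1)) := by
  refine ae_slice_eq ?_
  have hq := (measurePreserving_add_right (volume : Measure (Tor N))
    (mkT (s • Pi.single i 1))).quasiMeasurePreserving.ae (ae_coeFn_slice f)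
  filter_upwards [ae_ae_of_ae ((xField i).coeFn_U s f), hq] with x h1 h2
  filter_upwards [h1, h2] with v h1 h2
  rw [h1, h2, xField_flow]

/-! ### The Poincaré inequality -/

/-- Invariance of the measure moves the translation onto the character, which only picks up a phase.
Differentiating the phase in `s` gives the multiplier of `∂_{x_i}`. -/
lemma fcoef_U {N : ℕ} (n : Fin N → ℤ) (u : L2v N) (i : Fin N) (s : ℝ) (f : L2xv N) :
    fcoef n u ((xField i).U s f) =
      Complex.exp (-(2 * Real.pi * Complex.I * n i) * s) * fcoef n u f := by
  rw [fcoef_eq_integral, fcoef_eq_integral]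
  have hF (x : Tor N) : UnitAddTorus.mFourier n x =
      Complex.exp (-(2 * Real.pi * Complex.I * n i) * s) *
        UnitAddTorus.mFourier n (x + mkT (s • Pi.single i 1)) := by
    obtain ⟨y, rfl⟩ := mkT_surjective x
    rw [← mkT_add, mFourier_mkT, mFourier_mkT]
    have : ∏ m, Complex.exp (2 * Real.pi * Complex.I * n m * ((y + s • (Pi.single i 1 : Fin N → ℝ)) m : ℝ)) =
        (∏ m, Complex.exp (2 * Real.pi * Complex.I * n m * y m)) *
          Complex.exp ((2 * Real.pi * Complex.I * n i) * s) := by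
      rw [← Complex.exp_sum, ← Complex.exp_sum, ← Complex.exp_add]
      congr 1
      simp only [Pi.add_apply, Pi.smul_apply, smul_eq_mul, Complex.ofReal_add, mul_add,
        Finset.sum_add_distrib]
      congr 1
      rw [Finset.sum_eq_single i]
      · simp
      · intro m _ hm; simp [hm]
      · simp
    have hc : ∀ z P : ℂ, P = Complex.exp (-z * s) * (P * Complex.exp (z * s)) := fun z P => by
      rw [mul_left_comm, ← Complex.exp_add]
      simp
    rw [this]
    exact hc _ _
  have h1 : ∫ x, UnitAddTorus.mFourier n x * (⟪u, slice ((xField i).U s f) x⟫_ℝ : ℂ) =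
      ∫ x : Tor N, (fun x => Complex.exp (-(2 * Real.pi * Complex.I * n i) * s) *
        (UnitAddTorus.mFourier n x * (⟪u, slice f x⟫_ℝ : ℂ))) (x + mkT (s • Pi.single i 1)) := by
    refine integral_congr_ae ?_
    filter_upwards [slice_xField_U i s f] with x hx
    rw [hx, hF x]
    simp only [mul_assoc]
  have h2 := integral_add_right_eq_self (μ := (volume : Measure (Tor N)))
    (fun x => Complex.exp (-(2 * Real.pi * Complex.I * n i) * s) *
      (UnitAddTorus.mFourier n x * (⟪u, slice f x⟫_ℝ : ℂ))) (mkT (s • Pi.single i 1))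
  exact (h1.trans h2).trans (integral_const_mul _ _)

lemma fcoef_deriv {N : ℕ} (n : Fin N → ℤ) (u : L2v N) (i : Fin N) {f g : L2xv N}
    (h : HasDerivAt (fun s => (xField i).U s f) g 0) :
    fcoef n u g = -(2 * Real.pi * Complex.I * n i) * fcoef n u f := by
  have h1 : HasDerivAt (fun s => fcoef n u ((xField i).U s f)) (fcoef n u g) (0 : ℝ) := by
    have e1 := ((innerSL ℝ (tens (memLp_cosT n) u)).hasFDerivAt.comp_hasDerivAt (0 : ℝ) h).ofReal_comp
    have e2 := ((innerSL ℝ (tens (memLp_sinT n) u)).hasFDerivAt.comp_hasDerivAt (0 : ℝ) h).ofReal_comp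
    exact e1.add (e2.mul_const Complex.I)
  have h2 : HasDerivAt (fun s : ℝ => Complex.exp (-(2 * Real.pi * Complex.I * n i) * s) *
      fcoef n u f) (-(2 * Real.pi * Complex.I * n i) * fcoef n u f) (0 : ℝ) := by
    have e1 : HasDerivAt (fun s : ℝ => -(2 * Real.pi * Complex.I * n i) * (s : ℂ))
        (-(2 * Real.pi * Complex.I * n i) * 1) (0 : ℝ) :=
      (HasDerivAt.ofReal_comp (hasDerivAt_id (0 : ℝ))).const_mul _
    simpa using e1.cexp.mul_const (fcoef n u f)
  simp only [fcoef_U] at h1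
  exact h1.unique h2

/-- The Poincaré inequality for `x ↦ ⟨u, f(x,·)⟩`. -/
theorem poincare {N : ℕ} (u : L2v N) {f : L2xv N} {g : Fin N → L2xv N}
    (h : ∀ i, HasDerivAt (fun s => (xField i).U s f) (g i) 0)
    (h0 : ∫ x : Tor N, ⟪u, slice f x⟫_ℝ = 0) :
    ∫ x : Tor N, ⟪u, slice f x⟫_ℝ ^ 2 ≤ ∑ i, ∫ x : Tor N, ⟪u, slice (g i) x⟫_ℝ ^ 2 := by
  have hs (f : L2xv N) : HasSum (fun n : Fin N → ℤ => ‖fcoef (-n) u f‖ ^ 2)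
      (∫ x : Tor N, ⟪u, slice f x⟫_ℝ ^ 2) := by
    have := parseval (memLp_inner_slice_ofReal u f)
    simp only [← fcoef_eq_integral] at this
    simpa using this
  refine hasSum_le (fun n => ?_) (hs f) (hasSum_sum fun i _ => hs (g i))
  -- The zero mode vanishes by the mean zero hypothesis; any other mode has some `n i ≠ 0`, and then
  -- `|2π n i| ≥ 1` makes a single coordinate derivative sufficient.
  by_cases hn : n = 0
  · subst hn
    have : fcoef (-0) u f = 0 := by
      rw [fcoef_eq_integral, neg_zero, UnitAddTorus.mFourier_zero]
      simp only [ContinuousMap.one_apply, one_mul]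
      rw [integral_complex_ofReal, h0, Complex.ofReal_zero]
    rw [this]
    simpa using Finset.sum_nonneg fun i _ => by positivity
  · obtain ⟨i, hi⟩ := Function.ne_iff.1 hn
    refine le_trans ?_ (Finset.single_le_sum (f := fun i => ‖fcoef (-n) u (g i)‖ ^ 2)
      (fun i _ => by positivity) (Finset.mem_univ i))
    rw [fcoef_deriv _ u i (h i)]
    refine pow_le_pow_left₀ (norm_nonneg _) ?_ 2
    rw [norm_mul]
    refine le_mul_of_one_le_left (norm_nonneg _) ?_
    have h1 : (1 : ℝ) ≤ |(n i : ℝ)| := by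
      exact_mod_cast Int.one_le_abs hi
    have h2 := Real.pi_gt_three
    simp only [norm_neg, norm_mul, Complex.norm_ofNat, Complex.norm_real, Complex.norm_I, mul_one,
      Real.norm_eq_abs, abs_of_pos Real.pi_pos, Pi.neg_apply, Int.cast_neg, Complex.norm_intCast]
    nlinarith

/-! ### Test functions in `L²_{x,v}` -/

lemma IsTest.memLp {N : ℕ} {ψ : Tor N × Vel N → ℝ} (h : IsTest ψ) :
    MemLp ψ 2 (volume : Measure (Tor N × Vel N)) := by
  have : IsFiniteMeasureOnCompacts (volume : Measure (Tor N × Vel N)) :=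
    inferInstanceAs (IsFiniteMeasureOnCompacts
      ((volume : Measure (Tor N)).prod (volume : Measure (Vel N))))
  exact h.continuous.memLp_of_hasCompactSupport h.2

/-- A test function as an element of `L²_{x,v}`. -/
def IsTest.toL2 {N : ℕ} {ψ : Tor N × Vel N → ℝ} (h : IsTest ψ) : L2xv N := h.memLp.toLp ψ

lemma IsTest.inner_toL2 {N : ℕ} {ψ : Tor N × Vel N → ℝ} (h : IsTest ψ) (f : L2xv N) :
    ⟪f, h.toL2⟫_ℝ = ∫ p, f p * ψ p := by
  rw [L2.inner_def]
  refine integral_congr_ae ?_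
  filter_upwards [h.memLp.coeFn_toLp] with p hp
  simp only [IsTest.toL2]
  rw [hp]
  simp [mul_comm]

lemma IsTest.integrable_mul {N : ℕ} {ψ : Tor N × Vel N → ℝ} (h : IsTest ψ) (f : L2xv N) :
    Integrable (fun p => f p * ψ p) :=
  (Lp.memLp f).integrable_mul h.memLp

lemma Drift.U_toL2 {N : ℕ} (X : Drift N) (s : ℝ) {ψ : Tor N × Vel N → ℝ} (h : IsTest ψ) :
    X.U s h.toL2 = (h.comp_flow X s).toL2 := by
  refine Lp.ext ?_
  filter_upwards [X.coeFn_U s h.toL2, (h.comp_flow X s).memLp.coeFn_toLp,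
    (measurePreserving_flow X s).quasiMeasurePreserving.ae h.memLp.coeFn_toLp] with p h1 h2 h3
  rw [h1]
  exact h3.trans h2.symm

/-- The subspace of test functions. -/
def testSub (N : ℕ) : Submodule ℝ (L2xv N) where
  carrier := {f | ∃ (ψ : Tor N × Vel N → ℝ) (h : IsTest ψ), h.toL2 = f}
  add_mem' := by
    rintro _ _ ⟨ψ, h, rfl⟩ ⟨χ, h', rfl⟩
    exact ⟨_, h.add h', MemLp.toLp_add h.memLp h'.memLp⟩
  zero_mem' := ⟨0, isTest_zero, MemLp.toLp_zero _⟩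
  smul_mem' := by
    rintro c _ ⟨ψ, h, rfl⟩
    exact ⟨_, h.smul c, MemLp.toLp_const_smul c h.memLp⟩

lemma dense_testSub (N : ℕ) : Dense (testSub N : Set (L2xv N)) := by
  rw [Submodule.dense_iff_topologicalClosure_eq_top, Submodule.topologicalClosure_eq_top_iff,
    Submodule.eq_bot_iff]
  intro f hf
  refine eq_zero_of_test fun ψ h => ?_
  rw [← h.inner_toL2, real_inner_comm]
  exact (Submodule.mem_orthogonal _ _).1 hf _ ⟨ψ, h, rfl⟩

lemma Drift.hasDerivAt_integral {N : ℕ} (X : Drift N) (f : L2xv N) {ψ : Tor N × Vel N → ℝ}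
    (h : IsTest ψ) (s₀ : ℝ) :
    HasDerivAt (fun s => ∫ p, f p * ψ (X.flow s p)) (∫ p, f p * X.D ψ (X.flow s₀ p)) s₀ := by
  obtain ⟨M, hM0, hM⟩ := (h.D X).bounded
  obtain ⟨R, hR⟩ := (isTest_iff.1 (h.D X)).2
  -- For `|s - s₀| < 1` the velocity moves by at most `(|s₀| + 1)‖w‖`, so all the translated
  -- derivatives live in one set of finite measure. This gives the dominating function `|f| M 1_S`.
  let R' := R + (|s₀| + 1) * ‖X.w‖
  let S : Set (Tor N × Vel N) := univ ×ˢ Metric.closedBall 0 R'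
  have hS : MeasurableSet S := MeasurableSet.univ.prod measurableSet_closedBall
  have hSfin : (volume : Measure (Tor N × Vel N)) S ≠ ⊤ := by
    rw [volume_tor_vel, Measure.prod_prod]
    refine ENNReal.mul_ne_top (measure_ne_top _ _) ?_
    exact (isCompact_closedBall (0 : Vel N) R').measure_lt_top.ne
  have hb : MemLp (S.indicator fun _ => M) 2 (volume : Measure (Tor N × Vel N)) :=
    memLp_indicator_const 2 hS M (Or.inr hSfin)
  have hbound : Integrable (fun p => ‖f p‖ * S.indicator (fun _ => M) p) :=
    (Lp.memLp f).norm.integrable_mul hb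
  refine (hasDerivAt_integral_of_dominated_loc_of_deriv_le
    (F' := fun s p => f p * X.D ψ (X.flow s p)) (Metric.ball_mem_nhds s₀ one_pos) ?_ ?_ ?_ ?_
    hbound ?_).2
  · exact Eventually.of_forall fun s => ((h.comp_flow X s).integrable_mul f).aestronglyMeasurable
  · exact (h.comp_flow X s₀).integrable_mul f
  · exact (((h.D X).comp_flow X s₀).integrable_mul f).aestronglyMeasurable
  · refine Eventually.of_forall fun p s hs => ?_
    rw [norm_mul]
    refine mul_le_mul_of_nonneg_left ?_ (norm_nonneg _)
    by_cases hp : p ∈ S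
    · rw [indicator_of_mem hp]
      exact hM _
    · rw [indicator_of_notMem hp]
      have h1 : R' < ‖p.2‖ := by
        simpa [S] using hp
      have h2 : |s| ≤ |s₀| + 1 := by
        have := abs_sub_abs_le_abs_sub s s₀
        have h3 : |s - s₀| < 1 := by simpa [Real.dist_eq] using hs
        linarith
      have h4 : R < ‖p.2 + s • X.w‖ := by
        have h5 := norm_le_norm_add_norm_sub' p.2 (p.2 + s • X.w)
        simp only [sub_add_cancel_left, norm_neg, norm_smul, Real.norm_eq_abs] at h5
        have h6 := mul_le_mul_of_nonneg_right h2 (norm_nonneg X.w)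
        simp only [R'] at h1
        linarith
      have : X.D ψ (X.flow s p) = 0 := hR _ _ h4
      rw [this, norm_zero]
  · exact Eventually.of_forall fun p s _ => (X.hasDerivAt_flow h p s).const_mul (f p)

/-! ### Weak and strong derivatives along a flow -/

/-- `g` is the weak derivative of `f` along the vector field `X`. -/
def Drift.Weak {N : ℕ} (X : Drift N) (f g : L2xv N) : Prop :=
  ∀ ψ : Tor N × Vel N → ℝ, IsTest ψ → ∫ p, f p * X.D ψ p = - ∫ p, g p * ψ p

/-- `g` is the derivative in `L²` of the translates of `f` along the flow of `X`. -/
def Drift.Strong {N : ℕ} (X : Drift N) (f g : L2xv N) : Prop :=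
  HasDerivAt (fun s => X.U s f) g 0

/-- Weak convergence without excess of norm is strong: `‖q - g‖² ≤ 2‖g‖² - 2⟨q, g⟩` when `‖q‖ ≤
‖g‖`. The norm bound also lets the pairing with `g` be approximated by pairings with elements of
`K`. -/
lemma tendsto_of_inner_dense {V ι : Type*} [NormedAddCommGroup V] [InnerProductSpace ℝ V]
    {l : Filter ι} {q : ι → V} {g : V} {K : Set V} (hK : Dense K)
    (hq : ∀ᶠ s in l, ‖q s‖ ≤ ‖g‖) (h : ∀ ψ ∈ K, Tendsto (fun s => ⟪q s, ψ⟫_ℝ) l (𝓝 ⟪g, ψ⟫_ℝ)) :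
    Tendsto q l (𝓝 g) := by
  have h1 : Tendsto (fun s => ⟪q s, g⟫_ℝ) l (𝓝 ⟪g, g⟫_ℝ) := by
    rw [Metric.tendsto_nhds]
    intro ε hε
    have hε' : 0 < ε / (4 * (‖g‖ + 1)) := by positivity
    obtain ⟨ψ, hψ, hd⟩ := hK.exists_dist_lt g hε'
    filter_upwards [hq, Metric.tendsto_nhds.1 (h ψ hψ) (ε / 2) (by positivity)] with s hs hs'
    rw [dist_eq_norm] at hd
    rw [Real.dist_eq] at hs' ⊢
    have e : ⟪q s, g⟫_ℝ - ⟪g, g⟫_ℝ =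
        ⟪q s, g - ψ⟫_ℝ + (⟪q s, ψ⟫_ℝ - ⟪g, ψ⟫_ℝ) - ⟪g, g - ψ⟫_ℝ := by
      simp only [inner_sub_right]; ring
    have b1 : |⟪q s, g - ψ⟫_ℝ| ≤ ‖g‖ * ‖g - ψ‖ :=
      (abs_real_inner_le_norm _ _).trans (mul_le_mul_of_nonneg_right hs (norm_nonneg _))
    have b2 : |⟪g, g - ψ⟫_ℝ| ≤ ‖g‖ * ‖g - ψ‖ := abs_real_inner_le_norm _ _
    have b3 : ‖g‖ * ‖g - ψ‖ ≤ ε / 4 := by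
      have : (‖g‖ + 1) * ‖g - ψ‖ ≤ ε / 4 := by
        have := mul_le_mul_of_nonneg_left hd.le (by positivity : 0 ≤ ‖g‖ + 1)
        refine this.trans (le_of_eq ?_)
        field_simp
      nlinarith [norm_nonneg (g - ψ)]
    rw [e]
    calc _ ≤ |⟪q s, g - ψ⟫_ℝ + (⟪q s, ψ⟫_ℝ - ⟪g, ψ⟫_ℝ)| + |⟪g, g - ψ⟫_ℝ| := abs_sub _ _
      _ ≤ |⟪q s, g - ψ⟫_ℝ| + |⟪q s, ψ⟫_ℝ - ⟪g, ψ⟫_ℝ| + |⟪g, g - ψ⟫_ℝ| := by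
        gcongr; exact abs_add_le _ _
      _ < ε := by linarith
  have h2 : Tendsto (fun s => 2 * ‖g‖ ^ 2 - 2 * ⟪q s, g⟫_ℝ) l (𝓝 0) := by
    have := (h1.const_mul 2).const_sub (2 * ‖g‖ ^ 2)
    simpa [real_inner_self_eq_norm_sq] using this
  have h3 : Tendsto (fun s => ‖q s - g‖ ^ 2) l (𝓝 0) := by
    refine squeeze_zero' (Eventually.of_forall fun s => by positivity) ?_ h2
    filter_upwards [hq] with s hs
    rw [norm_sub_sq_real]
    have := pow_le_pow_left₀ (norm_nonneg _) hs 2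
    linarith
  have h4 : Tendsto (fun s => ‖q s - g‖) l (𝓝 0) := by
    have := h3.sqrt
    simpa using this
  exact tendsto_iff_norm_sub_tendsto_zero.2 h4

lemma Drift.hasDerivAt_inner_U {N : ℕ} (X : Drift N) (f : L2xv N) {ψ : Tor N × Vel N → ℝ}
    (h : IsTest ψ) (s : ℝ) :
    HasDerivAt (fun s => ⟪X.U s f, h.toL2⟫_ℝ) (-∫ p, f p * X.D ψ (X.flow (-s) p)) s := by
  have h1 : (fun s => ⟪X.U s f, h.toL2⟫_ℝ) = fun s => ∫ p, f p * ψ (X.flow (-s) p) := by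
    funext s
    rw [X.inner_U, X.U_toL2, IsTest.inner_toL2]
  rw [h1]
  have := (X.hasDerivAt_integral f h (-s)).comp s (hasDerivAt_neg s)
  rw [mul_neg_one] at this
  exact this

/-- Weak derivatives along a flow are strong. -/
theorem Drift.Weak.strong {N : ℕ} {X : Drift N} {f g : L2xv N} (h : X.Weak f g) :
    X.Strong f g := by
  have hd {ψ : Tor N × Vel N → ℝ} (hψ : IsTest ψ) (s : ℝ) :
      HasDerivAt (fun s => ⟪X.U s f, hψ.toL2⟫_ℝ) ⟪X.U s g, hψ.toL2⟫_ℝ s := by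
    convert! X.hasDerivAt_inner_U f hψ s using 1
    have := h _ (hψ.comp_flow X (-s))
    rw [X.D_comp_flow] at this
    rw [this, X.inner_U, X.U_toL2, IsTest.inner_toL2, neg_neg]
  -- The constant must be exactly `‖g‖`, so that the difference quotients have norm at most that of
  -- their weak limit. The mean value inequality is applied to the pairings with test functions, and
  -- density extends it to all of `L²`.
  have hlip : ∀ s : ℝ, ‖X.U s f - f‖ ≤ ‖g‖ * |s| := by
    intro s
    have hψ : ∀ ψ ∈ testSub N, ‖⟪X.U s f - f, ψ⟫_ℝ‖ ≤ ‖g‖ * |s| * ‖ψ‖ := by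
      rintro _ ⟨ψ, hψ, rfl⟩
      have := Convex.norm_image_sub_le_of_norm_hasDerivWithin_le
        (f := fun s => ⟪X.U s f, hψ.toL2⟫_ℝ) (f' := fun s => ⟪X.U s g, hψ.toL2⟫_ℝ)
        (C := ‖g‖ * ‖hψ.toL2‖) (s := univ) (x := 0) (y := s)
        (fun r _ => (hd hψ r).hasDerivWithinAt)
        (fun r _ => by simpa using norm_inner_le_norm (𝕜 := ℝ) (X.U r g) hψ.toL2)
        convex_univ (mem_univ _) (mem_univ _)
      simp only [X.U_zero, sub_zero, ← inner_sub_left, Real.norm_eq_abs] at this ⊢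
      linarith
    have hall : ∀ ξ : L2xv N, ‖⟪X.U s f - f, ξ⟫_ℝ‖ ≤ ‖g‖ * |s| * ‖ξ‖ := by
      intro ξ
      have hc : IsClosed {ξ : L2xv N | ‖⟪X.U s f - f, ξ⟫_ℝ‖ ≤ ‖g‖ * |s| * ‖ξ‖} :=
        isClosed_le (by fun_prop) (by fun_prop)
      exact (dense_testSub N).closure_eq ▸ hc.closure_subset_iff.2 hψ <| mem_univ ξ
    have := hall (X.U s f - f)
    rw [real_inner_self_eq_norm_sq, norm_pow, norm_norm, sq] at this
    by_cases h0 : ‖X.U s f - f‖ = 0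
    · rw [h0]; positivity
    · exact le_of_mul_le_mul_right this (lt_of_le_of_ne (norm_nonneg _) (Ne.symm h0))
  rw [Drift.Strong, hasDerivAt_iff_tendsto_slope]
  refine tendsto_of_inner_dense (dense_testSub N) ?_ ?_
  · filter_upwards [self_mem_nhdsWithin] with s hs
    have hs' : 0 < |s| := abs_pos.2 hs
    rw [slope_def_module, sub_zero, X.U_zero, norm_smul, norm_inv, Real.norm_eq_abs,
      inv_mul_le_iff₀ hs', mul_comm]
    exact hlip s
  · rintro _ ⟨ψ, hψ, rfl⟩
    have := hasDerivAt_iff_tendsto_slope.1 (hd hψ 0)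
    rw [X.U_zero] at this
    refine this.congr fun s => ?_
    simp only [slope_def_module, real_inner_smul_left, inner_sub_left, smul_eq_mul]

theorem Drift.Strong.weak {N : ℕ} {X : Drift N} {f g : L2xv N} (h : X.Strong f g) :
    X.Weak f g := by
  intro ψ hψ
  have h1 : HasDerivAt (fun s => ⟪X.U s f, hψ.toL2⟫_ℝ) ⟪g, hψ.toL2⟫_ℝ 0 := by
    have := HasDerivAt.inner ℝ h (hasDerivAt_const (0 : ℝ) hψ.toL2)
    simpa using this
  have h2 := h1.unique (X.hasDerivAt_inner_U f hψ 0)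
  simp only [neg_zero, X.flow_zero] at h2
  rw [← hψ.inner_toL2, h2, neg_neg]

/-- Both sides differentiate `⟨U_s f, f'⟩ = ⟨f, U_{-s} f'⟩` at `s = 0`. For `v·∇_x` this is
skew-symmetry with no decay assumption in `v` beyond the two derivatives being in `L²`. -/
lemma Drift.Strong.inner_eq {N : ℕ} {X : Drift N} {f g f' g' : L2xv N} (h : X.Strong f g)
    (h' : X.Strong f' g') : ⟪g, f'⟫_ℝ = -⟪f, g'⟫_ℝ := by
  have h1 : HasDerivAt (fun s => ⟪X.U s f, f'⟫_ℝ) ⟪g, f'⟫_ℝ 0 := by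
    have := HasDerivAt.inner ℝ h (hasDerivAt_const (0 : ℝ) f')
    simpa using this
  have h0 : HasDerivAt (fun s => X.U s f') g' (-0 : ℝ) := by rw [neg_zero]; exact h'
  have h2 : HasDerivAt (fun s => ⟪f, X.U (-s) f'⟫_ℝ) (-⟪f, g'⟫_ℝ) 0 := by
    have := HasDerivAt.inner ℝ (hasDerivAt_const (0 : ℝ) f) (h0.scomp (0 : ℝ) (hasDerivAt_neg 0))
    simpa using this
  simp only [X.inner_U] at h1
  exact h1.unique h2

/-- Formally this is two integrations by parts, but only first derivatives exist. The second one is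
replaced by differentiating `⟨qy, U_s u⟩ = -⟨q, U_s uy⟩` in `s`, which is legitimate since the flows
commute. In the mixed estimate this avoids any derivative of order `k + 1`. -/
lemma Drift.Strong.inner_swap {N : ℕ} {X Y : Drift N}
    (hXY : ∀ s t p, X.flow s (Y.flow t p) = Y.flow t (X.flow s p)) {q qx qy u ux uy : L2xv N}
    (hqx : X.Strong q qx) (hqy : Y.Strong q qy) (hux : X.Strong u ux) (huy : Y.Strong u uy) :
    ⟪qy, ux⟫_ℝ = ⟪qx, uy⟫_ℝ := by
  have hcomm : ∀ s t f, Y.U t (X.U s f) = X.U s (Y.U t f) := by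
    intro s t f
    refine Lp.ext ?_
    filter_upwards [Y.coeFn_U t (X.U s f), X.coeFn_U s (Y.U t f),
      (measurePreserving_flow X s).quasiMeasurePreserving.ae (Y.coeFn_U t f),
      (measurePreserving_flow Y t).quasiMeasurePreserving.ae (X.coeFn_U s f)] with p h1 h2 h3 h4
    rw [h1, h2, h3, h4, hXY]
  have hY : ∀ s, Y.Strong (X.U s u) (X.U s uy) := by
    intro s
    have := (X.U s).toContinuousLinearMap.hasFDerivAt.comp_hasDerivAt (0 : ℝ) huy
    refine this.congr_of_eventuallyEq (Eventually.of_forall fun t => ?_)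
    exact hcomm s t u
  have h1 : HasDerivAt (fun s => ⟪qy, X.U s u⟫_ℝ) ⟪qy, ux⟫_ℝ 0 := by
    have := HasDerivAt.inner ℝ (hasDerivAt_const (0 : ℝ) qy) hux
    simpa using this
  have h2 : (fun s => ⟪qy, X.U s u⟫_ℝ) = fun s => -⟪q, X.U s uy⟫_ℝ := by
    funext s
    exact hqy.inner_eq (hY s)
  have h0 : HasDerivAt (fun s => X.U s q) qx (-0 : ℝ) := by rw [neg_zero]; exact hqx
  have h3 : HasDerivAt (fun s => -⟪q, X.U s uy⟫_ℝ) ⟪qx, uy⟫_ℝ 0 := by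
    have e : (fun s => -⟪q, X.U s uy⟫_ℝ) = fun s => -⟪X.U (-s) q, uy⟫_ℝ := by
      funext s
      rw [X.inner_U, neg_neg]
    rw [e]
    have := (HasDerivAt.inner ℝ (h0.scomp (0 : ℝ) (hasDerivAt_neg 0))
      (hasDerivAt_const (0 : ℝ) uy)).neg
    convert! this using 1
    simp
  rw [h2] at h1
  exact h1.unique h3

/-- Closed subspaces of `L²_{x,v} × L²_{x,v}` which are invariant under the flow are invariant
under differentiation. -/
lemma Drift.Strong.mem_closed {N : ℕ} {X : Drift N} {M : Submodule ℝ (L2xv N × L2xv N)}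
    (hM : IsClosed (M : Set (L2xv N × L2xv N))) (hU : ∀ s f q, (f, q) ∈ M → (X.U s f, X.U s q) ∈ M)
    {f q f' q' : L2xv N} (hf : X.Strong f f') (hq : X.Strong q q') (h : (f, q) ∈ M) :
    (f', q') ∈ M := by
  have h1 := (hasDerivAt_iff_tendsto_slope.1 hf).prodMk_nhds (hasDerivAt_iff_tendsto_slope.1 hq)
  refine hM.mem_of_tendsto h1 (Eventually.of_forall fun s => ?_)
  have h2 := M.smul_mem ((s - 0)⁻¹) (M.sub_mem (hU s f q h) (hU 0 f q h))
  exact h2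

/-! ### Multi-indices -/

lemma len_zero {N : ℕ} : len (0 : Fin N → ℕ) = 0 := by simp [len]

lemma len_add {N : ℕ} (j l : Fin N → ℕ) : len (j + l) = len j + len l := by
  simp [len, Finset.sum_add_distrib]

lemma len_dl {N : ℕ} (m : Fin N) : len (dl m) = 1 := by
  simp [len, dl]

lemma len_eq_zero {N : ℕ} {j : Fin N → ℕ} : len j = 0 ↔ j = 0 := by
  simp [len, funext_iff]

lemma dl_le {N : ℕ} {j : Fin N → ℕ} {m : Fin N} (h : 0 < j m) : dl m ≤ j := by
  intro i
  by_cases hi : i = m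
  · subst hi; simpa [dl] using Nat.succ_le_of_lt h
  · simp [dl, hi]

lemma sub_add_dl {N : ℕ} {j : Fin N → ℕ} {m : Fin N} (h : 0 < j m) : j - dl m + dl m = j :=
  tsub_add_cancel_of_le (dl_le h)

lemma len_sub_dl {N : ℕ} {j : Fin N → ℕ} {m : Fin N} (h : 0 < j m) :
    len (j - dl m) + 1 = len j := by
  rw [← len_dl m, ← len_add, sub_add_dl h]

lemma exists_pos_of_ne_zero {N : ℕ} {j : Fin N → ℕ} (h : j ≠ 0) : ∃ m, 0 < j m := by
  obtain ⟨m, hm⟩ := Function.ne_iff.1 h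
  exact ⟨m, Nat.pos_of_ne_zero hm⟩

lemma midx_induction {N : ℕ} {P : (Fin N → ℕ) → Prop} (h0 : P 0)
    (hs : ∀ j m, P j → P (j + dl m)) (j : Fin N → ℕ) : P j := by
  induction hn : len j generalizing j with
  | zero => rw [len_eq_zero.1 hn]; exact h0
  | succ n ih =>
    have hj : j ≠ 0 := fun h => by rw [h, len_zero] at hn; omega
    obtain ⟨m, hm⟩ := exists_pos_of_ne_zero hj
    rw [← sub_add_dl hm]
    refine hs _ _ (ih _ ?_)
    have := len_sub_dl hm
    omega

lemma mem_midx {N k : ℕ} {l : Fin N → ℕ} : l ∈ midx N k ↔ len l ≤ k := by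
  simp only [midx, Finset.mem_filter, Fintype.mem_piFinset, Finset.mem_range, and_iff_right_iff_imp]
  intro h i
  have : l i ≤ len l := Finset.single_le_sum (f := l) (fun _ _ => Nat.zero_le _) (Finset.mem_univ i)
  omega

lemma mem_midx2 {N k : ℕ} {m : (Fin N → ℕ) × (Fin N → ℕ)} :
    m ∈ midx2 N k ↔ len m.1 + len m.2 ≤ k := by
  simp only [midx2, Finset.mem_filter, Finset.mem_product, mem_midx]
  omega

/-! ### Weak partial derivatives -/

lemma ext_of_test {N : ℕ} {f g : L2xv N}
    (h : ∀ ψ : Tor N × Vel N → ℝ, IsTest ψ → ∫ p, f p * ψ p = ∫ p, g p * ψ p) : f = g := by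
  rw [← sub_eq_zero]
  refine eq_zero_of_test fun ψ hψ => ?_
  rw [← hψ.inner_toL2, inner_sub_left, hψ.inner_toL2, hψ.inner_toL2, h ψ hψ, sub_self]

lemma neg_one_pow_mul_self (n : ℕ) (a : ℝ) : (-1 : ℝ) ^ n * ((-1) ^ n * a) = a := by
  rw [← mul_assoc, ← mul_pow]; simp

lemma HasWeakDeriv.unique {N : ℕ} {j l : Fin N → ℕ} {f g g' : L2xv N} (h : HasWeakDeriv j l f g)
    (h' : HasWeakDeriv j l f g') : g = g' := by
  refine ext_of_test fun ψ hψ => ?_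
  rw [← neg_one_pow_mul_self (len j + len l) (∫ p, g p * ψ p), ← h ψ hψ, h' ψ hψ,
    neg_one_pow_mul_self]

lemma HasWeakDeriv.pd_eq {N : ℕ} {j l : Fin N → ℕ} {f g : L2xv N} (h : HasWeakDeriv j l f g) :
    pd j l f = g := by
  have hex : ∃ g, HasWeakDeriv j l f g := ⟨g, h⟩
  rw [pd, dif_pos hex]
  exact hex.choose_spec.unique h

lemma MemH.hasWeakDeriv {N k : ℕ} {f : L2xv N} (h : MemH k f) {j l : Fin N → ℕ}
    (hjl : len j + len l ≤ k) : HasWeakDeriv j l f (pd j l f) := by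
  obtain ⟨g, hg⟩ := h j l hjl
  rwa [hg.pd_eq]

lemma MemH.mono {N k n : ℕ} {f : L2xv N} (h : MemH k f) (hn : n ≤ k) : MemH n f :=
  fun j l hjl => h j l (hjl.trans hn)

lemma hasWeakDeriv_zero {N : ℕ} (f : L2xv N) : HasWeakDeriv 0 0 f f := by
  intro ψ _
  rw [classD_zero, len_zero]
  simp

lemma pd_zero_zero {N : ℕ} (f : L2xv N) : pd 0 0 f = f := (hasWeakDeriv_zero f).pd_eq

lemma HasWeakDeriv.add {N : ℕ} {j l : Fin N → ℕ} {f g f' g' : L2xv N} (h : HasWeakDeriv j l f g)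
    (h' : HasWeakDeriv j l f' g') : HasWeakDeriv j l (f + f') (g + g') := by
  intro ψ hψ
  rw [← (hψ.classD j l).inner_toL2, ← hψ.inner_toL2, inner_add_left, inner_add_left,
    (hψ.classD j l).inner_toL2, (hψ.classD j l).inner_toL2, hψ.inner_toL2, hψ.inner_toL2,
    h ψ hψ, h' ψ hψ]
  ring

lemma HasWeakDeriv.smul {N : ℕ} {j l : Fin N → ℕ} {f g : L2xv N} (h : HasWeakDeriv j l f g)
    (c : ℝ) : HasWeakDeriv j l (c • f) (c • g) := by
  intro ψ hψ
  rw [← (hψ.classD j l).inner_toL2, ← hψ.inner_toL2, real_inner_smul_left, real_inner_smul_left,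
    (hψ.classD j l).inner_toL2, hψ.inner_toL2, h ψ hψ]
  ring

lemma MemH.add {N k : ℕ} {f g : L2xv N} (hf : MemH k f) (hg : MemH k g) : MemH k (f + g) :=
  fun _ _ h => ⟨_, (hf.hasWeakDeriv h).add (hg.hasWeakDeriv h)⟩

lemma MemH.smul {N k : ℕ} {f : L2xv N} (hf : MemH k f) (c : ℝ) : MemH k (c • f) :=
  fun _ _ h => ⟨_, (hf.hasWeakDeriv h).smul c⟩

lemma pd_add {N k : ℕ} {f g : L2xv N} (hf : MemH k f) (hg : MemH k g) {j l : Fin N → ℕ}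
    (h : len j + len l ≤ k) : pd j l (f + g) = pd j l f + pd j l g :=
  ((hf.hasWeakDeriv h).add (hg.hasWeakDeriv h)).pd_eq

lemma pd_smul {N k : ℕ} {f : L2xv N} (hf : MemH k f) (c : ℝ) {j l : Fin N → ℕ}
    (h : len j + len l ≤ k) : pd j l (c • f) = c • pd j l f :=
  ((hf.hasWeakDeriv h).smul c).pd_eq

/-- Reduces weak derivatives of any order to first order weak derivatives along a field, to which
the flow calculus applies. -/
lemma HasWeakDeriv.weak_v {N : ℕ} {j l : Fin N → ℕ} {m : Fin N} {f g g' : L2xv N}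
    (h : HasWeakDeriv j l f g) (h' : HasWeakDeriv (j + dl m) l f g') :
    (vField m).Weak g g' := by
  intro ψ hψ
  have h1 := h _ (hψ.vD m)
  rw [← classD_add_v hψ, h' ψ hψ, len_add, len_dl] at h1
  rw [← vD_eq, ← neg_one_pow_mul_self (len j + len l) (∫ p, g p * vD m ψ p), ← h1,
    show len j + 1 + len l = len j + len l + 1 by ring, pow_succ]
  rw [mul_assoc, neg_one_pow_mul_self]
  ring

lemma HasWeakDeriv.weak_x {N : ℕ} {j l : Fin N → ℕ} {m : Fin N} {f g g' : L2xv N}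
    (h : HasWeakDeriv j l f g) (h' : HasWeakDeriv j (l + dl m) f g') :
    (xField m).Weak g g' := by
  intro ψ hψ
  have h1 := h _ (hψ.xD m)
  rw [← classD_add_x hψ, h' ψ hψ, len_add, len_dl] at h1
  rw [← xD_eq, ← neg_one_pow_mul_self (len j + len l) (∫ p, g p * xD m ψ p), ← h1,
    ← add_assoc, pow_succ]
  rw [mul_assoc, neg_one_pow_mul_self]
  ring

lemma HasWeakDeriv.step_v {N : ℕ} {j l : Fin N → ℕ} {m : Fin N} {f g g' : L2xv N}
    (h : HasWeakDeriv j l f g) (h' : (vField m).Weak g g') : HasWeakDeriv (j + dl m) l f g' := by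
  intro ψ hψ
  rw [classD_add_v hψ, h _ (hψ.vD m), vD_eq, h' ψ hψ, len_add, len_dl]
  ring

lemma HasWeakDeriv.step_x {N : ℕ} {j l : Fin N → ℕ} {m : Fin N} {f g g' : L2xv N}
    (h : HasWeakDeriv j l f g) (h' : (xField m).Weak g g') : HasWeakDeriv j (l + dl m) f g' := by
  intro ψ hψ
  rw [classD_add_x hψ, h _ (hψ.xD m), xD_eq, h' ψ hψ, len_add, len_dl]
  ring

lemma MemH.weak_v {N k : ℕ} {f : L2xv N} (h : MemH k f) {j l : Fin N → ℕ} (m : Fin N)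
    (hjl : len j + len l + 1 ≤ k) : (vField m).Weak (pd j l f) (pd (j + dl m) l f) :=
  (h.hasWeakDeriv (by omega)).weak_v (h.hasWeakDeriv (by rw [len_add, len_dl]; omega))

lemma MemH.weak_x {N k : ℕ} {f : L2xv N} (h : MemH k f) {j l : Fin N → ℕ} (m : Fin N)
    (hjl : len j + len l + 1 ≤ k) : (xField m).Weak (pd j l f) (pd j (l + dl m) f) :=
  (h.hasWeakDeriv (by omega)).weak_x (h.hasWeakDeriv (by rw [len_add, len_dl]; omega))

/-! ### The transport operator -/

lemma Drift.weak_zero {N : ℕ} (X : Drift N) : X.Weak 0 0 := by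
  intro ψ hψ
  rw [← (hψ.D X).inner_toL2, ← hψ.inner_toL2, inner_zero_left, inner_zero_left, neg_zero]

lemma Drift.Weak.smul {N : ℕ} {X : Drift N} {f g : L2xv N} (h : X.Weak f g) (c : ℝ) :
    X.Weak (c • f) (c • g) := by
  intro ψ hψ
  rw [← (hψ.D X).inner_toL2, ← hψ.inner_toL2, real_inner_smul_left, real_inner_smul_left,
    (hψ.D X).inner_toL2, hψ.inner_toL2, h ψ hψ, mul_neg]

lemma weak_tField_of_x {N : ℕ} {m : Fin N} {f g f' g' : L2xv N} (h : tField.Weak f g)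
    (hf : (xField m).Weak f f') (hg : (xField m).Weak g g') : tField.Weak f' g' := by
  intro ψ hψ
  have h1 := hf _ (hψ.D tField)
  have h2 := h _ (hψ.xD m)
  have h3 := hg _ hψ
  rw [← xD_eq] at h1 h3
  rw [xD_tField m hψ] at h1
  linarith

/-- The dual form of `[∂_{v_m}, v·∇_x] = ∂_{x_m}`: the commutator acts on the test function only, so
no second derivative of `f` is formed. -/
lemma weak_tField_of_v {N : ℕ} {m : Fin N} {f g f' g' fx : L2xv N} (h : tField.Weak f g)
    (hf : (vField m).Weak f f') (hg : (vField m).Weak g g') (hx : (xField m).Weak f fx) :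
    tField.Weak f' (g' - fx) := by
  intro ψ hψ
  have h1 := hf _ (hψ.D tField)
  have h2 := h _ (hψ.vD m)
  have h3 := hg _ hψ
  have h4 := hx _ hψ
  rw [← vD_eq] at h1 h3
  rw [← xD_eq] at h4
  have h5 : ∫ p, f p * vD m (tField.D ψ) p =
      (∫ p, f p * tField.D (vD m ψ) p) + ∫ p, f p * xD m ψ p := by
    rw [vD_tField m hψ, ← integral_add (((hψ.vD m).D _).integrable_mul f)
      ((hψ.xD m).integrable_mul f)]
    simp only [Pi.add_apply, mul_add]
  have h6 : ∫ p, (g' - fx : L2xv N) p * ψ p = (∫ p, g' p * ψ p) - ∫ p, fx p * ψ p := by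
    rw [← hψ.inner_toL2, inner_sub_left, hψ.inner_toL2, hψ.inner_toL2]
  linarith

/-- The growing factor `v_i` is attached to the test function, which stays a test function; then the
weak `x`-derivatives of `f` can be used one coordinate at a time. -/
lemma weak_tField_transport {N : ℕ} {f τ : L2xv N} (hf : MemH 1 f)
    (h : ∀ᵐ p, τ p = transport f p) : tField.Weak f τ := by
  intro ψ hψ
  have hx (i : Fin N) : ∫ p, f p * xD i (fun p => p.2 i * ψ p) p =
      - ∫ p, pd 0 (dl i) f p * (p.2 i * ψ p) := by
    have := hf.weak_x (j := 0) (l := 0) i (by simp [len_zero]) _ (hψ.coord_mul i)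
    rwa [pd_zero_zero, zero_add, ← xD_eq] at this
  have h1 : ∫ p, f p * tField.D ψ p = ∑ i, ∫ p, f p * xD i (fun p => p.2 i * ψ p) p := by
    rw [tField_D_eq hψ, ← integral_finsetSum _ fun i _ =>
      ((hψ.coord_mul i).xD i).integrable_mul f]
    simp only [Finset.sum_apply, Finset.mul_sum]
  have h2 : ∫ p, τ p * ψ p = ∑ i, ∫ p, pd 0 (dl i) f p * (p.2 i * ψ p) := by
    rw [← integral_finsetSum _ fun i _ => (hψ.coord_mul i).integrable_mul _]
    refine integral_congr_ae ?_
    filter_upwards [h] with p hp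
    rw [hp, transport, Finset.sum_mul]
    exact Finset.sum_congr rfl fun i _ => by ring
  rw [h1, h2]
  simp only [hx, Finset.sum_neg_distrib]

/-- The commutator of the transport operator with the weak derivatives. -/
theorem weak_tField_pd {N k : ℕ} {f τ : L2xv N} (hf : MemH k f) (hτ : MemH k τ)
    (h : tField.Weak f τ) (j l : Fin N → ℕ) (hjl : len j + len l ≤ k) :
    tField.Weak (pd j l f)
      (pd j l τ - ∑ i, (j i : ℝ) • pd (j - dl i) (l + dl i) f) := by
  induction j using midx_induction generalizing l with
  | h0 =>
    simp only [Pi.zero_apply, Nat.cast_zero, zero_smul, Finset.sum_const_zero, sub_zero]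
    induction l using midx_induction with
    | h0 => rwa [pd_zero_zero, pd_zero_zero]
    | hs l m ih =>
      have hl : len (0 : Fin N → ℕ) + len l + 1 ≤ k := by
        rw [len_add, len_dl] at hjl; omega
      exact weak_tField_of_x (ih (by omega)) (hf.weak_x m hl) (hτ.weak_x m hl)
  | hs j m ih =>
    have hl : len j + len l + 1 ≤ k := by
      rw [len_add, len_dl] at hjl; omega
    have hsum : (vField m).Weak (pd j l τ - ∑ i, (j i : ℝ) • pd (j - dl i) (l + dl i) f)
        (pd (j + dl m) l τ - ∑ i, (j i : ℝ) • pd (j - dl i + dl m) (l + dl i) f) := by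
      have h1 : ∀ i, (vField m).Weak ((j i : ℝ) • pd (j - dl i) (l + dl i) f)
          ((j i : ℝ) • pd (j - dl i + dl m) (l + dl i) f) := by
        intro i
        -- When `j i = 0` the truncated subtraction leaves `j` unchanged, and the corresponding
        -- derivative may exceed the available order; its coefficient `j i` removes it.
        rcases Nat.eq_zero_or_pos (j i) with h0 | h0
        · rw [h0, Nat.cast_zero, zero_smul, zero_smul]
          exact Drift.weak_zero _
        · have h2 : (vField m).Weak (pd (j - dl i) (l + dl i) f)
              (pd (j - dl i + dl m) (l + dl i) f) := by
            refine hf.weak_v m ?_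
            have := len_sub_dl h0
            rw [len_add, len_dl]
            omega
          exact h2.smul _
      have h3 : (vField m).Strong (pd j l τ - ∑ i, (j i : ℝ) • pd (j - dl i) (l + dl i) f)
          (pd (j + dl m) l τ - ∑ i, (j i : ℝ) • pd (j - dl i + dl m) (l + dl i) f) := by
        have h4 := (hτ.weak_v m hl).strong.sub (HasDerivAt.fun_sum (u := Finset.univ)
          fun i _ => (h1 i).strong)
        refine h4.congr_of_eventuallyEq (Eventually.of_forall fun s => ?_)
        simp [map_sub, map_sum]
      exact h3.weak
    have key := weak_tField_of_v (ih l (by omega)) (hf.weak_v m hl) hsum (hf.weak_x m hl)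
    convert! key using 1
    rw [sub_sub]
    congr 1
    -- Raising `j m` by one creates exactly one additional commutator, `∂_{x_m}` applied to `∂^j_l
    -- f`; the other terms are differentiated in `v_m`.
    have e : ∀ i, ((j + dl m) i : ℝ) • pd (j + dl m - dl i) (l + dl i) f =
        (j i : ℝ) • pd (j - dl i + dl m) (l + dl i) f +
          if i = m then pd j (l + dl m) f else 0 := by
      intro i
      by_cases hi : i = m
      · subst hi
        have h1 : j + dl i - dl i = j := add_tsub_cancel_right _ _
        have h2 : ((j + dl i) i : ℝ) = (j i : ℝ) + 1 := by simp [dl]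
        rw [h1, h2, add_smul, one_smul, if_pos rfl]
        congr 1
        rcases Nat.eq_zero_or_pos (j i) with h0 | h0
        · simp [h0]
        · rw [sub_add_dl h0]
      · have h2 : (j + dl m) i = j i := by simp [dl, hi]
        rw [h2, if_neg hi, add_zero]
        rcases Nat.eq_zero_or_pos (j i) with h0 | h0
        · simp [h0]
        · rw [tsub_add_eq_add_tsub (dl_le h0)]
    simp only [e, Finset.sum_add_distrib, Finset.sum_ite_eq', Finset.mem_univ, if_true]

/-! ### Closed fibrewise conditions -/

/-- Pairs of functions satisfying fibrewise a condition. -/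
def fiberSub {N : ℕ} (G : Submodule ℝ (L2v N × L2v N)) : Submodule ℝ (L2xv N × L2xv N) where
  carrier := {p | ∀ᵐ x : Tor N, (slice p.1 x, slice p.2 x) ∈ G}
  add_mem' := by
    intro p q hp hq
    filter_upwards [hp, hq, slice_add p.1 q.1, slice_add p.2 q.2] with x h1 h2 h3 h4
    rw [Prod.fst_add, Prod.snd_add, h3, h4]
    exact G.add_mem h1 h2
  zero_mem' := by
    filter_upwards [slice_zero (N := N)] with x h
    rw [Prod.fst_zero, Prod.snd_zero, h]
    exact G.zero_mem
  smul_mem' := by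
    intro c p hp
    filter_upwards [hp, slice_smul c p.1, slice_smul c p.2] with x h1 h3 h4
    rw [Prod.smul_fst, Prod.smul_snd, h3, h4]
    exact G.smul_mem c h1

lemma mem_fiberSub {N : ℕ} {G : Submodule ℝ (L2v N × L2v N)} {f q : L2xv N} :
    (f, q) ∈ fiberSub G ↔ ∀ᵐ x : Tor N, (slice f x, slice q x) ∈ G := Iff.rfl

/-- Convergence in `L²_{x,v}` gives convergence of almost every slice along a subsequence, extracted
twice for the two components, and the fibre condition is closed. -/
lemma isClosed_fiberSub {N : ℕ} {G : Submodule ℝ (L2v N × L2v N)}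
    (hG : IsClosed (G : Set (L2v N × L2v N))) :
    IsClosed (fiberSub G : Set (L2xv N × L2xv N)) := by
  refine IsSeqClosed.isClosed fun p q hp hpq => ?_
  obtain ⟨ns, hns, h1⟩ := exists_subseq_slice_tendsto
    ((continuous_fst.tendsto q).comp hpq)
  obtain ⟨ms, hms, h2⟩ := exists_subseq_slice_tendsto
    (((continuous_snd.tendsto q).comp hpq).comp hns.tendsto_atTop)
  have h3 : ∀ᵐ x : Tor N, ∀ n, (slice (p n).1 x, slice (p n).2 x) ∈ G := ae_all_iff.2 hp
  change ∀ᵐ x : Tor N, (slice q.1 x, slice q.2 x) ∈ G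
  filter_upwards [h1, h2, h3] with x h1 h2 h3
  exact hG.mem_of_tendsto ((h1.comp hms.tendsto_atTop).prodMk_nhds h2)
    (Eventually.of_forall fun n => h3 (ns (ms n)))

lemma U_mem_fiberSub {N : ℕ} {G : Submodule ℝ (L2v N × L2v N)} (i : Fin N) (s : ℝ) {f q : L2xv N}
    (h : (f, q) ∈ fiberSub G) : ((xField i).U s f, (xField i).U s q) ∈ fiberSub G := by
  rw [mem_fiberSub] at h ⊢
  have hq := (measurePreserving_add_right (volume : Measure (Tor N))
    (mkT (s • Pi.single i 1))).quasiMeasurePreserving.ae h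
  filter_upwards [hq, slice_xField_U i s f, slice_xField_U i s q] with x h1 h2 h3
  rw [h2, h3]
  exact h1

/-- Closed fibrewise linear conditions are preserved by the `x`-derivatives. -/
theorem pd_mem_fiberSub {N k : ℕ} {G : Submodule ℝ (L2v N × L2v N)}
    (hG : IsClosed (G : Set (L2v N × L2v N))) {f q : L2xv N} (hf : MemH k f) (hq : MemH k q)
    (h : (f, q) ∈ fiberSub G) (l : Fin N → ℕ) (hl : len l ≤ k) :
    (pd 0 l f, pd 0 l q) ∈ fiberSub G := by
  induction l using midx_induction with
  | h0 => rwa [pd_zero_zero, pd_zero_zero]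
  | hs l m ih =>
    have hl' : len (0 : Fin N → ℕ) + len l + 1 ≤ k := by
      rw [len_add, len_dl] at hl; rw [len_zero]; omega
    exact Drift.Strong.mem_closed (isClosed_fiberSub hG) (fun s _ _ => U_mem_fiberSub m s)
      (hf.weak_x m hl').strong (hq.weak_x m hl').strong (ih (by rw [len_zero] at hl'; omega))

lemma acts_iff_fiberSub {N : ℕ} {A : L2v N →ₗ.[ℝ] L2v N} {f q : L2xv N} :
    Acts A f q ↔ (f, q) ∈ fiberSub A.graph := by
  rw [mem_fiberSub, Acts]
  refine eventually_congr (Eventually.of_forall fun x => ?_)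
  simp only [LinearPMap.mem_graph_iff]
  constructor
  · rintro ⟨hx, h⟩; exact ⟨⟨_, hx⟩, rfl, h⟩
  · rintro ⟨⟨y, hy⟩, rfl, h⟩; exact ⟨hy, h⟩

/-- The graph is a closed linear condition on fibres, preserved by translations in `x` and hence by
limits of difference quotients. This makes the fibrewise properties of `L` available for `∂^0_l h`.
-/
lemma Acts.pd {N k : ℕ} {A : L2v N →ₗ.[ℝ] L2v N} (hA : A.IsClosed) {f q : L2xv N} (hf : MemH k f)
    (hq : MemH k q) (h : Acts A f q) (l : Fin N → ℕ) (hl : len l ≤ k) :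
    Acts A (pd 0 l f) (pd 0 l q) :=
  acts_iff_fiberSub.2 (pd_mem_fiberSub hA hf hq (acts_iff_fiberSub.1 h) l hl)

lemma inner_slice_pd_eq_zero {N k : ℕ} (u : L2v N) {q : L2xv N} (hq : MemH k q)
    (h : ∀ᵐ x : Tor N, ⟪u, slice q x⟫_ℝ = 0) (l : Fin N → ℕ) (hl : len l ≤ k) :
    ∀ᵐ x : Tor N, ⟪u, slice (pd 0 l q) x⟫_ℝ = 0 := by
  let F : L2v N × L2v N →L[ℝ] ℝ := (innerSL ℝ u).comp (ContinuousLinearMap.snd ℝ _ _)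
  have hG : IsClosed ((LinearMap.ker F.toLinearMap : Submodule ℝ (L2v N × L2v N)) :
      Set (L2v N × L2v N)) := F.isClosed_ker
  have h1 : (q, q) ∈ fiberSub (LinearMap.ker F.toLinearMap) := h
  exact pd_mem_fiberSub hG hq hq h1 l hl

/-! ### The `Λ`-norm -/

lemma IsExtNorm.measurable_slice {N : ℕ} {nΛ : L2v N → ℝ≥0∞} (hn : IsExtNorm nΛ) (f : L2xv N) :
    Measurable fun x : Tor N => nΛ (slice f x) := by
  let _ : MeasurableSpace (L2v N) := borel (L2v N)
  have : BorelSpace (L2v N) := ⟨rfl⟩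
  exact Measurable.comp hn.measurable (stronglyMeasurable_slice f).measurable

lemma IsExtNorm.zero {N : ℕ} {nΛ : L2v N → ℝ≥0∞} (hn : IsExtNorm nΛ) : nΛ 0 = 0 := by
  have := hn.smul 0 0
  simpa using this

lemma IsExtNorm.sum_le {N : ℕ} {nΛ : L2v N → ℝ≥0∞} (hn : IsExtNorm nΛ) {ι : Type*} (s : Finset ι)
    (u : ι → L2v N) : nΛ (∑ i ∈ s, u i) ≤ ∑ i ∈ s, nΛ (u i) := by
  classical
  induction s using Finset.induction_on with
  | empty => simp [hn.zero]
  | insert i s hi ih =>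
    rw [Finset.sum_insert hi, Finset.sum_insert hi]
    exact (hn.add_le _ _).trans (add_le_add le_rfl ih)

lemma lamNorm_sq {N : ℕ} (nΛ : L2v N → ℝ≥0∞) (f : L2xv N) :
    lamNorm nΛ f ^ 2 = ∫⁻ x, nΛ (slice f x) ^ 2 := by
  rw [lamNorm, ← ENNReal.rpow_natCast, ← ENNReal.rpow_mul]
  simp

lemma lamNorm_ne_top_iff {N : ℕ} {nΛ : L2v N → ℝ≥0∞} {f : L2xv N} :
    lamNorm nΛ f ≠ ⊤ ↔ ∫⁻ x, nΛ (slice f x) ^ 2 ≠ ⊤ := by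
  rw [← lamNorm_sq]
  simp

/-- The real value of the `Λ`-norm. -/
def lamR {N : ℕ} (nΛ : L2v N → ℝ≥0∞) (f : L2xv N) : ℝ := (lamNorm nΛ f).toReal

lemma lamR_sq {N : ℕ} (nΛ : L2v N → ℝ≥0∞) (f : L2xv N) :
    lamR nΛ f ^ 2 = (∫⁻ x, nΛ (slice f x) ^ 2).toReal := by
  rw [← lamNorm_sq, ENNReal.toReal_pow, lamR]

lemma IsExtNorm.ae_ne_top {N : ℕ} {nΛ : L2v N → ℝ≥0∞} (hn : IsExtNorm nΛ) {f : L2xv N}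
    (hf : lamNorm nΛ f ≠ ⊤) : ∀ᵐ x : Tor N, nΛ (slice f x) ≠ ⊤ := by
  filter_upwards [ae_lt_top ((hn.measurable_slice f).pow_const 2) (lamNorm_ne_top_iff.1 hf)]
    with x hx
  have h : nΛ (slice f x) < ⊤ := by simpa using hx
  exact h.ne

lemma IsExtNorm.integrable_sq {N : ℕ} {nΛ : L2v N → ℝ≥0∞} (hn : IsExtNorm nΛ) {f : L2xv N}
    (hf : lamNorm nΛ f ≠ ⊤) : Integrable fun x : Tor N => (nΛ (slice f x)).toReal ^ 2 := by
  have := integrable_toReal_of_lintegral_ne_top ((hn.measurable_slice f).pow_const 2).aemeasurable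
    (lamNorm_ne_top_iff.1 hf)
  simpa only [ENNReal.toReal_pow] using this

lemma IsExtNorm.integral_sq {N : ℕ} {nΛ : L2v N → ℝ≥0∞} (hn : IsExtNorm nΛ) {f : L2xv N}
    (hf : lamNorm nΛ f ≠ ⊤) : ∫ x : Tor N, (nΛ (slice f x)).toReal ^ 2 = lamR nΛ f ^ 2 := by
  have := integral_toReal ((hn.measurable_slice f).pow_const 2).aemeasurable (μ := volume)
    (ae_lt_top ((hn.measurable_slice f).pow_const 2) (lamNorm_ne_top_iff.1 hf))
  rw [lamR_sq, ← this]
  simp only [ENNReal.toReal_pow]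

lemma norm_sq_le_lamR {N : ℕ} {nΛ : L2v N → ℝ≥0∞} {ν₀ ν₁ : ℝ} (h₀ : 0 < ν₀) (h₁ : 0 < ν₁)
    (h : ∀ u : L2v N, ENNReal.ofReal (ν₀ * ‖u‖ ^ 2) ≤ ENNReal.ofReal ν₁ * nΛ u ^ 2) {f : L2xv N}
    (hf : lamNorm nΛ f ≠ ⊤) : ‖f‖ ^ 2 ≤ ν₁ / ν₀ * lamR nΛ f ^ 2 := by
  have e (a : ℝ) (ha : 0 ≤ a) : ENNReal.ofReal (ν₀ * a ^ 2) = ENNReal.ofReal ν₀ *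
      ENNReal.ofReal a ^ 2 := by
    rw [ENNReal.ofReal_mul h₀.le, ENNReal.ofReal_pow ha]
  have h2 : ENNReal.ofReal (ν₀ * ‖f‖ ^ 2) ≤ ENNReal.ofReal (ν₁ * lamR nΛ f ^ 2) := by
    rw [e _ (norm_nonneg _), ofReal_norm, ← lintegral_slice, ENNReal.ofReal_mul h₁.le, lamR_sq,
      ENNReal.ofReal_toReal (lamNorm_ne_top_iff.1 hf),
      ← lintegral_const_mul' _ _ ENNReal.ofReal_ne_top,
      ← lintegral_const_mul' _ _ ENNReal.ofReal_ne_top]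
    refine lintegral_mono fun x => ?_
    have := h (slice f x)
    rwa [e _ (norm_nonneg _), ofReal_norm] at this
  rw [ENNReal.ofReal_le_ofReal_iff (by positivity)] at h2
  rw [div_mul_eq_mul_div, le_div_iff₀ h₀]
  linarith

/-! ### The microscopic part -/

/-- The microscopic part `f^⊥` of `f`, for a basis `φ` of the kernel. -/
def perp {N d : ℕ} (φ : Fin d → L2v N) (f : L2xv N) : L2xv N :=
  f - ∑ i, tens (memLp_inner_slice (φ i) f) (φ i)

lemma slice_perp {N d : ℕ} (φ : Fin d → L2v N) (f : L2xv N) :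
    ∀ᵐ x : Tor N, slice (perp φ f) x = slice f x - ∑ i, ⟪φ i, slice f x⟫_ℝ • φ i := by
  filter_upwards [slice_sub f (∑ i, tens (memLp_inner_slice (φ i) f) (φ i)),
    slice_sum Finset.univ fun i => tens (memLp_inner_slice (φ i) f) (φ i),
    ae_all_iff.2 fun i => slice_tens (memLp_inner_slice (φ i) f) (φ i)] with x h1 h2 h3
  rw [perp, h1, h2]
  simp only [h3]

lemma inner_perp_right {N d : ℕ} (φ : Fin d → L2v N) {r f : L2xv N}
    (h : ∀ i, ∀ᵐ x : Tor N, ⟪φ i, slice r x⟫_ℝ = 0) : ⟪r, perp φ f⟫_ℝ = ⟪r, f⟫_ℝ := by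
  rw [perp, inner_sub_right, inner_sum, sub_eq_self]
  refine Finset.sum_eq_zero fun i _ => ?_
  rw [real_inner_comm, inner_tens]
  refine integral_eq_zero_of_ae ?_
  filter_upwards [h i] with x hx
  rw [hx, mul_zero, Pi.zero_apply]

lemma ennreal_add_sq_le (a b : ℝ≥0∞) : (a + b) ^ 2 ≤ 4 * a ^ 2 + 4 * b ^ 2 := by
  have h : a + b ≤ 2 * max a b := by
    rw [two_mul]; exact add_le_add (le_max_left _ _) (le_max_right _ _)
  calc (a + b) ^ 2 ≤ (2 * max a b) ^ 2 := by gcongr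
    _ = 4 * (max a b) ^ 2 := by rw [mul_pow]; norm_num
    _ ≤ 4 * (a ^ 2 + b ^ 2) := by
      gcongr
      rcases le_total a b with h | h
      · rw [max_eq_right h]; exact le_add_self
      · rw [max_eq_left h]; exact le_self_add
    _ = _ := mul_add _ _ _

/-- On the finite dimensional kernel the `Λ`-norm is bounded by the `L²` norm, since each `φ i` has
finite `Λ`-norm. The full `Λ`-norm is thus controlled by the microscopic dissipation and by the `L²`
norm that the mixed terms provide. -/
lemma lamNorm_le_perp {N d : ℕ} {nΛ : L2v N → ℝ≥0∞} (hn : IsExtNorm nΛ) {φ : Fin d → L2v N}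
    (hφ : Orthonormal ℝ φ) (hφΛ : ∀ i, nΛ (φ i) ≠ ⊤) :
    ∃ C : ℝ, 0 < C ∧ ∀ f : L2xv N, lamNorm nΛ (perp φ f) ≠ ⊤ →
      lamNorm nΛ f ≠ ⊤ ∧ lamR nΛ f ^ 2 ≤ 4 * lamR nΛ (perp φ f) ^ 2 + C * ‖f‖ ^ 2 := by
  let M : ℝ≥0∞ := ∑ i, nΛ (φ i)
  have hM : M ≠ ⊤ := ENNReal.sum_ne_top.2 fun i _ => hφΛ i
  refine ⟨4 * M.toReal ^ 2 + 1, by positivity, fun f hf => ?_⟩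
  have hpt : ∀ u : L2v N, nΛ u ^ 2 ≤
      4 * nΛ (u - ∑ i, ⟪φ i, u⟫_ℝ • φ i) ^ 2 + 4 * M ^ 2 * ‖u‖ₑ ^ 2 := by
    intro u
    have h1 : nΛ (∑ i, ⟪φ i, u⟫_ℝ • φ i) ≤ M * ‖u‖ₑ := by
      refine (hn.sum_le _ _).trans ?_
      rw [Finset.sum_mul]
      refine Finset.sum_le_sum fun i _ => ?_
      rw [hn.smul, mul_comm]
      gcongr
      rw [← ofReal_norm, ← ofReal_norm]
      refine ENNReal.ofReal_le_ofReal ?_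
      simpa [hφ.1 i] using norm_inner_le_norm (𝕜 := ℝ) (φ i) u
    have h2 : nΛ u ≤ nΛ (u - ∑ i, ⟪φ i, u⟫_ℝ • φ i) + M * ‖u‖ₑ := by
      calc nΛ u = nΛ ((u - ∑ i, ⟪φ i, u⟫_ℝ • φ i) + ∑ i, ⟪φ i, u⟫_ℝ • φ i) := by
            rw [sub_add_cancel]
        _ ≤ _ := (hn.add_le _ _).trans (add_le_add le_rfl h1)
    calc nΛ u ^ 2 ≤ _ := pow_le_pow_left₀ (zero_le) h2 2
      _ ≤ _ := ennreal_add_sq_le _ _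
      _ = _ := by rw [mul_pow, mul_assoc]
  have hint : ∫⁻ x : Tor N, nΛ (slice f x) ^ 2 ≤
      4 * (∫⁻ x : Tor N, nΛ (slice (perp φ f) x) ^ 2) + 4 * M ^ 2 * ‖f‖ₑ ^ 2 := by
    rw [← lintegral_slice f, ← lintegral_const_mul' _ _ (by simp),
      ← lintegral_const_mul' _ _ (ENNReal.mul_ne_top (by simp) (by simpa using hM)),
      ← lintegral_add_left (((hn.measurable_slice _).pow_const 2).const_mul _)]
    refine lintegral_mono_ae ?_
    filter_upwards [slice_perp φ f] with x hx
    rw [hx]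
    exact hpt _
  have hfin := lamNorm_ne_top_iff.1 hf
  have hfin1 : 4 * (∫⁻ x : Tor N, nΛ (slice (perp φ f) x) ^ 2) ≠ ⊤ :=
    ENNReal.mul_ne_top (by simp) hfin
  have hfin2 : 4 * M ^ 2 * ‖f‖ₑ ^ 2 ≠ ⊤ :=
    ENNReal.mul_ne_top (ENNReal.mul_ne_top (by simp) (by simpa using hM)) (by simp)
  have hfin3 := ENNReal.add_ne_top.2 ⟨hfin1, hfin2⟩
  refine ⟨lamNorm_ne_top_iff.2 (ne_top_of_le_ne_top hfin3 hint), ?_⟩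
  rw [lamR_sq, lamR_sq]
  have h3 := ENNReal.toReal_mono hfin3 hint
  rw [ENNReal.toReal_add hfin1 hfin2] at h3
  simp only [ENNReal.toReal_mul, ENNReal.toReal_pow, toReal_enorm, ENNReal.toReal_ofNat] at h3
  nlinarith [sq_nonneg ‖f‖]

/-- The spectral gap integrated in `x`. Finiteness is part of the conclusion: the squared `Λ`-norm
is dominated pointwise by a multiple of the integrable function `-⟨q(x), f(x)⟩`. -/
lemma coercive_perp {N d : ℕ} {nΛ : L2v N → ℝ≥0∞} {L : L2v N →ₗ.[ℝ] L2v N}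
    {φ : Fin d → L2v N} {lam : ℝ} (hlam : 0 < lam)
    (h : ∀ u : L.domain, nΛ ((u : L2v N) - ∑ i, ⟪φ i, (u : L2v N)⟫_ℝ • φ i) ≠ ⊤ ∧
      ⟪L u, (u : L2v N)⟫_ℝ ≤
        -lam * (nΛ ((u : L2v N) - ∑ i, ⟪φ i, (u : L2v N)⟫_ℝ • φ i)).toReal ^ 2)
    {f q : L2xv N} (hf : Acts L f q) :
    lamNorm nΛ (perp φ f) ≠ ⊤ ∧ ⟪q, f⟫_ℝ ≤ -lam * lamR nΛ (perp φ f) ^ 2 := by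
  have hpt : ∀ᵐ x : Tor N, nΛ (slice (perp φ f) x) ^ 2 ≤
      ENNReal.ofReal (-(lam⁻¹ * ⟪slice q x, slice f x⟫_ℝ)) ∧
        0 ≤ -(lam⁻¹ * ⟪slice q x, slice f x⟫_ℝ) := by
    filter_upwards [hf, slice_perp φ f] with x hx h2
    obtain ⟨hx, hq⟩ := hx
    obtain ⟨h3, h4⟩ := h ⟨_, hx⟩
    rw [hq] at h4
    rw [h2]
    have h5 : (nΛ (slice f x - ∑ i, ⟪φ i, slice f x⟫_ℝ • φ i)).toReal ^ 2 ≤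
        -(lam⁻¹ * ⟪slice q x, slice f x⟫_ℝ) := by
      rw [← mul_neg, le_inv_mul_iff₀ hlam]
      linarith
    refine ⟨?_, (by positivity : (0 : ℝ) ≤ _).trans h5⟩
    rw [← ENNReal.ofReal_toReal h3, ← ENNReal.ofReal_pow ENNReal.toReal_nonneg]
    exact ENNReal.ofReal_le_ofReal h5
  have hi : Integrable fun x : Tor N => -(lam⁻¹ * ⟪slice q x, slice f x⟫_ℝ) :=
    ((integrable_inner_slice q f).const_mul _).neg
  have h1 : ∫⁻ x : Tor N, nΛ (slice (perp φ f) x) ^ 2 ≤ ENNReal.ofReal (-(lam⁻¹ * ⟪q, f⟫_ℝ)) := by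
    rw [inner_eq_integral_slice, ← integral_const_mul, ← integral_neg,
      ofReal_integral_eq_lintegral_ofReal hi (hpt.mono fun x hx => hx.2)]
    exact lintegral_mono_ae (hpt.mono fun x hx => hx.1)
  have h0 : 0 ≤ -(lam⁻¹ * ⟪q, f⟫_ℝ) := by
    rw [inner_eq_integral_slice, ← integral_const_mul, ← integral_neg]
    exact integral_nonneg_of_ae (hpt.mono fun x hx => hx.2)
  refine ⟨lamNorm_ne_top_iff.2 (ne_top_of_le_ne_top ENNReal.ofReal_ne_top h1), ?_⟩
  have h2 := ENNReal.toReal_mono ENNReal.ofReal_ne_top h1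
  rw [ENNReal.toReal_ofReal h0, ← lamR_sq, ← mul_neg, le_inv_mul_iff₀ hlam] at h2
  linarith

/-- In each fibre `L f = L f^⊥`, so the bound on `L` may be applied to the microscopic part alone.
Young's inequality is left with a free parameter `t`. -/
lemma inner_le_perp {N d : ℕ} {nΛ : L2v N → ℝ≥0∞} (hn : IsExtNorm nΛ)
    {L : L2v N →ₗ.[ℝ] L2v N} {φ : Fin d → L2v N} (hker : ∀ i, InKer L (φ i)) {C : ℝ} (hC : 0 < C)
    (h : ∀ (u : L.domain) (w : L2v N), nΛ w ≠ ⊤ →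
      ⟪L u, w⟫_ℝ ≤ C * (nΛ u).toReal * (nΛ w).toReal)
    {f q w : L2xv N} (hf : Acts L f q) (hfΛ : lamNorm nΛ (perp φ f) ≠ ⊤)
    (hw : lamNorm nΛ w ≠ ⊤) {t : ℝ} (ht : 0 < t) :
    ⟪q, w⟫_ℝ ≤ C * (t * lamR nΛ (perp φ f) ^ 2 + t⁻¹ * lamR nΛ w ^ 2) := by
  rw [inner_eq_integral_slice, ← hn.integral_sq hfΛ, ← hn.integral_sq hw, ← integral_const_mul,
    ← integral_const_mul, ← integral_add ((hn.integrable_sq hfΛ).const_mul _)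
    ((hn.integrable_sq hw).const_mul _), ← integral_const_mul]
  refine integral_mono_ae (integrable_inner_slice q w)
    ((((hn.integrable_sq hfΛ).const_mul _).add ((hn.integrable_sq hw).const_mul _)).const_mul _) ?_
  filter_upwards [hf, slice_perp φ f, hn.ae_ne_top hw] with x hx h2 h3
  obtain ⟨hx, hq⟩ := hx
  have hdom : ∑ i, ⟪φ i, slice f x⟫_ℝ • φ i ∈ L.domain :=
    Submodule.sum_mem _ fun i _ => Submodule.smul_mem _ _ (hker i).1
  have hL0 : L ⟨∑ i, ⟪φ i, slice f x⟫_ℝ • φ i, hdom⟩ = 0 := by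
    have : (⟨∑ i, ⟪φ i, slice f x⟫_ℝ • φ i, hdom⟩ : L.domain) =
        ∑ i, ⟪φ i, slice f x⟫_ℝ • ⟨φ i, (hker i).1⟩ := by
      ext1; simp
    rw [this]
    change L.toFun _ = 0
    rw [map_sum]
    refine Finset.sum_eq_zero fun i _ => ?_
    rw [map_smul]
    change _ • L ⟨φ i, (hker i).1⟩ = 0
    rw [(hker i).2, smul_zero]
  have hL : L (⟨slice f x, hx⟩ - ⟨∑ i, ⟪φ i, slice f x⟫_ℝ • φ i, hdom⟩) = slice q x := by
    rw [LinearPMap.map_sub, hL0, sub_zero, hq]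
  have h4 := h (⟨slice f x, hx⟩ - ⟨∑ i, ⟪φ i, slice f x⟫_ℝ • φ i, hdom⟩) (slice w x) h3
  rw [hL] at h4
  simp only [AddSubgroupClass.coe_sub, ← h2] at h4
  refine h4.trans ?_
  rw [mul_assoc]
  refine mul_le_mul_of_nonneg_left ?_ hC.le
  set a := (nΛ (slice (perp φ f) x)).toReal
  set b := (nΛ (slice w x)).toReal
  have hb : t⁻¹ * b ^ 2 = t * (t⁻¹ * b) ^ 2 := by field_simp
  have hab : a * b = t * (a * (t⁻¹ * b)) := by field_simp
  rw [hb, hab, ← mul_add]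
  refine mul_le_mul_of_nonneg_left ?_ ht.le
  nlinarith [sq_nonneg (a - t⁻¹ * b), sq_nonneg (a + t⁻¹ * b), sq_nonneg a, sq_nonneg (t⁻¹ * b)]

/-- The Poincaré inequality for the fluid part. -/
lemma norm_sq_le_perp {N d : ℕ} {φ : Fin d → L2v N} (hφ : Orthonormal ℝ φ) {f : L2xv N}
    (hf : MemH 1 f) (h0 : ∀ i, ∫ x : Tor N, ⟪φ i, slice f x⟫_ℝ = 0) :
    ‖f‖ ^ 2 ≤ 2 * ‖perp φ f‖ ^ 2 + 2 * d * ∑ m, ‖pd 0 (dl m) f‖ ^ 2 := by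
  have hn (g : L2xv N) : ‖g‖ ^ 2 = ∫ x : Tor N, ‖slice g x‖ ^ 2 := by
    rw [← real_inner_self_eq_norm_sq, inner_eq_integral_slice]
    simp only [real_inner_self_eq_norm_sq]
  have hni (g : L2xv N) : Integrable fun x : Tor N => ‖slice g x‖ ^ 2 := by
    simpa only [real_inner_self_eq_norm_sq] using integrable_inner_slice g g
  have hii (i : Fin d) (g : L2xv N) : Integrable fun x : Tor N => ⟪φ i, slice g x⟫_ℝ ^ 2 :=
    (memLp_inner_slice (φ i) g).integrable_sq
  have h1 : ‖f‖ ^ 2 ≤ 2 * ‖perp φ f‖ ^ 2 + 2 * ∑ i, ∫ x : Tor N, ⟪φ i, slice f x⟫_ℝ ^ 2 := by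
    rw [hn f, hn (perp φ f), ← integral_finsetSum _ fun i _ => hii i f, ← integral_const_mul,
      ← integral_const_mul, ← integral_add ((hni _).const_mul 2)
      ((integrable_finsetSum _ fun i _ => hii i f).const_mul 2)]
    refine integral_mono_ae (hni f) (((hni _).const_mul 2).add
      ((integrable_finsetSum _ fun i _ => hii i f).const_mul 2)) ?_
    filter_upwards [slice_perp φ f] with x hx
    have h2 : ‖∑ i, ⟪φ i, slice f x⟫_ℝ • φ i‖ ^ 2 = ∑ i, ⟪φ i, slice f x⟫_ℝ ^ 2 := by
      rw [← real_inner_self_eq_norm_sq, hφ.inner_sum]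
      simp [sq]
    rw [← h2, hx]
    have h3 := parallelogram_law_with_norm ℝ (slice f x - ∑ i, ⟪φ i, slice f x⟫_ℝ • φ i)
      (∑ i, ⟪φ i, slice f x⟫_ℝ • φ i)
    rw [sub_add_cancel] at h3
    nlinarith [norm_nonneg (slice f x - ∑ i, ⟪φ i, slice f x⟫_ℝ • φ i -
      ∑ i, ⟪φ i, slice f x⟫_ℝ • φ i)]
  have h2 (i : Fin d) : ∫ x : Tor N, ⟪φ i, slice f x⟫_ℝ ^ 2 ≤ ∑ m, ‖pd 0 (dl m) f‖ ^ 2 := by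
    refine (poincare (φ i) (g := fun m => pd 0 (dl m) f) (fun m => ?_) (h0 i)).trans ?_
    · have := hf.weak_x (j := 0) (l := 0) m (by simp [len_zero])
      rw [pd_zero_zero, zero_add] at this
      exact this.strong
    · refine Finset.sum_le_sum fun m _ => ?_
      rw [hn]
      refine integral_mono (hii i _) (hni _) fun x => ?_
      have := norm_inner_le_norm (𝕜 := ℝ) (φ i) (slice (pd 0 (dl m) f) x)
      rw [hφ.1 i, one_mul] at this
      have h3 := pow_le_pow_left₀ (norm_nonneg _) this 2
      simpa using h3
  refine h1.trans ?_
  have h3 : ∑ i, ∫ x : Tor N, ⟪φ i, slice f x⟫_ℝ ^ 2 ≤ d * ∑ m, ‖pd 0 (dl m) f‖ ^ 2 := by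
    refine (Finset.sum_le_sum fun i _ => h2 i).trans ?_
    simp
  linarith

/-! ### Polynomials times a Gaussian -/

lemma exists_pderiv {N : ℕ} (P : MvPolynomial (Fin N) ℝ) :
    ContDiff ℝ ∞ (fun v : Vel N => MvPolynomial.eval (fun m => v m) P) ∧
    ∀ w : Vel N, ∃ Q : MvPolynomial (Fin N) ℝ, ∀ v : Vel N,
      fderiv ℝ (fun v : Vel N => MvPolynomial.eval (fun m => v m) P) v w =
        MvPolynomial.eval (fun m => v m) Q := by
  induction P using MvPolynomial.induction_on with
  | C a =>
    refine ⟨by simpa using contDiff_const, fun w => ⟨0, fun v => ?_⟩⟩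
    simp
  | add P Q hP hQ =>
    refine ⟨by simpa using hP.1.add hQ.1, fun w => ?_⟩
    obtain ⟨P', hP'⟩ := hP.2 w
    obtain ⟨Q', hQ'⟩ := hQ.2 w
    refine ⟨P' + Q', fun v => ?_⟩
    simp only [map_add]
    rw [fderiv_fun_add (hP.1.differentiable (by simp) v) (hQ.1.differentiable (by simp) v)]
    simp [hP', hQ']
  | mul_X P i hP =>
    have hX : ∀ v : Vel N, HasFDerivAt (fun v : Vel N => v i)
        (EuclideanSpace.proj i : Vel N →L[ℝ] ℝ) v := fun v =>
      (EuclideanSpace.proj i : Vel N →L[ℝ] ℝ).hasFDerivAt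
    refine ⟨?_, fun w => ?_⟩
    · simp only [map_mul, MvPolynomial.eval_X]
      exact hP.1.mul (EuclideanSpace.proj i : Vel N →L[ℝ] ℝ).contDiff
    · obtain ⟨P', hP'⟩ := hP.2 w
      refine ⟨P * MvPolynomial.C (w i) + P' * MvPolynomial.X i, fun v => ?_⟩
      simp only [map_mul, MvPolynomial.eval_X, map_add, MvPolynomial.eval_C]
      rw [fderiv_fun_mul (hP.1.differentiable (by simp) v) (hX v).differentiableAt, (hX v).fderiv]
      simp [hP', mul_comm]

/-- A polynomial times a Gaussian. -/
def polyGauss {N : ℕ} (P : MvPolynomial (Fin N) ℝ) (v : Vel N) : ℝ :=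
  MvPolynomial.eval (fun m => v m) P * Real.exp (-‖v‖ ^ 2 / 4)

lemma contDiff_polyGauss {N : ℕ} (P : MvPolynomial (Fin N) ℝ) : ContDiff ℝ ∞ (polyGauss P) :=
  (exists_pderiv P).1.mul (((contDiff_norm_sq ℝ).neg.div_const 4).exp)

lemma exists_fderiv_polyGauss {N : ℕ} (P : MvPolynomial (Fin N) ℝ) (m : Fin N) :
    ∃ Q : MvPolynomial (Fin N) ℝ, ∀ v : Vel N,
      fderiv ℝ (polyGauss P) v (EuclideanSpace.single m 1) = polyGauss Q v := by
  obtain ⟨Q, hQ⟩ := (exists_pderiv P).2 (EuclideanSpace.single m 1)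
  refine ⟨Q - MvPolynomial.C (1 / 2) * MvPolynomial.X m * P, fun v => ?_⟩
  have h1 : HasFDerivAt (fun v : Vel N => Real.exp (-‖v‖ ^ 2 / 4))
      (Real.exp (-‖v‖ ^ 2 / 4) • ((4 : ℝ)⁻¹ • -(2 • innerSL ℝ v)) : Vel N →L[ℝ] ℝ) v := by
    have h0 : HasFDerivAt (fun v : Vel N => ‖v‖ ^ 2) (2 • innerSL ℝ v) v :=
      (hasStrictFDerivAt_norm_sq v).hasFDerivAt
    have h2 := (h0.neg.const_mul (4 : ℝ)⁻¹).exp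
    convert! h2 using 1
    · funext v
      simp only [Pi.neg_apply]
      congr 1; ring
    · simp only [Pi.neg_apply]
      congr 2; ring
  have h2 := ((exists_pderiv P).1.differentiable (by simp) v).hasFDerivAt.mul h1
  have h3 : polyGauss P = (fun v : Vel N => MvPolynomial.eval (fun m => v m) P) *
    fun v : Vel N => Real.exp (-‖v‖ ^ 2 / 4) := rfl
  rw [h3, h2.fderiv]
  simp only [add_apply, smul_apply, hQ, polyGauss, neg_apply,
    innerSL_apply_apply, EuclideanSpace.inner_single_right, map_sub, map_mul, MvPolynomial.eval_C,
    MvPolynomial.eval_X, smul_eq_mul, nsmul_eq_mul]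
  simp
  ring

lemma exists_bound_eval {N : ℕ} (P : MvPolynomial (Fin N) ℝ) :
    ∃ (C : ℝ) (n : ℕ), 0 ≤ C ∧ ∀ v : Vel N,
      |MvPolynomial.eval (fun m => v m) P| ≤ C * (1 + ‖v‖) ^ n := by
  induction P using MvPolynomial.induction_on with
  | C a => exact ⟨|a|, 0, abs_nonneg a, fun v => by simp⟩
  | add P Q hP hQ =>
    obtain ⟨C, n, hC, h⟩ := hP
    obtain ⟨C', n', hC', h'⟩ := hQ
    refine ⟨C + C', n + n', by positivity, fun v => ?_⟩
    have h1 : 1 ≤ 1 + ‖v‖ := by linarith [norm_nonneg v]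
    have h2 := pow_le_pow_right₀ h1 (Nat.le_add_right n n')
    have h3 := pow_le_pow_right₀ h1 (Nat.le_add_left n' n)
    rw [map_add]
    refine (abs_add_le _ _).trans ?_
    nlinarith [h v, h' v]
  | mul_X P i hP =>
    obtain ⟨C, n, hC, h⟩ := hP
    refine ⟨C, n + 1, hC, fun v => ?_⟩
    rw [map_mul, MvPolynomial.eval_X, abs_mul, pow_succ, ← mul_assoc]
    have h1 : |v i| ≤ 1 + ‖v‖ := by
      have := PiLp.norm_apply_le v i
      rw [Real.norm_eq_abs] at this
      linarith
    exact mul_le_mul (h v) h1 (abs_nonneg _) (by positivity)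

lemma memLp_polyGauss {N : ℕ} (P : MvPolynomial (Fin N) ℝ) :
    MemLp (polyGauss P) 2 (volume : Measure (Vel N)) := by
  obtain ⟨C, n, hC, h⟩ := exists_bound_eval P
  have hm := (contDiff_polyGauss P).continuous.aestronglyMeasurable (μ := (volume : Measure (Vel N)))
  rw [memLp_two_iff_integrable_sq hm]
  -- `2n` powers for the squared polynomial, and `N + 1` more to leave the integrable factor
  -- `(1+‖v‖)^{-(N+1)}`. The constant `3/2` is the maximum of `1 + s - s²/2`.
  let r := n + n + (N + 1)
  have hi : Integrable (fun v : Vel N => (C ^ 2 * (r.factorial * Real.exp (3 / 2))) *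
      (1 + ‖v‖) ^ (-(N + 1 : ℝ))) :=
    (integrable_one_add_norm (by simp)).const_mul _
  refine hi.mono' (hm.pow 2) (Eventually.of_forall fun v => ?_)
  have hv : 0 < 1 + ‖v‖ := by positivity
  rw [Real.norm_eq_abs, abs_of_nonneg (sq_nonneg _), Real.rpow_neg hv.le,
    ← div_eq_mul_inv, show (N + 1 : ℝ) = ((N + 1 : ℕ) : ℝ) by push_cast; ring, Real.rpow_natCast,
    le_div_iff₀ (by positivity)]
  have h1 : (polyGauss P v) ^ 2 ≤ (C * (1 + ‖v‖) ^ n) ^ 2 * Real.exp (-‖v‖ ^ 2 / 2) := by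
    rw [polyGauss, mul_pow, ← Real.exp_nat_mul]
    have := pow_le_pow_left₀ (abs_nonneg _) (h v) 2
    rw [sq_abs] at this
    have e : ((2 : ℕ) : ℝ) * (-‖v‖ ^ 2 / 4) = -‖v‖ ^ 2 / 2 := by push_cast; ring
    rw [e]
    exact mul_le_mul_of_nonneg_right this (Real.exp_pos _).le
  have h2 : (1 + ‖v‖) ^ r ≤ r.factorial * Real.exp (1 + ‖v‖) := by
    have := Real.pow_div_factorial_le_exp (1 + ‖v‖) hv.le r
    rwa [div_le_iff₀ (by positivity), mul_comm] at this
  calc polyGauss P v ^ 2 * (1 + ‖v‖) ^ (N + 1)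
      ≤ (C * (1 + ‖v‖) ^ n) ^ 2 * Real.exp (-‖v‖ ^ 2 / 2) * (1 + ‖v‖) ^ (N + 1) := by gcongr
    _ = C ^ 2 * ((1 + ‖v‖) ^ r * Real.exp (-‖v‖ ^ 2 / 2)) := by
      simp only [r, pow_add]; ring
    _ ≤ C ^ 2 * (r.factorial * Real.exp (1 + ‖v‖) * Real.exp (-‖v‖ ^ 2 / 2)) := by gcongr
    _ = C ^ 2 * (r.factorial * Real.exp (1 + ‖v‖ + -‖v‖ ^ 2 / 2)) := by
      rw [mul_assoc (r.factorial : ℝ), ← Real.exp_add]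
    _ ≤ _ := by
      gcongr
      nlinarith [sq_nonneg (‖v‖ - 1)]

/-! ### Functions of the velocity alone -/

lemma memLp_one_tor {N : ℕ} : MemLp (fun _ : Tor N => (1 : ℝ)) 2 volume := memLp_const 1

/-- A function of `v` as a function of `(x, v)`. -/
def constX {N : ℕ} (u : L2v N) : L2xv N := tens memLp_one_tor u

lemma slice_constX {N : ℕ} (u : L2v N) : ∀ᵐ x : Tor N, slice (constX u) x = u := by
  filter_upwards [slice_tens memLp_one_tor u] with x hx
  rw [constX, hx, one_smul]

lemma inner_constX {N : ℕ} (u : L2v N) (f : L2xv N) :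
    ⟪constX u, f⟫_ℝ = ∫ x : Tor N, ⟪u, slice f x⟫_ℝ := by
  rw [constX, inner_tens]
  simp

lemma constX_strong {N : ℕ} (u : L2v N) {X : Drift N} (hX : X.w = 0) :
    X.Strong (constX u) 0 := by
  have : ∀ s, X.U s (constX u) = constX u := by
    intro s
    refine Lp.ext ?_
    filter_upwards [X.coeFn_U s (constX u), coeFn_tens memLp_one_tor u,
      (measurePreserving_flow X s).quasiMeasurePreserving.ae (coeFn_tens memLp_one_tor u)]
      with p h1 h2 h3
    rw [h1, constX, h2, h3]
    simp [Drift.flow, hX]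
  rw [Drift.Strong]
  simp only [this]
  exact hasDerivAt_const _ _

/-- The class of polynomials times the Gaussian is stable under `∂_{v_m}`, and for fixed `x` the
test function has compact support in `v`, so classical integration by parts applies. -/
lemma constX_weak_v {N : ℕ} (P : MvPolynomial (Fin N) ℝ) (m : Fin N) :
    ∃ g, (vField m).Weak (constX ((memLp_polyGauss P).toLp _)) g := by
  obtain ⟨Q, hQ⟩ := exists_fderiv_polyGauss P m
  refine ⟨constX ((memLp_polyGauss Q).toLp _), fun ψ hψ => ?_⟩
  have hc (P : MvPolynomial (Fin N) ℝ) : ∀ᵐ p : Tor N × Vel N,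
      constX ((memLp_polyGauss P).toLp _) p = polyGauss P p.2 := by
    have hq : ∀ᵐ p : Tor N × Vel N, (memLp_polyGauss P).toLp _ p.2 = polyGauss P p.2 :=
      Measure.quasiMeasurePreserving_snd.ae (memLp_polyGauss P).coeFn_toLp
    filter_upwards [coeFn_tens memLp_one_tor ((memLp_polyGauss P).toLp _), hq] with p h1 h2
    rw [constX, h1, h2, one_mul]
  have hf (P : MvPolynomial (Fin N) ℝ) {χ : Tor N × Vel N → ℝ} (hχ : IsTest χ) :
      Integrable (fun p : Tor N × Vel N => polyGauss P p.2 * χ p) ∧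
      ∫ p, constX ((memLp_polyGauss P).toLp _) p * χ p =
        ∫ x : Tor N, ∫ v : Vel N, polyGauss P v * χ (x, v) := by
    have hi := hχ.integrable_mul (constX ((memLp_polyGauss P).toLp _))
    have he : (fun p => constX ((memLp_polyGauss P).toLp _) p * χ p) =ᵐ[volume]
        fun p : Tor N × Vel N => polyGauss P p.2 * χ p := by
      filter_upwards [hc P] with p hp
      rw [hp]
    refine ⟨hi.congr he, ?_⟩
    rw [integral_congr_ae he]
    exact integral_prod _ (hi.congr he)
  rw [← vD_eq, (hf P (hψ.vD m)).2, (hf Q hψ).2, ← integral_neg]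
  refine integral_congr_ae (Eventually.of_forall fun x => ?_)
  obtain ⟨y, rfl⟩ := mkT_surjective x
  let χ : Vel N → ℝ := fun v => ψ (mkT y, v)
  have hχ : ContDiff ℝ ∞ χ := hψ.contDiff.comp (contDiff_const.prodMk contDiff_id)
  obtain ⟨R, hR⟩ := (isTest_iff.1 hψ).2
  have hχc : HasCompactSupport χ := by
    refine HasCompactSupport.of_support_subset_isCompact (isCompact_closedBall (0 : Vel N) R) ?_
    intro v hv
    rw [mem_closedBall_zero_iff]
    by_contra hne
    exact hv (hR _ v (not_le.1 hne))
  have hvD (v : Vel N) : vD m ψ (mkT y, v) = fderiv ℝ χ v (EuclideanSpace.single m 1) := by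
    have h1 : HasDerivAt (fun s : ℝ => v + s • (EuclideanSpace.single m (1 : ℝ) : Vel N))
        (EuclideanSpace.single m 1) 0 := by
      simpa using ((hasDerivAt_id (0 : ℝ)).smul_const
        (EuclideanSpace.single m (1 : ℝ) : Vel N)).const_add v
    have h2 := ((hχ.differentiable (by simp)) (v + (0 : ℝ) •
      (EuclideanSpace.single m (1 : ℝ) : Vel N))).hasFDerivAt.comp_hasDerivAt (0 : ℝ) h1
    rw [zero_smul, add_zero] at h2
    exact h2.deriv
  have hcP := (contDiff_polyGauss P).continuous
  have hcQ := (contDiff_polyGauss Q).continuous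
  have hd : Continuous fun v => fderiv ℝ χ v (EuclideanSpace.single m 1) :=
    ((hχ.continuous_fderiv (by simp)).clm_apply continuous_const)
  have hdc : HasCompactSupport fun v => fderiv ℝ χ v (EuclideanSpace.single m 1) :=
    hχc.fderiv_apply ℝ _
  have key := integral_mul_fderiv_eq_neg_fderiv_mul_of_integrable
    (μ := (volume : Measure (Vel N))) (f := polyGauss P) (g := χ)
    (v := EuclideanSpace.single m 1) ?_ ?_ ?_
    (fun v _ => (contDiff_polyGauss P).differentiable (by simp) v)
    (fun v _ => hχ.differentiable (by simp) v)
  · simp only [hvD]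
    rw [key]
    simp only [hQ, χ]
  · simp only [hQ]
    exact (hcQ.mul hχ.continuous).integrable_of_hasCompactSupport hχc.mul_left
  · exact (hcP.mul hd).integrable_of_hasCompactSupport hdc.mul_left
  · exact (hcP.mul hχ.continuous).integrable_of_hasCompactSupport hχc.mul_left

/-- Functions of `v` alone which are a polynomial times a Gaussian are in the kernel of `G_ε`
as soon as they are in the kernel of `L`. -/
lemma inKerG_constX {N : ℕ} {L : L2v N →ₗ.[ℝ] L2v N} (ε : ℝ) {φ : L2v N}
    (P : MvPolynomial (Fin N) ℝ)
    (hP : ∀ᵐ v : Vel N, φ v = MvPolynomial.eval (fun m => v m) P * Real.exp (-‖v‖ ^ 2 / 4))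
    (hφ : InKer L φ) : InKerG L ε (constX φ) := by
  have e : φ = (memLp_polyGauss P).toLp _ := by
    refine Lp.ext ?_
    filter_upwards [hP, (memLp_polyGauss P).coeFn_toLp] with v h1 h2
    rw [h1, h2, polyGauss]
  have hx (m : Fin N) : HasWeakDeriv 0 (0 + dl m) (constX φ) 0 :=
    (hasWeakDeriv_zero _).step_x (constX_strong φ rfl).weak
  have hmem : MemH 1 (constX φ) := by
    intro j l hjl
    by_cases hj : j = 0
    · subst hj
      by_cases hl : l = 0
      · subst hl; exact ⟨_, hasWeakDeriv_zero _⟩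
      · obtain ⟨m, hm⟩ := exists_pos_of_ne_zero hl
        have h1 := len_sub_dl hm
        rw [len_zero] at hjl
        have h2 : l - dl m = 0 := len_eq_zero.1 (by omega)
        have h3 := sub_add_dl hm
        rw [h2] at h3
        exact ⟨0, h3 ▸ hx m⟩
    · obtain ⟨m, hm⟩ := exists_pos_of_ne_zero hj
      have h1 := len_sub_dl hm
      have hl : l = 0 := len_eq_zero.1 (by omega)
      have h2 : j - dl m = 0 := len_eq_zero.1 (by omega)
      have h3 := sub_add_dl hm
      rw [h2] at h3
      obtain ⟨g, hg⟩ := constX_weak_v P m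
      rw [← e] at hg
      exact ⟨g, hl ▸ h3 ▸ (hasWeakDeriv_zero _).step_v hg⟩
  refine ⟨hmem, 0, ?_, ?_⟩
  · filter_upwards [slice_constX φ, slice_zero (N := N)] with x h1 h2
    rw [h1, h2]
    exact hφ
  · have h1 : ∀ m, pd 0 (dl m) (constX φ) = 0 := fun m => by
      have := (hx m).pd_eq
      rwa [zero_add] at this
    exact Eventually.of_forall fun p => by simp [transport, h1]

/-! ### Conservation laws -/

/-- Symmetry of `L` makes its range orthogonal to its kernel, fibre by fibre. -/
lemma integral_inner_ker_eq_zero {N : ℕ} {L : L2v N →ₗ.[ℝ] L2v N} (hL : IsSelfAdjoint L)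
    {φ : L2v N} (hφ : InKer L φ) {f q : L2xv N} (h : Acts L f q) :
    ∀ᵐ x : Tor N, ⟪φ, slice q x⟫_ℝ = 0 := by
  have h1 : L.IsFormalAdjoint L := by
    have := LinearPMap.adjoint_isFormalAdjoint hL.dense_domain
    rwa [LinearPMap.isSelfAdjoint_def.1 hL] at this
  filter_upwards [h] with x hx
  obtain ⟨hx, hq⟩ := hx
  have h2 := h1 ⟨_, hx⟩ ⟨_, hφ.1⟩
  rw [hφ.2, hq] at h2
  rw [real_inner_comm]
  simpa using h2

/-- Functions of `v` alone are fixed by free transport, so skew-symmetry annihilates this pairing.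
-/
lemma inner_transport_constX {N : ℕ} (u : L2v N) {f τ : L2xv N} (h : tField.Weak f τ) :
    ⟪constX u, τ⟫_ℝ = 0 := by
  have := (constX_strong u (X := tField) rfl).inner_eq h.strong
  rw [inner_zero_left] at this
  linarith

lemma eq_of_hasDerivAt_zero {F : ℝ → ℝ} {T : ℝ} (hc : ContinuousOn F (Ico 0 T))
    (hd : ∀ t ∈ Ioo 0 T, HasDerivAt F 0 t) {t : ℝ} (ht : t ∈ Ioo 0 T) : F t = F 0 := by
  obtain ⟨c, hc', h⟩ := exists_hasDerivAt_eq_slope F (fun _ => 0) ht.1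
    (hc.mono fun s hs => ⟨hs.1, hs.2.trans_lt ht.2⟩)
    (fun s hs => hd s ⟨hs.1, hs.2.trans ht.2⟩)
  have h1 : 0 < t - 0 := by simpa using ht.1
  rw [eq_div_iff h1.ne', zero_mul] at h
  linarith

/-! ### The coefficients of the functional -/

/-- The exponents of the coefficients. -/
def wt {N : ℕ} (k : ℕ) (j l : Fin N → ℕ) : ℕ := max (len j + len l) 1 * (k + 1) + len j

/-- The coefficients of the `v`-derivatives. -/
def coefB {N : ℕ} (k : ℕ) (r : ℝ) (j l : Fin N → ℕ) : ℝ := r ^ wt k j l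

/-- The coefficients of the `x`-derivatives. -/
def coefAlpha {N : ℕ} (r : ℝ) (_l : Fin N → ℕ) : ℝ := r⁻¹ ^ 3

/-- The coefficients of the mixed terms. -/
def coefA {N : ℕ} (k : ℕ) (r : ℝ) (_i : Fin N) (l : Fin N → ℕ) : ℝ := r ^ wt k 0 l

lemma wt_le {N k : ℕ} {m : (Fin N → ℕ) × (Fin N → ℕ)} (hm : m ∈ midx2 N k) :
    wt k m.1 m.2 ≤ (k + 1) * (k + 1) + k := by
  rw [mem_midx2] at hm
  unfold wt
  have h1 : max (len m.1 + len m.2) 1 ≤ k + 1 := by omega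
  have := Nat.mul_le_mul_right (k + 1) h1
  omega

/-- The mixed coefficient for `l` is larger by exactly `r⁻¹` than the coefficient of the
`v`-derivative entering that term. With Young parameter `r²`, a net factor `r` remains. -/
lemma wt_mixed {N : ℕ} (k : ℕ) {i : Fin N} {l : Fin N → ℕ} (h : 0 < l i) :
    wt k (dl i) (l - dl i) = wt k 0 l + 1 := by
  have := len_sub_dl h
  unfold wt
  rw [len_dl, len_zero, zero_add, add_zero, add_comm 1, this]

lemma sum_midx2_split {N k : ℕ} (f : (Fin N → ℕ) × (Fin N → ℕ) → ℝ) :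
    ∑ m ∈ midx2 N k, f m = ∑ m ∈ (midx2 N k).filter (fun m => 1 ≤ len m.1), f m +
      ∑ l ∈ midx N k, f (0, l) := by
  rw [← Finset.sum_filter_add_sum_filter_not (midx2 N k) (fun m => 1 ≤ len m.1)]
  congr 1
  refine Finset.sum_nbij' (fun m => m.2) (fun l => (0, l)) ?_ ?_ ?_ ?_ ?_
  · intro m hm
    rw [Finset.mem_filter, mem_midx2] at hm
    rw [mem_midx]; omega
  · intro l hl
    rw [mem_midx] at hl
    rw [Finset.mem_filter, mem_midx2]
    simp only [len_zero]
    omega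
  · intro m hm
    rw [Finset.mem_filter] at hm
    have : m.1 = 0 := len_eq_zero.1 (by omega)
    ext1
    · exact this.symm
    · rfl
  · intro l _; rfl
  · intro m hm
    rw [Finset.mem_filter] at hm
    have : m.1 = 0 := len_eq_zero.1 (by omega)
    rw [← this]

lemma mixed_mem {N k : ℕ} {i : Fin N} {l : Fin N → ℕ} (h : 0 < l i) (hl : l ∈ midx N k) :
    (dl i, l - dl i) ∈ (midx2 N k).filter (fun m => 1 ≤ len m.1) := by
  rw [mem_midx] at hl
  have := len_sub_dl h
  rw [Finset.mem_filter, mem_midx2]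
  simp only [len_dl]
  omega

set_option maxHeartbeats 1600000 in
/-- The combination of the energy estimates. -/
theorem energy_combine (N k : ℕ) (hk : 1 ≤ k) {c C CL lam CP Cp r₀ : ℝ} (hc : 0 < c) (hC : 0 < C)
    (hlam : 0 < lam) (hCP : 0 < CP) (hCp : 0 < Cp) (hr₀ : 0 < r₀) :
    ∃ r K₀ K₁ K₂ : ℝ, 0 < r ∧ r ≤ 1 ∧ r ≤ r₀ ∧ 0 < K₀ ∧ 0 < K₁ ∧ 0 < K₂ ∧
    ∀ (ε : ℝ), 0 < ε → ε ≤ 1 → ∀ (Q e : (Fin N → ℕ) → (Fin N → ℕ) → ℝ) (Z a : (Fin N → ℕ) → ℝ)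
      (x : Fin N → (Fin N → ℕ) → ℝ) (gx gxv T : ℝ), (∀ j l, 0 ≤ Q j l) → (∀ l, 0 ≤ Z l) →
      (∀ j l, 1 ≤ len j → len j + len l ≤ k → e j l ≤ -c * Q j l +
        C * (∑ m ∈ (midx2 N k).filter (fun m => wt k m.1 m.2 < wt k j l), Q m.1 m.2) +
        C * (ε ^ 2 * gxv ^ 2)) →
      (∀ l, len l ≤ k → a l ≤ -(lam / ε ^ 2) * Z l + gx ^ 2 / lam) →
      (∀ i l, 0 < l i → len l ≤ k → ∀ s : ℝ, 0 < s → x i l ≤ -Q 0 l + 2 * s * Q (dl i) (l - dl i) +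
        4 * CL ^ 2 / (s * ε ^ 2) * Z l + gx ^ 2 / s) →
      Q 0 0 ≤ CP * (Z 0 + ∑ m, Q 0 (dl m)) →
      T ≤ Cp * ∑ m ∈ midx2 N k, Q m.1 m.2 + 4 * ∑ l ∈ midx N k, Z l →
      (∑ m ∈ (midx2 N k).filter (fun m => 1 ≤ len m.1), coefB k r m.1 m.2 * e m.1 m.2) +
        (∑ l ∈ midx N k, coefAlpha r l * a l) +
        (∑ l ∈ midx N k, ∑ i ∈ Finset.univ.filter (fun i => 0 < l i), coefA k r i l * x i l) ≤
        -K₀ * T + K₁ * gx ^ 2 + ε ^ 2 * K₂ * gxv ^ 2 := by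
  obtain ⟨A, hA⟩ : ∃ A : ℝ, A = ((midx2 N k).card : ℝ) + 1 := ⟨_, rfl⟩
  obtain ⟨B, hB⟩ : ∃ B : ℝ, B = ((midx N k).card : ℝ) + 1 := ⟨_, rfl⟩
  have hA0 : 0 < A := by rw [hA]; positivity
  have hB0 : 0 < B := by rw [hB]; positivity
  -- `E` is the total coefficient of the error `rΘ`: `AC` from the `v`-derivatives and `2BN` from
  -- the mixed terms.
  obtain ⟨E, hE⟩ : ∃ E : ℝ, E = A * C + 2 * B * N := ⟨_, rfl⟩
  have hE0 : 0 < E := by rw [hE]; positivity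
  obtain ⟨c₁, hc₁0, hc1, hc2⟩ : ∃ c₁ : ℝ, 0 < c₁ ∧ c₁ ≤ c ∧ c₁ ≤ 1 :=
    ⟨min c 1, lt_min hc one_pos, min_le_left _ _, min_le_right _ _⟩
  -- `P` is the cost of eliminating the order zero term by Poincaré in `Θ ≤ P (D₁ + D₂) + CP * Zs`.
  obtain ⟨P, hP⟩ : ∃ P : ℝ, P = 1 + CP * N := ⟨_, rfl⟩
  have hP0 : 0 < P := by rw [hP]; positivity
  -- `F` collects the microscopic errors, from Poincaré and from `L` in the mixed terms, measured in
  -- units of `r · r⁻³ε⁻²`. The two smallness conditions on `r` let the errors use at most half of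
  -- each dissipation.
  obtain ⟨F, hF⟩ : ∃ F : ℝ, F = E * CP + 4 * N * CL ^ 2 := ⟨_, rfl⟩
  have hF0 : 0 < F := by rw [hF]; positivity
  obtain ⟨r, hr0, hr1, hrr, hrc', hrl'⟩ : ∃ r : ℝ, 0 < r ∧ r ≤ 1 ∧ r ≤ r₀ ∧
      r ≤ c₁ / (2 * (E * P)) ∧ r ≤ lam / (2 * F) := by
    refine ⟨min (min 1 r₀) (min (c₁ / (2 * (E * P))) (lam / (2 * F))), ?_,
      (min_le_left _ _).trans (min_le_left _ _), (min_le_left _ _).trans (min_le_right _ _),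
      (min_le_right _ _).trans (min_le_left _ _), (min_le_right _ _).trans (min_le_right _ _)⟩
    simp only [lt_min_iff]
    exact ⟨⟨one_pos, hr₀⟩, by positivity, by positivity⟩
  have hrc : r * (E * P) ≤ c₁ / 2 := by
    rw [le_div_iff₀ (by positivity)] at hrc'
    linarith
  have hrl : r * F ≤ lam / 2 := by
    rw [le_div_iff₀ (by positivity)] at hrl'
    linarith
  -- The exponent bounds every weight occurring, so `R` turns the weighted sum `Θ` back into the
  -- unweighted one.
  obtain ⟨R, hR⟩ : ∃ R : ℝ, R = (r ^ ((k + 1) * (k + 1) + k))⁻¹ := ⟨_, rfl⟩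
  have hR0 : 0 < R := by rw [hR]; positivity
  obtain ⟨K₀, hK₀0, hK1, hK2⟩ : ∃ K₀ : ℝ, 0 < K₀ ∧ K₀ ≤ c₁ / 2 / (Cp * R * P) ∧
      K₀ ≤ lam / 2 / (Cp * R * CP + 4) :=
    ⟨min (c₁ / 2 / (Cp * R * P)) (lam / 2 / (Cp * R * CP + 4)),
      lt_min (by positivity) (by positivity), min_le_left _ _, min_le_right _ _⟩
  refine ⟨r, K₀, B * (r⁻¹ ^ 3 / lam) + B * N * (r ^ 2)⁻¹, A * C, hr0, hr1, hrr, hK₀0,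
    by positivity, by positivity, ?_⟩
  intro ε hε hε1 Q e Z a x gx gxv T hQ hZ he ha hx hQ0 hT
  obtain ⟨Θ, hΘ⟩ : ∃ Θ : ℝ, Θ = ∑ m ∈ midx2 N k, r ^ wt k m.1 m.2 * Q m.1 m.2 := ⟨_, rfl⟩
  obtain ⟨D₁, hD₁⟩ : ∃ D₁ : ℝ, D₁ = ∑ m ∈ (midx2 N k).filter (fun m => 1 ≤ len m.1),
    r ^ wt k m.1 m.2 * Q m.1 m.2 := ⟨_, rfl⟩
  obtain ⟨D₂, hD₂⟩ : ∃ D₂ : ℝ, D₂ = ∑ l ∈ (midx N k).erase 0, r ^ wt k 0 l * Q 0 l := ⟨_, rfl⟩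
  obtain ⟨Zs, hZs⟩ : ∃ Zs : ℝ, Zs = ∑ l ∈ midx N k, Z l := ⟨_, rfl⟩
  have hnn : ∀ j l, 0 ≤ r ^ wt k j l * Q j l := fun j l => mul_nonneg (by positivity) (hQ j l)
  have hΘ0 : 0 ≤ Θ := hΘ ▸ Finset.sum_nonneg fun m _ => hnn _ _
  have hD₁0 : 0 ≤ D₁ := hD₁ ▸ Finset.sum_nonneg fun m _ => hnn _ _
  have hD₂0 : 0 ≤ D₂ := hD₂ ▸ Finset.sum_nonneg fun m _ => hnn _ _
  have hZs0 : 0 ≤ Zs := hZs ▸ Finset.sum_nonneg fun l _ => hZ l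
  have hε2 : 1 ≤ (ε ^ 2)⁻¹ := (one_le_inv₀ (by positivity)).2 (pow_le_one₀ hε.le hε1)
  have hcardA : ((midx2 N k).card : ℝ) ≤ A := by rw [hA]; linarith
  have hcardB : ((midx N k).card : ℝ) ≤ B := by rw [hB]; linarith
  have h0mem : (0 : Fin N → ℕ) ∈ midx N k := by rw [mem_midx, len_zero]; omega
  -- the `v`-derivatives
  have h1 : ∑ m ∈ (midx2 N k).filter (fun m => 1 ≤ len m.1), coefB k r m.1 m.2 * e m.1 m.2 ≤
      -c * D₁ + A * (C * (r * Θ)) + A * (C * (ε ^ 2 * gxv ^ 2)) := by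
    have hterm : ∀ m ∈ (midx2 N k).filter (fun m => 1 ≤ len m.1),
        coefB k r m.1 m.2 * e m.1 m.2 ≤ -c * (r ^ wt k m.1 m.2 * Q m.1 m.2) +
          (C * (r * Θ) + C * (ε ^ 2 * gxv ^ 2)) := by
      intro m hm
      rw [Finset.mem_filter, mem_midx2] at hm
      have hp : 0 < r ^ wt k m.1 m.2 := by positivity
      have hp1 : r ^ wt k m.1 m.2 ≤ 1 := pow_le_one₀ hr0.le hr1
      have h2 := mul_le_mul_of_nonneg_left (he m.1 m.2 hm.2 hm.1) hp.le
      have h3 : r ^ wt k m.1 m.2 *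
          (∑ n ∈ (midx2 N k).filter (fun n => wt k n.1 n.2 < wt k m.1 m.2), Q n.1 n.2) ≤
          r * Θ := by
        rw [Finset.mul_sum, hΘ, Finset.mul_sum]
        refine (Finset.sum_le_sum fun n hn => ?_).trans
          (Finset.sum_le_sum_of_subset_of_nonneg (Finset.filter_subset _ _)
            fun n _ _ => mul_nonneg hr0.le (hnn n.1 n.2))
        rw [Finset.mem_filter] at hn
        -- The weights are integers, so a strictly smaller exponent leaves room for a whole factor
        -- `r`.
        rw [← mul_assoc, ← pow_succ']
        exact mul_le_mul_of_nonneg_right (pow_le_pow_of_le_one hr0.le hr1 hn.2) (hQ _ _)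
      have h4 : 0 ≤ C * (ε ^ 2 * gxv ^ 2) := by positivity
      have h5 := mul_le_mul_of_nonneg_right hp1 h4
      have h6 := mul_le_mul_of_nonneg_left h3 hC.le
      unfold coefB
      linarith
    refine (Finset.sum_le_sum hterm).trans ?_
    rw [Finset.sum_add_distrib, ← Finset.mul_sum, Finset.sum_const, nsmul_eq_mul, ← hD₁]
    have hcard : (((midx2 N k).filter (fun m => 1 ≤ len m.1)).card : ℝ) ≤ A :=
      (Nat.cast_le.2 (Finset.card_filter_le _ _)).trans hcardA
    have hpos : 0 ≤ C * (r * Θ) + C * (ε ^ 2 * gxv ^ 2) := by positivity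
    have := mul_le_mul_of_nonneg_right hcard hpos
    linarith
  -- the `x`-derivatives
  have h2 : ∑ l ∈ midx N k, coefAlpha r l * a l ≤
      -(r⁻¹ ^ 3 * lam * (ε ^ 2)⁻¹) * Zs + B * (r⁻¹ ^ 3 / lam) * gx ^ 2 := by
    have hterm : ∀ l ∈ midx N k, coefAlpha r l * a l ≤
        -(r⁻¹ ^ 3 * lam * (ε ^ 2)⁻¹) * Z l + r⁻¹ ^ 3 / lam * gx ^ 2 := by
      intro l hl
      have := mul_le_mul_of_nonneg_left (ha l (mem_midx.1 hl)) (by positivity : 0 ≤ r⁻¹ ^ 3)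
      unfold coefAlpha
      refine this.trans (le_of_eq ?_)
      ring
    refine (Finset.sum_le_sum hterm).trans ?_
    rw [Finset.sum_add_distrib, ← Finset.mul_sum, Finset.sum_const, nsmul_eq_mul, ← hZs]
    have hpos : 0 ≤ r⁻¹ ^ 3 / lam * gx ^ 2 := by positivity
    have := mul_le_mul_of_nonneg_right hcardB hpos
    linarith
  -- the mixed terms
  have h3 : ∑ l ∈ midx N k, ∑ i ∈ Finset.univ.filter (fun i => 0 < l i), coefA k r i l * x i l ≤
      -D₂ + B * (N * (2 * (r * Θ) + (r ^ 2)⁻¹ * gx ^ 2)) +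
        N * (4 * CL ^ 2 * (r ^ 2)⁻¹ * (ε ^ 2)⁻¹) * Zs := by
    obtain ⟨G, hG⟩ : ∃ G : (Fin N → ℕ) → ℝ, G = fun l => 2 * (r * Θ) + (r ^ 2)⁻¹ * gx ^ 2 +
      4 * CL ^ 2 * (r ^ 2)⁻¹ * (ε ^ 2)⁻¹ * Z l := ⟨_, rfl⟩
    have hG0 : ∀ l, 0 ≤ G l := fun l => by
      have := hZ l
      rw [hG]; positivity
    have hterm : ∀ l ∈ midx N k, ∀ i ∈ Finset.univ.filter (fun i => 0 < l i),
        coefA k r i l * x i l ≤ -(r ^ wt k 0 l * Q 0 l) + G l := by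
      intro l hl i hi
      have hi' : 0 < l i := (Finset.mem_filter.1 hi).2
      have hp : 0 < r ^ wt k 0 l := by positivity
      have hp1 : r ^ wt k 0 l ≤ 1 := pow_le_one₀ hr0.le hr1
      -- The choice `s = r²` makes the `v`-derivative error at most `2rΘ` and the microscopic error
      -- of size `r⁻²ε⁻²`, one factor `r` below the dissipation with coefficient `r⁻³`.
      have h4 := mul_le_mul_of_nonneg_left (hx i l hi' (mem_midx.1 hl) (r ^ 2) (by positivity)) hp.le
      have h5 : r ^ wt k 0 l * (r * Q (dl i) (l - dl i)) ≤ Θ := by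
        have := Finset.single_le_sum (f := fun m : (Fin N → ℕ) × (Fin N → ℕ) =>
          r ^ wt k m.1 m.2 * Q m.1 m.2) (fun m _ => hnn m.1 m.2)
          (Finset.mem_of_mem_filter _ (mixed_mem hi' hl))
        simp only [wt_mixed k hi', pow_succ] at this
        linarith
      have h6 : 0 ≤ 4 * CL ^ 2 / (r ^ 2 * ε ^ 2) * Z l + gx ^ 2 / r ^ 2 := by
        have := hZ l
        positivity
      have h7 := mul_le_mul_of_nonneg_right hp1 h6
      have h8 := mul_le_mul_of_nonneg_left h5 hr0.le
      have h9 : 4 * CL ^ 2 / (r ^ 2 * ε ^ 2) * Z l + gx ^ 2 / r ^ 2 =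
          4 * CL ^ 2 * (r ^ 2)⁻¹ * (ε ^ 2)⁻¹ * Z l + (r ^ 2)⁻¹ * gx ^ 2 := by
        field_simp
      have h10 : G l = 2 * (r * Θ) + (4 * CL ^ 2 * (r ^ 2)⁻¹ * (ε ^ 2)⁻¹ * Z l +
          (r ^ 2)⁻¹ * gx ^ 2) := by
        rw [hG]; ring
      unfold coefA
      rw [h10]
      rw [add_assoc, h9] at h4
      rw [h9] at h7
      generalize 4 * CL ^ 2 * (r ^ 2)⁻¹ * (ε ^ 2)⁻¹ * Z l + (r ^ 2)⁻¹ * gx ^ 2 = W at h4 h7 ⊢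
      linarith
    -- A nonzero `l` has at least one admissible `i`, hence at least one copy of the dissipation,
    -- and one is kept. For `l = 0` the row is empty, which is why order zero needs Poincaré.
    have hrow : ∀ l ∈ midx N k,
        ∑ i ∈ Finset.univ.filter (fun i => 0 < l i), coefA k r i l * x i l ≤
          (if l = 0 then 0 else -(r ^ wt k 0 l * Q 0 l)) + N * G l := by
      intro l hl
      refine (Finset.sum_le_sum (hterm l hl)).trans ?_
      rw [Finset.sum_const, nsmul_eq_mul]
      have hcN : ((Finset.univ.filter (fun i => 0 < l i)).card : ℝ) ≤ N := by
        have := Finset.card_filter_le (Finset.univ : Finset (Fin N)) (fun i => 0 < l i)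
        rw [Finset.card_univ, Fintype.card_fin] at this
        exact_mod_cast this
      have hGl := mul_le_mul_of_nonneg_right hcN (hG0 l)
      by_cases h0 : l = 0
      · subst h0
        simp only [if_true, Pi.zero_apply, lt_irrefl, Finset.filter_false, Finset.card_empty,
          Nat.cast_zero, zero_mul]
        have := hG0 0
        positivity
      · rw [if_neg h0]
        obtain ⟨i, hi⟩ := exists_pos_of_ne_zero h0
        have hc1 : (1 : ℝ) ≤ ((Finset.univ.filter (fun i => 0 < l i)).card : ℝ) := by
          have : 0 < (Finset.univ.filter (fun i => 0 < l i)).card :=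
            Finset.card_pos.2 ⟨i, by simpa using hi⟩
          exact_mod_cast this
        have := mul_le_mul_of_nonneg_right hc1 (hnn 0 l)
        linarith
    refine (Finset.sum_le_sum hrow).trans ?_
    rw [Finset.sum_add_distrib, ← Finset.mul_sum]
    have e1 : ∑ l ∈ midx N k, (if l = 0 then 0 else -(r ^ wt k 0 l * Q 0 l)) = -D₂ := by
      rw [← Finset.add_sum_erase _ _ h0mem, if_pos rfl, zero_add, hD₂, ← Finset.sum_neg_distrib]
      refine Finset.sum_congr rfl fun l hl => ?_
      rw [if_neg (Finset.ne_of_mem_erase hl)]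
    have e2 : ∑ l ∈ midx N k, G l ≤ B * (2 * (r * Θ) + (r ^ 2)⁻¹ * gx ^ 2) +
        4 * CL ^ 2 * (r ^ 2)⁻¹ * (ε ^ 2)⁻¹ * Zs := by
      simp only [hG]
      rw [Finset.sum_add_distrib, ← Finset.mul_sum, Finset.sum_const, nsmul_eq_mul, ← hZs]
      have hpos : 0 ≤ 2 * (r * Θ) + (r ^ 2)⁻¹ * gx ^ 2 := by positivity
      have := mul_le_mul_of_nonneg_right hcardB hpos
      linarith
    have := mul_le_mul_of_nonneg_left e2 (Nat.cast_nonneg N : (0 : ℝ) ≤ N)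
    rw [e1]
    linarith
  -- the remaining lower order term
  have h4 : Θ ≤ P * (D₁ + D₂) + CP * Zs := by
    have e1 : Θ = D₁ + (r ^ (k + 1) * Q 0 0 + D₂) := by
      rw [hΘ, sum_midx2_split, hD₁, hD₂, ← Finset.add_sum_erase _ _ h0mem]
      simp [wt, len_zero]
    -- The `max … 1` in `wt` gives order zero the same exponent `k + 1` as the first
    -- `x`-derivatives, so Poincaré loses no power of `r`.
    have e2 : r ^ (k + 1) * Q 0 0 ≤ CP * (Zs + N * D₂) := by
      have hp1 : r ^ (k + 1) ≤ 1 := pow_le_one₀ hr0.le hr1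
      have hZ0 : Z 0 ≤ Zs := hZs ▸ Finset.single_le_sum (fun l _ => hZ l) h0mem
      have e3 : r ^ (k + 1) * Z 0 ≤ Zs :=
        (mul_le_mul_of_nonneg_right hp1 (hZ 0)).trans (by rw [one_mul]; exact hZ0)
      have e4 : r ^ (k + 1) * ∑ m, Q 0 (dl m) ≤ N * D₂ := by
        rw [Finset.mul_sum]
        have : ∀ m ∈ (Finset.univ : Finset (Fin N)), r ^ (k + 1) * Q 0 (dl m) ≤ D₂ := by
          intro m _
          have hm : dl m ∈ (midx N k).erase 0 := by
            rw [Finset.mem_erase, mem_midx, len_dl]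
            refine ⟨fun h => ?_, hk⟩
            have := len_dl m
            rw [h, len_zero] at this
            omega
          have := Finset.single_le_sum (f := fun l => r ^ wt k 0 l * Q 0 l)
            (fun l _ => hnn 0 l) hm
          rw [← hD₂] at this
          simpa [wt, len_zero, len_dl] using this
        refine (Finset.sum_le_sum this).trans ?_
        simp
      have := mul_le_mul_of_nonneg_left hQ0 (by positivity : 0 ≤ r ^ (k + 1))
      have e5 := mul_le_mul_of_nonneg_left (add_le_add e3 e4) hCP.le
      linarith
    rw [e1, hP]
    linarith [mul_nonneg (mul_nonneg hCP.le (Nat.cast_nonneg N : (0 : ℝ) ≤ N)) hD₁0]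
  -- the coercivity constant
  have h5 : K₀ * T ≤ c₁ / 2 * (D₁ + D₂) + lam / 2 * Zs := by
    have e1 : ∑ m ∈ midx2 N k, Q m.1 m.2 ≤ R * Θ := by
      rw [hΘ, Finset.mul_sum]
      refine Finset.sum_le_sum fun m hm => ?_
      rw [← mul_assoc]
      refine le_mul_of_one_le_left (hQ _ _) ?_
      rw [hR, inv_mul_eq_div, one_le_div (by positivity)]
      exact pow_le_pow_of_le_one hr0.le hr1 (wt_le hm)
    rw [← hZs] at hT
    have e2 : T ≤ Cp * R * P * (D₁ + D₂) + (Cp * R * CP + 4) * Zs := by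
      have := mul_le_mul_of_nonneg_left (e1.trans (mul_le_mul_of_nonneg_left h4 hR0.le)) hCp.le
      linarith
    have e3 : K₀ * (Cp * R * P) ≤ c₁ / 2 := by
      rwa [le_div_iff₀ (by positivity)] at hK1
    have e4 : K₀ * (Cp * R * CP + 4) ≤ lam / 2 := by
      rwa [le_div_iff₀ (by positivity)] at hK2
    have e5 := mul_le_mul_of_nonneg_left e2 hK₀0.le
    have e6 := mul_le_mul_of_nonneg_right e3 (add_nonneg hD₁0 hD₂0)
    have e7 := mul_le_mul_of_nonneg_right e4 hZs0
    linarith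
  have h6 := mul_le_mul_of_nonneg_right hc1 hD₁0
  have h7 := mul_le_mul_of_nonneg_right hc2 hD₂0
  have h8 := mul_le_mul_of_nonneg_left h4 (mul_nonneg hE0.le hr0.le)
  have h9 := mul_le_mul_of_nonneg_right hrc (add_nonneg hD₁0 hD₂0)
  have h10 : 1 ≤ r⁻¹ ^ 3 * (ε ^ 2)⁻¹ := by
    have : 1 ≤ r⁻¹ ^ 3 := one_le_pow₀ ((one_le_inv₀ hr0).2 hr1)
    exact one_le_mul_of_one_le_of_one_le this hε2
  have h11 : E * r * (CP * Zs) + N * (4 * CL ^ 2 * (r ^ 2)⁻¹ * (ε ^ 2)⁻¹) * Zs ≤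
      r * F * (r⁻¹ ^ 3 * (ε ^ 2)⁻¹) * Zs := by
    have e1 : (r ^ 2)⁻¹ = r * r⁻¹ ^ 3 := by field_simp
    rw [e1, hF]
    have := mul_le_mul_of_nonneg_left h10 (by positivity : 0 ≤ E * r * (CP * Zs))
    linarith
  have h12 : r * F * (r⁻¹ ^ 3 * (ε ^ 2)⁻¹) * Zs ≤
      r⁻¹ ^ 3 * lam * (ε ^ 2)⁻¹ * Zs - lam / 2 * Zs := by
    have e1 := mul_le_mul_of_nonneg_right hrl (by positivity : 0 ≤ r⁻¹ ^ 3 * (ε ^ 2)⁻¹ * Zs)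
    have e2 := mul_le_mul_of_nonneg_right h10 (by positivity : 0 ≤ lam / 2 * Zs)
    linarith
  have e3 : A * (C * (r * Θ)) + B * (N * (2 * (r * Θ))) = E * r * Θ := by rw [hE]; ring
  linarith

/-! ### Equivalence of the functional and the weighted norm -/

/-- Young with parameter `r²`: the powers of `r` are such that each mixed term costs only the
fraction `r/2` of the two diagonal terms. -/
lemma abs_mixed_le {a r ε F G p B S : ℝ} (hr : 0 < r) (ha : 0 ≤ a) (ha1 : a ≤ 1) (hp : |p| ≤ F * G)
    (hB : a * r * ε ^ 2 * F ^ 2 ≤ B) (hS : G ^ 2 ≤ S) :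
    |a * ε * p| ≤ r / 2 * (B + r⁻¹ ^ 3 * S) := by
  have hε : |a * ε * p| ≤ a * (|ε| * (F * G)) := by
    rw [abs_mul, abs_mul, abs_of_nonneg ha, mul_assoc]
    gcongr
  have h1 : |ε| * (F * G) ≤ (r ^ 2 * (ε ^ 2 * F ^ 2) + (r ^ 2)⁻¹ * G ^ 2) / 2 := by
    have h := sq_nonneg (r * (|ε| * F) - r⁻¹ * G)
    have e1 : (r * (|ε| * F) - r⁻¹ * G) ^ 2 =
        r ^ 2 * (|ε| ^ 2 * F ^ 2) + (r ^ 2)⁻¹ * G ^ 2 - 2 * (|ε| * (F * G)) := by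
      field_simp
      ring
    rw [e1, sq_abs] at h
    linarith
  have h2 := mul_le_mul_of_nonneg_left h1 ha
  have h3 := mul_le_mul_of_nonneg_left hB hr.le
  have h4 : a * ((r ^ 2)⁻¹ * G ^ 2) ≤ (r ^ 2)⁻¹ * S := by
    have e1 : 0 ≤ (r ^ 2)⁻¹ * G ^ 2 := by positivity
    have e2 := mul_le_mul_of_nonneg_right ha1 e1
    have e3 := mul_le_mul_of_nonneg_left hS (by positivity : 0 ≤ (r ^ 2)⁻¹)
    linarith
  have e1 : r / 2 * (B + r⁻¹ ^ 3 * S) = (r * B + (r ^ 2)⁻¹ * S) / 2 := by field_simp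
  rw [e1]
  linarith

lemma hEpsSq_equiv (N k : ℕ) {r : ℝ} (hr : 0 < r) (hr1 : r ≤ 1)
    (hrN : r * ((midx N k).card * N) ≤ 1) :
    ∃ c C : ℝ, 0 < c ∧ 0 < C ∧ ∀ ε : ℝ, ∀ f : L2xv N,
      c * weightedSq k ε f ≤ hEpsSq k (coefB k r) (coefAlpha r) (coefA k r) ε f ∧
        hEpsSq k (coefB k r) (coefAlpha r) (coefA k r) ε f ≤ C * weightedSq k ε f := by
  -- All mixed terms together take at most half of the diagonal part, whence the factors `1/2` and
  -- `3/2`. The other half of `1/4` absorbs the repeated `‖f‖²`, which is already the `l = 0` term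
  -- of the second sum.
  refine ⟨r ^ ((k + 1) * (k + 1) + k) / 4, 3 / 2 * r⁻¹ ^ 3, by positivity, by positivity, ?_⟩
  intro ε f
  unfold hEpsSq weightedSq
  obtain ⟨X, hX⟩ : ∃ X : ℝ, X = ∑ m ∈ (midx2 N k).filter (fun m => 1 ≤ len m.1),
    ‖pd m.1 m.2 f‖ ^ 2 := ⟨_, rfl⟩
  obtain ⟨S, hS⟩ : ∃ S : ℝ, S = ∑ l ∈ midx N k, ‖pd 0 l f‖ ^ 2 := ⟨_, rfl⟩
  obtain ⟨B, hB⟩ : ∃ B : ℝ, B = ∑ m ∈ (midx2 N k).filter (fun m => 1 ≤ len m.1),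
    coefB k r m.1 m.2 * ε ^ 2 * ‖pd m.1 m.2 f‖ ^ 2 := ⟨_, rfl⟩
  obtain ⟨M, hM⟩ : ∃ M : ℝ, M = ∑ l ∈ midx N k, ∑ i ∈ Finset.univ.filter (fun i => 0 < l i),
    coefA k r i l * ε * ⟪pd (dl i) (l - dl i) f, pd 0 l f⟫_ℝ := ⟨_, rfl⟩
  have hα : ∑ l ∈ midx N k, coefAlpha r l * ‖pd 0 l f‖ ^ 2 = r⁻¹ ^ 3 * S := by
    rw [hS, Finset.mul_sum]; rfl
  rw [← hX, ← hS, ← hB, ← hM, hα]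
  have hBterm : ∀ m : (Fin N → ℕ) × (Fin N → ℕ),
      0 ≤ coefB k r m.1 m.2 * ε ^ 2 * ‖pd m.1 m.2 f‖ ^ 2 := fun m => by
    unfold coefB; positivity
  have hX0 : 0 ≤ X := hX ▸ Finset.sum_nonneg fun m _ => by positivity
  have hS0 : 0 ≤ S := hS ▸ Finset.sum_nonneg fun m _ => by positivity
  have hB0 : 0 ≤ B := hB ▸ Finset.sum_nonneg fun m _ => hBterm m
  have hri : 1 ≤ r⁻¹ ^ 3 := one_le_pow₀ ((one_le_inv₀ hr).2 hr1)
  have hfS : ‖f‖ ^ 2 ≤ S := by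
    have := Finset.single_le_sum (f := fun l : Fin N → ℕ => ‖pd 0 l f‖ ^ 2)
      (fun l _ => by positivity) (mem_midx.2 (by rw [len_zero]; omega) : (0 : Fin N → ℕ) ∈ midx N k)
    simp only [pd_zero_zero] at this
    rwa [← hS] at this
  have hBX : r ^ ((k + 1) * (k + 1) + k) * (ε ^ 2 * X) ≤ B := by
    rw [hX, hB, Finset.mul_sum, Finset.mul_sum]
    refine Finset.sum_le_sum fun m hm => ?_
    unfold coefB
    rw [← mul_assoc]
    have := pow_le_pow_of_le_one hr.le hr1 (wt_le (Finset.mem_of_mem_filter _ hm))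
    gcongr
  have hBX' : B ≤ ε ^ 2 * X := by
    rw [hX, hB, Finset.mul_sum]
    refine Finset.sum_le_sum fun m _ => ?_
    unfold coefB
    have : r ^ wt k m.1 m.2 ≤ 1 := pow_le_one₀ hr.le hr1
    have h2 : 0 ≤ ε ^ 2 * ‖pd m.1 m.2 f‖ ^ 2 := by positivity
    have := mul_le_mul_of_nonneg_right this h2
    linarith
  have hMle : |M| ≤ 1 / 2 * (B + r⁻¹ ^ 3 * S) := by
    obtain ⟨t, ht⟩ : ∃ t : ℝ, t = r / 2 * (B + r⁻¹ ^ 3 * S) := ⟨_, rfl⟩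
    have hpos : 0 ≤ B + r⁻¹ ^ 3 * S := by positivity
    have ht0 : 0 ≤ t := by rw [ht]; positivity
    have hrow : ∀ l ∈ midx N k, |∑ i ∈ Finset.univ.filter (fun i => 0 < l i),
        coefA k r i l * ε * ⟪pd (dl i) (l - dl i) f, pd 0 l f⟫_ℝ| ≤ N * t := by
      intro l hl
      refine (Finset.abs_sum_le_sum_abs _ _).trans ?_
      have : ∀ i ∈ Finset.univ.filter (fun i => 0 < l i),
          |coefA k r i l * ε * ⟪pd (dl i) (l - dl i) f, pd 0 l f⟫_ℝ| ≤ t := by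
        intro i hi
        have hi' : 0 < l i := (Finset.mem_filter.1 hi).2
        rw [ht]
        refine abs_mixed_le hr (by unfold coefA; positivity) (pow_le_one₀ hr.le hr1)
          (abs_real_inner_le_norm _ _) ?_ ?_
        · have := Finset.single_le_sum (f := fun m : (Fin N → ℕ) × (Fin N → ℕ) =>
            coefB k r m.1 m.2 * ε ^ 2 * ‖pd m.1 m.2 f‖ ^ 2) (fun m _ => hBterm m)
            (mixed_mem hi' hl)
          rw [← hB] at this
          simp only [coefB, wt_mixed k hi', pow_succ r] at this
          exact this
        · rw [hS]
          exact Finset.single_le_sum (f := fun l : Fin N → ℕ => ‖pd 0 l f‖ ^ 2)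
            (fun l _ => by positivity) hl
      refine (Finset.sum_le_card_nsmul _ _ _ this).trans ?_
      rw [nsmul_eq_mul]
      refine mul_le_mul_of_nonneg_right ?_ ht0
      have := Finset.card_filter_le (Finset.univ : Finset (Fin N)) (fun i => 0 < l i)
      rw [Finset.card_univ, Fintype.card_fin] at this
      exact_mod_cast this
    rw [hM]
    refine (Finset.abs_sum_le_sum_abs _ _).trans ((Finset.sum_le_card_nsmul _ _ _ hrow).trans ?_)
    rw [nsmul_eq_mul, ht]
    have := mul_le_mul_of_nonneg_right hrN hpos
    linarith
  obtain ⟨hM1, hM2⟩ := abs_le.1 hMle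
  have hp1 : r ^ ((k + 1) * (k + 1) + k) ≤ 1 := pow_le_one₀ hr.le hr1
  constructor
  · have e1 : r ^ ((k + 1) * (k + 1) + k) * (‖f‖ ^ 2 + S) ≤ 2 * S := by
      have := mul_le_mul_of_nonneg_right hp1 (by positivity : 0 ≤ ‖f‖ ^ 2 + S)
      linarith
    have e2 := mul_le_mul_of_nonneg_right hri hS0
    linarith
  · have e1 := mul_le_mul_of_nonneg_right hri (by positivity : 0 ≤ ε ^ 2 * X)
    have e2 : 0 ≤ r⁻¹ ^ 3 * ‖f‖ ^ 2 := by positivity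
    linarith

/-! ### Energy estimates at a fixed time -/

/-- The terms of the equation at a fixed time. -/
structure Snapshot {N : ℕ} (k : ℕ) (ε : ℝ) (L Λ : L2v N →ₗ.[ℝ] L2v N)
    (h ht q z r τ : L2xv N) : Prop where
  mem : MemH k h
  mem_q : MemH k q
  mem_z : MemH k z
  mem_r : MemH k r
  mem_τ : MemH k τ
  actsL : Acts L h q
  actsΛ : Acts Λ h z
  weak : tField.Weak h τ
  eqn : ht = (ε ^ 2)⁻¹ • q + ε⁻¹ • r + (-ε⁻¹) • τ

variable {N k : ℕ} {ε : ℝ} {L K Λ : L2v N →ₗ.[ℝ] L2v N} {nΛ : L2v N → ℝ≥0∞}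
  {h ht q z r τ : L2xv N}

lemma Snapshot.mem_ht (S : Snapshot k ε L Λ h ht q z r τ) : MemH k ht := by
  rw [S.eqn]
  exact ((S.mem_q.smul _).add (S.mem_r.smul _)).add (S.mem_τ.smul _)

lemma Snapshot.inner_pd (S : Snapshot k ε L Λ h ht q z r τ) {j l : Fin N → ℕ}
    (hjl : len j + len l ≤ k) (w : L2xv N) : ⟪pd j l ht, w⟫_ℝ =
      (ε ^ 2)⁻¹ * ⟪pd j l q, w⟫_ℝ + ε⁻¹ * ⟪pd j l r, w⟫_ℝ - ε⁻¹ * ⟪pd j l τ, w⟫_ℝ := by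
  rw [S.eqn, pd_add ((S.mem_q.smul _).add (S.mem_r.smul _)) (S.mem_τ.smul _) hjl,
    pd_add (S.mem_q.smul _) (S.mem_r.smul _) hjl, pd_smul S.mem_q _ hjl, pd_smul S.mem_r _ hjl,
    pd_smul S.mem_τ _ hjl]
  simp only [inner_add_left, real_inner_smul_left]
  ring

lemma Snapshot.weak_pd_x (S : Snapshot k ε L Λ h ht q z r τ) {l : Fin N → ℕ} (hl : len l ≤ k) :
    tField.Weak (pd 0 l h) (pd 0 l τ) := by
  have := weak_tField_pd S.mem S.mem_τ S.weak 0 l (by rw [len_zero]; omega)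
  simpa using this

/-- The contribution `Γ/ε` can be tested against `(∂^0_l h)^⊥` only, because `Γ` is orthogonal to
`Ker L`. Half of the gap `2λ/ε²` then absorbs it and leaves a bound uniform in `ε`. -/
lemma Snapshot.energy_x (S : Snapshot k ε L Λ h ht q z r τ) (hε : 0 < ε) (hL : L.IsClosed)
    {d : ℕ} {φ : Fin d → L2v N} {lam : ℝ} (hlam : 0 < lam)
    (hrel : ∀ u : L.domain, nΛ ((u : L2v N) - ∑ i, ⟪φ i, (u : L2v N)⟫_ℝ • φ i) ≠ ⊤ ∧
      ⟪L u, (u : L2v N)⟫_ℝ ≤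
        -lam * (nΛ ((u : L2v N) - ∑ i, ⟪φ i, (u : L2v N)⟫_ℝ • φ i)).toReal ^ 2)
    (hr : ∀ i, ∀ᵐ x : Tor N, ⟪φ i, slice r x⟫_ℝ = 0) {gx : ℝ} {l : Fin N → ℕ} (hl : len l ≤ k)
    (hgx : ∀ f : L2xv N, lamNorm nΛ f ≠ ⊤ → |⟪pd 0 l r, f⟫_ℝ| ≤ gx * lamR nΛ f) :
    2 * ⟪pd 0 l ht, pd 0 l h⟫_ℝ ≤
      -(lam / ε ^ 2) * lamR nΛ (perp φ (pd 0 l h)) ^ 2 + gx ^ 2 / lam := by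
  have h0l : len (0 : Fin N → ℕ) + len l ≤ k := by rw [len_zero]; omega
  obtain ⟨hfin, hco⟩ := coercive_perp hlam hrel (S.actsL.pd hL S.mem S.mem_q l hl)
  have h1 : ⟪pd 0 l τ, pd 0 l h⟫_ℝ = 0 := by
    have := (S.weak_pd_x hl).strong.inner_eq (S.weak_pd_x hl).strong
    rw [real_inner_comm] at this
    rw [real_inner_comm]
    linarith
  have h2 := (le_abs_self _).trans (hgx _ hfin)
  rw [inner_perp_right φ (fun i => inner_slice_pd_eq_zero (φ i) S.mem_r (hr i) l hl)] at h2
  rw [S.inner_pd h0l, h1, mul_zero, sub_zero]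
  set Z := lamR nΛ (perp φ (pd 0 l h))
  have h3 := mul_le_mul_of_nonneg_left hco (by positivity : 0 ≤ (ε ^ 2)⁻¹)
  have h4 := mul_le_mul_of_nonneg_left h2 (by positivity : 0 ≤ ε⁻¹)
  have h5 : 2 * (ε⁻¹ * (gx * Z)) ≤ lam / ε ^ 2 * Z ^ 2 + gx ^ 2 / lam := by
    have e1 : lam / ε ^ 2 * Z ^ 2 + gx ^ 2 / lam - 2 * (ε⁻¹ * (gx * Z)) =
        (lam * (ε⁻¹ * Z) - gx) ^ 2 / lam := by
      field_simp
      ring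
    have : 0 ≤ (lam * (ε⁻¹ * Z) - gx) ^ 2 / lam := by positivity
    linarith
  have e2 : (ε ^ 2)⁻¹ * (-lam * Z ^ 2) = -(lam / ε ^ 2 * Z ^ 2) := by ring
  linarith

lemma flow_xField_vField (i m : Fin N) (s t : ℝ) (p : Tor N × Vel N) :
    (xField i).flow s ((vField m).flow t p) = (vField m).flow t ((xField i).flow s p) := by
  simp [Drift.flow, xField, vField, mkT_zero]

/-- The gain of a full `‖∂^0_l h‖²` comes from the commutator with transport. The swap of `x`- and
`v`-derivatives makes both halves of the product rule equal, so the terms in `L` and `Γ` involve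
only derivatives in `x` of those terms. -/
lemma Snapshot.energy_mixed (S : Snapshot k ε L Λ h ht q z r τ) (hε : 0 < ε) (hL : L.IsClosed)
    (hn : IsExtNorm nΛ) {d : ℕ} {φ : Fin d → L2v N} {lam : ℝ} (hlam : 0 < lam)
    (hker : ∀ i, InKer L (φ i))
    (hrel : ∀ u : L.domain, nΛ ((u : L2v N) - ∑ i, ⟪φ i, (u : L2v N)⟫_ℝ • φ i) ≠ ⊤ ∧
      ⟪L u, (u : L2v N)⟫_ℝ ≤
        -lam * (nΛ ((u : L2v N) - ∑ i, ⟪φ i, (u : L2v N)⟫_ℝ • φ i)).toReal ^ 2)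
    {CL : ℝ} (hCL : 0 < CL) (hb : ∀ (u : L.domain) (w : L2v N), nΛ w ≠ ⊤ →
      ⟪L u, w⟫_ℝ ≤ CL * (nΛ u).toReal * (nΛ w).toReal)
    {gx : ℝ} {i : Fin N} {l : Fin N → ℕ} (hi : 0 < l i) (hl : len l ≤ k)
    (hw : lamNorm nΛ (pd (dl i) (l - dl i) h) ≠ ⊤)
    (hgx : ∀ f : L2xv N, lamNorm nΛ f ≠ ⊤ → |⟪pd 0 l r, f⟫_ℝ| ≤ gx * lamR nΛ f)
    {s : ℝ} (hs : 0 < s) :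
    ε * (⟪pd (dl i) (l - dl i) ht, pd 0 l h⟫_ℝ + ⟪pd (dl i) (l - dl i) h, pd 0 l ht⟫_ℝ) ≤
      -‖pd 0 l h‖ ^ 2 + 2 * s * lamR nΛ (pd (dl i) (l - dl i) h) ^ 2 +
        4 * CL ^ 2 / (s * ε ^ 2) * lamR nΛ (perp φ (pd 0 l h)) ^ 2 + gx ^ 2 / s := by
  have h0l : len (0 : Fin N → ℕ) + len l ≤ k := by rw [len_zero]; omega
  have hl' := len_sub_dl hi
  have hjl : len (dl i) + len (l - dl i) ≤ k := by rw [len_dl]; omega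
  have h0l' : len (0 : Fin N → ℕ) + len (l - dl i) + 1 ≤ k := by rw [len_zero]; omega
  have hx {f : L2xv N} (hf : MemH k f) : (xField i).Strong (pd 0 (l - dl i) f) (pd 0 l f) := by
    have := hf.weak_x i h0l'
    rw [sub_add_dl hi] at this
    exact this.strong
  have hv {f : L2xv N} (hf : MemH k f) :
      (vField i).Strong (pd 0 (l - dl i) f) (pd (dl i) (l - dl i) f) := by
    have := hf.weak_v i h0l'
    rw [zero_add] at this
    exact this.strong
  have swap {f : L2xv N} (hf : MemH k f) :
      ⟪pd (dl i) (l - dl i) f, pd 0 l h⟫_ℝ = ⟪pd 0 l f, pd (dl i) (l - dl i) h⟫_ℝ :=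
    Drift.Strong.inner_swap (flow_xField_vField i i) (hx hf) (hv hf) (hx S.mem) (hv S.mem)
  set w := pd (dl i) (l - dl i) h
  -- Skew-symmetry gives `⟨∂_l τ, w⟩ = ‖∂_l h‖² - ⟨∂_l h, ∂^{δ_i}_{l-δ_i} τ⟩`, and the swap
  -- identifies the last pairing with the first.
  have hτ : 2 * ⟪pd 0 l τ, w⟫_ℝ = ‖pd 0 l h‖ ^ 2 := by
    have h1 := weak_tField_pd S.mem S.mem_τ S.weak (dl i) (l - dl i) hjl
    have e1 : ∑ m, ((dl i : Fin N → ℕ) m : ℝ) • pd (dl i - dl m) (l - dl i + dl m) h =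
        pd 0 l h := by
      rw [Finset.sum_eq_single i]
      · simp [dl]
        rw [← dl, sub_add_dl hi]
      · intro m _ hm
        simp [dl, hm]
      · simp
    rw [e1] at h1
    have h2 := (S.weak_pd_x hl).strong.inner_eq h1.strong
    rw [inner_sub_right, real_inner_self_eq_norm_sq, real_inner_comm _ (pd 0 l h),
      swap S.mem_τ] at h2
    linarith
  obtain ⟨hfin, -⟩ := coercive_perp hlam hrel (S.actsL.pd hL S.mem S.mem_q l hl)
  have hq := inner_le_perp hn hker hCL hb (S.actsL.pd hL S.mem S.mem_q l hl) hfin hw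
    -- After multiplication by `2ε⁻¹` this choice leaves exactly `s` in front of the `v`-derivative;
    -- the `Γ` term contributes a second `s`.
    (t := 2 * CL / (ε * s)) (by positivity)
  have hr := (le_abs_self _).trans (hgx _ hw)
  rw [swap S.mem_ht, real_inner_comm (pd 0 l ht) w, S.inner_pd h0l]
  have h3 : gx * lamR nΛ w * 2 ≤ s * lamR nΛ w ^ 2 + gx ^ 2 / s := by
    have e1 : s * lamR nΛ w ^ 2 + gx ^ 2 / s - gx * lamR nΛ w * 2 =
        (s * lamR nΛ w - gx) ^ 2 / s := by
      field_simp
      ring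
    have : 0 ≤ (s * lamR nΛ w - gx) ^ 2 / s := by positivity
    linarith
  have h4 := mul_le_mul_of_nonneg_left hq (by positivity : 0 ≤ 2 * ε⁻¹)
  have e2 : 2 * ε⁻¹ * (CL * (2 * CL / (ε * s) * lamR nΛ (perp φ (pd 0 l h)) ^ 2 +
      (2 * CL / (ε * s))⁻¹ * lamR nΛ w ^ 2)) =
      4 * CL ^ 2 / (s * ε ^ 2) * lamR nΛ (perp φ (pd 0 l h)) ^ 2 + s * lamR nΛ w ^ 2 := by
    field_simp
    ring
  rw [e2] at h4
  have e3 : ε * ((ε ^ 2)⁻¹ * ⟪pd 0 l q, w⟫_ℝ + ε⁻¹ * ⟪pd 0 l r, w⟫_ℝ - ε⁻¹ * ⟪pd 0 l τ, w⟫_ℝ +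
      ((ε ^ 2)⁻¹ * ⟪pd 0 l q, w⟫_ℝ + ε⁻¹ * ⟪pd 0 l r, w⟫_ℝ - ε⁻¹ * ⟪pd 0 l τ, w⟫_ℝ)) =
      2 * ε⁻¹ * ⟪pd 0 l q, w⟫_ℝ + 2 * ⟪pd 0 l r, w⟫_ℝ - 2 * ⟪pd 0 l τ, w⟫_ℝ := by
    field_simp
    ring
  rw [e3]
  linarith

lemma acts_of_decomp {N : ℕ} {L K Λ : L2v N →ₗ.[ℝ] L2v N} (hd : L = K - Λ) {h q z : L2xv N}
    (hL : Acts L h q) (hΛ : Acts Λ h z) : Acts K h (q + z) := by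
  subst hd
  filter_upwards [hL, hΛ, slice_add q z] with x ⟨h1, e1⟩ ⟨h2, e2⟩ h3
  refine ⟨h1.1, ?_⟩
  rw [h3, ← e1, ← e2, LinearPMap.sub_apply]
  simp

/-- The squares of the norms that control the dissipation. -/
def lamQ {N : ℕ} (nΛ : L2v N → ℝ≥0∞) (h : L2xv N) (j l : Fin N → ℕ) : ℝ :=
  if j = 0 then ‖pd j l h‖ ^ 2 else lamR nΛ (pd j l h) ^ 2

lemma lamQ_nonneg {N : ℕ} (nΛ : L2v N → ℝ≥0∞) (h : L2xv N) (j l : Fin N → ℕ) :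
    0 ≤ lamQ nΛ h j l := by
  unfold lamQ
  split_ifs <;> positivity

section

variable {N k : ℕ} {L K Λ : L2v N →ₗ.[ℝ] L2v N} {nΛ : L2v N → ℝ≥0∞}

/-- Finiteness is contained in the coercivity lower bound of (H1'), applied at the exact order of
the derivative. -/
lemma Snapshot.lamNorm_pd_ne_top {ε : ℝ} {h ht q z r τ : L2xv N}
    (S : Snapshot k ε L Λ h ht q z r τ) (hH1 : H1' L K Λ nΛ)
    {j l : Fin N → ℕ} (hj : 1 ≤ len j) (hjl : len j + len l ≤ k) :
    lamNorm nΛ (pd j l h) ≠ ⊤ := by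
  obtain ⟨ν₅, ν₆, -, -, hdef⟩ := hH1.defect (len j + len l) (by omega)
  exact (hdef j l rfl hj h z (S.mem.mono hjl) S.actsΛ (S.mem_z.mono hjl)).1

lemma Snapshot.norm_sq_le_lamQ {ε : ℝ} {h ht q z r τ : L2xv N}
    (S : Snapshot k ε L Λ h ht q z r τ) (hH1 : H1' L K Λ nΛ) {cn : ℝ} (hcn : 0 < cn)
    (hle : ∀ f : L2xv N, lamNorm nΛ f ≠ ⊤ → ‖f‖ ^ 2 ≤ cn * lamR nΛ f ^ 2)
    {j l : Fin N → ℕ} (hjl : len j + len l ≤ k) :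
    ‖pd j l h‖ ^ 2 ≤ (cn + 1) * lamQ nΛ h j l := by
  unfold lamQ
  split_ifs with hj
  · have : 0 ≤ cn * ‖pd j l h‖ ^ 2 := by positivity
    linarith
  · have hj' : 1 ≤ len j := by
      by_contra hc
      exact hj (len_eq_zero.1 (by omega))
    have := hle _ (S.lamNorm_pd_ne_top hH1 hj' hjl)
    have h2 : 0 ≤ lamR nΛ (pd j l h) ^ 2 := by positivity
    linarith

/-- The total order dominates because the secondary entry is at most `k < k + 1`. Orders zero and
one share a block, and there `1 ≤ len j` keeps the inequality strict. -/
lemma wt_lt_of_len_lt {j l j' l' : Fin N → ℕ} (hj : 1 ≤ len j)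
    (h : len j' + len l' < len j + len l) (hk : len j' ≤ k) : wt k j' l' < wt k j l := by
  unfold wt
  rcases Nat.eq_zero_or_pos (len j' + len l') with h0 | h0
  · have h1 := Nat.mul_le_mul_right (k + 1)
      ((max_eq_right (by omega : len j' + len l' ≤ 1)).le.trans (le_max_right (len j + len l) 1))
    omega
  · rw [max_eq_left (by omega), max_eq_left (by omega)]
    have h1 := Nat.mul_le_mul_right (k + 1) (Nat.succ_le_of_lt h)
    rw [Nat.succ_mul] at h1
    omega

/-- The commutator keeps the total order and loses one `v`-derivative; the second entry of `wt`
exists for this case. -/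
lemma wt_comm_lt {i : Fin N} {j l : Fin N → ℕ} (hi : 0 < j i) :
    wt k (j - dl i) (l + dl i) < wt k j l := by
  have := len_sub_dl hi
  unfold wt
  rw [len_add, len_dl, show len (j - dl i) + (len l + 1) = len j + len l by omega]
  omega

lemma hNorm_sq_le_lower {j l : Fin N → ℕ} (hj : 1 ≤ len j) (hjl : len j + len l ≤ k)
    (h : L2xv N) : hNorm (len j + len l - 1) h ^ 2 ≤
      ∑ m ∈ (midx2 N k).filter (fun m => wt k m.1 m.2 < wt k j l), ‖pd m.1 m.2 h‖ ^ 2 := by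
  unfold hNorm
  rw [Real.sq_sqrt (Finset.sum_nonneg fun m _ => by positivity)]
  refine Finset.sum_le_sum_of_subset_of_nonneg (fun m hm => ?_) fun m _ _ => by positivity
  rw [mem_midx2] at hm
  rw [Finset.mem_filter, mem_midx2]
  exact ⟨by omega, wt_lt_of_len_lt hj (by omega) (by omega)⟩

lemma norm_commutator_sq_le {j l : Fin N → ℕ} (hjl : len j + len l ≤ k) (h : L2xv N) :
    ‖∑ i, (j i : ℝ) • pd (j - dl i) (l + dl i) h‖ ^ 2 ≤ (k : ℝ) ^ 2 *
      ∑ m ∈ (midx2 N k).filter (fun m => wt k m.1 m.2 < wt k j l), ‖pd m.1 m.2 h‖ ^ 2 := by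
  obtain ⟨S, hS⟩ : ∃ S : ℝ, S =
    ∑ m ∈ (midx2 N k).filter (fun m => wt k m.1 m.2 < wt k j l), ‖pd m.1 m.2 h‖ ^ 2 := ⟨_, rfl⟩
  have hS0 : 0 ≤ S := hS ▸ Finset.sum_nonneg fun m _ => by positivity
  rw [← hS]
  have hterm : ∀ i ∈ (Finset.univ : Finset (Fin N)),
      ‖(j i : ℝ) • pd (j - dl i) (l + dl i) h‖ ≤ j i * √S := by
    intro i _
    rw [norm_smul, Real.norm_natCast]
    rcases Nat.eq_zero_or_pos (j i) with h0 | h0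
    · simp [h0]
    · refine mul_le_mul_of_nonneg_left (Real.le_sqrt_of_sq_le ?_) (Nat.cast_nonneg _)
      have hm : (j - dl i, l + dl i) ∈
          (midx2 N k).filter (fun m => wt k m.1 m.2 < wt k j l) := by
        have := len_sub_dl h0
        rw [Finset.mem_filter, mem_midx2]
        refine ⟨?_, wt_comm_lt h0⟩
        simp only [len_add, len_dl]
        omega
      have hle := Finset.single_le_sum
        (f := fun m : (Fin N → ℕ) × (Fin N → ℕ) => ‖pd m.1 m.2 h‖ ^ 2)
        (fun m _ => sq_nonneg ‖pd m.1 m.2 h‖) hm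
      rw [← hS] at hle
      exact hle
  have h1 : ‖∑ i, (j i : ℝ) • pd (j - dl i) (l + dl i) h‖ ≤ k * √S := by
    refine (norm_sum_le_of_le _ hterm).trans ?_
    rw [← Finset.sum_mul]
    refine mul_le_mul_of_nonneg_right ?_ (Real.sqrt_nonneg _)
    have : len j ≤ k := by omega
    unfold len at this
    exact_mod_cast this
  refine (pow_le_pow_left₀ (norm_nonneg _) h1 2).trans ?_
  rw [mul_pow, Real.sq_sqrt hS0]

lemma two_mul_le_sq_add {θ : ℝ} (hθ : 0 < θ) (a b : ℝ) : 2 * (a * b) ≤ θ * a ^ 2 + b ^ 2 / θ := by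
  have e1 : θ * a ^ 2 + b ^ 2 / θ - 2 * (a * b) = (θ * a - b) ^ 2 / θ := by
    field_simp
    ring
  have : 0 ≤ (θ * a - b) ^ 2 / θ := by positivity
  linarith

/-- The factor `ε²` cancels the singular coefficient of `L`, whose part `-Λ` is coercive up to lower
order and whose part `K` is a small perturbation up to lower order. Transport acts only through its
commutator, with the harmless factor `ε ≤ 1`. -/
theorem exists_energy_v (hH1 : H1' L K Λ nΛ) (hH2 : H2' K) {cn : ℝ} (hcn : 0 < cn)
    (hle : ∀ f : L2xv N, lamNorm nΛ f ≠ ⊤ → ‖f‖ ^ 2 ≤ cn * lamR nΛ f ^ 2)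
    (j l : Fin N → ℕ) (hj : 1 ≤ len j) (hjl : len j + len l ≤ k) :
    ∃ M : ℝ, 0 < M ∧ ∀ ε : ℝ, 0 < ε → ε ≤ 1 → ∀ h ht q z r τ : L2xv N,
      Snapshot k ε L Λ h ht q z r τ → ∀ gxv : ℝ,
      (∀ f : L2xv N, lamNorm nΛ f ≠ ⊤ → |⟪pd j l r, f⟫_ℝ| ≤ gxv * lamR nΛ f) →
      ε ^ 2 * (2 * ⟪pd j l ht, pd j l h⟫_ℝ) ≤ -M⁻¹ * lamQ nΛ h j l +
        M * (∑ m ∈ (midx2 N k).filter (fun m => wt k m.1 m.2 < wt k j l), lamQ nΛ h m.1 m.2) +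
        M * (ε ^ 2 * gxv ^ 2) := by
  obtain ⟨ν₅, ν₆, hν₅, hν₆, hdef⟩ := hH1.defect (len j + len l) (by omega)
  -- Three copies of `θ‖w‖²` occur, two from `K` and one from the commutator; together they cost
  -- `ν₅/2` of the dissipation `2ν₅`. The `Γ` term costs another `ν₅/2`.
  obtain ⟨θ, hθ⟩ : ∃ θ : ℝ, θ = ν₅ / (6 * cn) := ⟨_, rfl⟩
  have hθ0 : 0 < θ := by rw [hθ]; positivity
  obtain ⟨Cδ, hCδ, hmix⟩ := hH2 (len j + len l) (by omega) j l rfl hj θ hθ0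
  obtain ⟨C₁, hC₁⟩ : ∃ C₁ : ℝ, C₁ = (2 * Cδ + 2 * ν₆ + (k : ℝ) ^ 2 / θ) * (cn + 1) := ⟨_, rfl⟩
  have hC₁0 : 0 < C₁ := by rw [hC₁]; positivity
  refine ⟨ν₅⁻¹ + C₁ + 2 / ν₅, by positivity, ?_⟩
  intro ε hε hε1 h ht q z r τ S gxv hgxv
  have hj0 : j ≠ 0 := by
    rintro rfl
    rw [len_zero] at hj
    omega
  have hQ : lamQ nΛ h j l = lamR nΛ (pd j l h) ^ 2 := if_neg hj0
  obtain ⟨hfin, hd⟩ := hdef j l rfl hj h z (S.mem.mono hjl) S.actsΛ (S.mem_z.mono hjl)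
  change ν₅ * lamR nΛ (pd j l h) ^ 2 - ν₆ * hNorm (len j + len l - 1) h ^ 2 ≤ _ at hd
  have hK := hmix h (q + z) (S.mem.mono hjl) (acts_of_decomp hH1.h1.decomp S.actsL S.actsΛ)
    ((S.mem_q.mono hjl).add (S.mem_z.mono hjl))
  rw [pd_add S.mem_q S.mem_z hjl, inner_add_left] at hK
  have hlow := hNorm_sq_le_lower hj hjl h
  have hcom := norm_commutator_sq_le hjl h
  have hlow2 : ∑ m ∈ (midx2 N k).filter (fun m => wt k m.1 m.2 < wt k j l), ‖pd m.1 m.2 h‖ ^ 2 ≤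
      (cn + 1) * ∑ m ∈ (midx2 N k).filter (fun m => wt k m.1 m.2 < wt k j l),
        lamQ nΛ h m.1 m.2 := by
    rw [Finset.mul_sum]
    refine Finset.sum_le_sum fun m hm => S.norm_sq_le_lamQ hH1 hcn hle ?_
    exact mem_midx2.1 (Finset.mem_of_mem_filter _ hm)
  obtain ⟨s, hs⟩ : ∃ s : ℝ, s =
    ∑ m ∈ (midx2 N k).filter (fun m => wt k m.1 m.2 < wt k j l), lamQ nΛ h m.1 m.2 := ⟨_, rfl⟩
  have hs0 : 0 ≤ s := hs ▸ Finset.sum_nonneg fun m _ => lamQ_nonneg _ _ _ _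
  rw [← hs] at hlow2 ⊢
  have hτ : ⟪pd j l τ, pd j l h⟫_ℝ =
      ⟪∑ i, (j i : ℝ) • pd (j - dl i) (l + dl i) h, pd j l h⟫_ℝ := by
    have h1 := (weak_tField_pd S.mem S.mem_τ S.weak j l hjl).strong
    have h2 := h1.inner_eq h1
    rw [real_inner_comm _ (pd j l h), inner_sub_left] at h2
    linarith
  rw [S.inner_pd hjl, hτ, hQ]
  set w := pd j l h
  set G := ∑ i, (j i : ℝ) • pd (j - dl i) (l + dl i) h
  have hr := (le_abs_self _).trans (hgxv _ hfin)
  have hw := hle w hfin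
  set X := lamR nΛ w
  have e1 : ε ^ 2 * (2 * ((ε ^ 2)⁻¹ * ⟪pd j l q, w⟫_ℝ + ε⁻¹ * ⟪pd j l r, w⟫_ℝ - ε⁻¹ * ⟪G, w⟫_ℝ)) =
      2 * ⟪pd j l q, w⟫_ℝ + 2 * ε * ⟪pd j l r, w⟫_ℝ - ε * (2 * ⟪G, w⟫_ℝ) := by
    field_simp
  rw [e1]
  have h1 : -(ε * (2 * ⟪G, w⟫_ℝ)) ≤ θ * ‖w‖ ^ 2 + ‖G‖ ^ 2 / θ := by
    have a1 := neg_le_of_abs_le (abs_real_inner_le_norm G w)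
    have a2 := two_mul_le_sq_add hθ0 ‖w‖ ‖G‖
    have a3 : 0 ≤ θ * ‖w‖ ^ 2 + ‖G‖ ^ 2 / θ := by positivity
    have a4 : -(2 * ⟪G, w⟫_ℝ) ≤ θ * ‖w‖ ^ 2 + ‖G‖ ^ 2 / θ := by linarith
    have a5 := mul_le_mul_of_nonneg_left a4 hε.le
    have a6 := mul_le_mul_of_nonneg_right hε1 a3
    linarith
  have h2 : 2 * ε * ⟪pd j l r, w⟫_ℝ ≤ ν₅ / 2 * X ^ 2 + 2 / ν₅ * (ε ^ 2 * gxv ^ 2) := by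
    have a1 := two_mul_le_sq_add (half_pos hν₅) X (ε * gxv)
    have a2 := mul_le_mul_of_nonneg_left hr (by positivity : 0 ≤ 2 * ε)
    have a3 : (ε * gxv) ^ 2 / (ν₅ / 2) = 2 / ν₅ * (ε ^ 2 * gxv ^ 2) := by field_simp
    linarith
  have h3 : 3 * θ * ‖w‖ ^ 2 ≤ ν₅ / 2 * X ^ 2 := by
    have a1 := mul_le_mul_of_nonneg_left hw (by positivity : 0 ≤ 3 * θ)
    have a2 : 3 * θ * (cn * X ^ 2) = ν₅ / 2 * X ^ 2 := by rw [hθ]; field_simp; ring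
    linarith
  have h4 : (2 * Cδ + 2 * ν₆) * hNorm (len j + len l - 1) h ^ 2 + ‖G‖ ^ 2 / θ ≤ C₁ * s := by
    have a1 := mul_le_mul_of_nonneg_left (hlow.trans hlow2) (by positivity : 0 ≤ 2 * Cδ + 2 * ν₆)
    have a2 := (hcom.trans (mul_le_mul_of_nonneg_left hlow2 (by positivity))).trans_eq
      (show (k : ℝ) ^ 2 * ((cn + 1) * s) = (k : ℝ) ^ 2 * (cn + 1) * s by ring)
    have a3 := div_le_div_of_nonneg_right a2 hθ0.le
    have a4 : C₁ * s = (2 * Cδ + 2 * ν₆) * ((cn + 1) * s) + (k : ℝ) ^ 2 * (cn + 1) * s / θ := by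
      rw [hC₁]; ring
    linarith
  have h5 : (ν₅⁻¹ + C₁ + 2 / ν₅)⁻¹ * X ^ 2 ≤ ν₅ * X ^ 2 := by
    refine mul_le_mul_of_nonneg_right ?_ (by positivity)
    rw [inv_le_comm₀ (by positivity) hν₅]
    have : 0 < 2 / ν₅ := by positivity
    linarith
  have h6 : C₁ * s ≤ (ν₅⁻¹ + C₁ + 2 / ν₅) * s := by
    refine mul_le_mul_of_nonneg_right ?_ hs0
    have : 0 < ν₅⁻¹ + 2 / ν₅ := by positivity
    linarith
  have h7 : 2 / ν₅ * (ε ^ 2 * gxv ^ 2) ≤ (ν₅⁻¹ + C₁ + 2 / ν₅) * (ε ^ 2 * gxv ^ 2) := by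
    refine mul_le_mul_of_nonneg_right ?_ (by positivity)
    have : 0 < ν₅⁻¹ := by positivity
    linarith
  linarith

/-- There are finitely many pairs of multi-indices of order at most `k`, and the estimate weakens as
`M` grows, so the sum of the individual constants works. -/
theorem exists_energy_v_uniform (k : ℕ) (hH1 : H1' L K Λ nΛ) (hH2 : H2' K) {cn : ℝ} (hcn : 0 < cn)
    (hle : ∀ f : L2xv N, lamNorm nΛ f ≠ ⊤ → ‖f‖ ^ 2 ≤ cn * lamR nΛ f ^ 2) :
    ∃ M : ℝ, 0 < M ∧ ∀ ε : ℝ, 0 < ε → ε ≤ 1 → ∀ h ht q z r τ : L2xv N,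
      Snapshot k ε L Λ h ht q z r τ → ∀ gxv : ℝ, ∀ j l : Fin N → ℕ, 1 ≤ len j →
      len j + len l ≤ k →
      (∀ f : L2xv N, lamNorm nΛ f ≠ ⊤ → |⟪pd j l r, f⟫_ℝ| ≤ gxv * lamR nΛ f) →
      ε ^ 2 * (2 * ⟪pd j l ht, pd j l h⟫_ℝ) ≤ -M⁻¹ * lamQ nΛ h j l +
        M * (∑ m ∈ (midx2 N k).filter (fun m => wt k m.1 m.2 < wt k j l), lamQ nΛ h m.1 m.2) +
        M * (ε ^ 2 * gxv ^ 2) := by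
  have hex : ∀ m : (Fin N → ℕ) × (Fin N → ℕ), ∃ M : ℝ, 0 < M ∧ (1 ≤ len m.1 →
      len m.1 + len m.2 ≤ k → ∀ ε : ℝ, 0 < ε → ε ≤ 1 → ∀ h ht q z r τ : L2xv N,
      Snapshot k ε L Λ h ht q z r τ → ∀ gxv : ℝ,
      (∀ f : L2xv N, lamNorm nΛ f ≠ ⊤ → |⟪pd m.1 m.2 r, f⟫_ℝ| ≤ gxv * lamR nΛ f) →
      ε ^ 2 * (2 * ⟪pd m.1 m.2 ht, pd m.1 m.2 h⟫_ℝ) ≤ -M⁻¹ * lamQ nΛ h m.1 m.2 +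
        M * (∑ n ∈ (midx2 N k).filter (fun n => wt k n.1 n.2 < wt k m.1 m.2),
          lamQ nΛ h n.1 n.2) + M * (ε ^ 2 * gxv ^ 2)) := by
    intro m
    by_cases hm : 1 ≤ len m.1 ∧ len m.1 + len m.2 ≤ k
    · obtain ⟨M, hM, h⟩ := exists_energy_v hH1 hH2 hcn hle m.1 m.2 hm.1 hm.2
      exact ⟨M, hM, fun _ _ => h⟩
    · exact ⟨1, one_pos, fun h1 h2 => absurd ⟨h1, h2⟩ hm⟩
  choose M hM hE using hex
  have hpos : 0 < 1 + ∑ m ∈ midx2 N k, M m :=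
    add_pos_of_pos_of_nonneg one_pos (Finset.sum_nonneg fun m _ => (hM m).le)
  refine ⟨1 + ∑ m ∈ midx2 N k, M m, hpos, ?_⟩
  intro ε hε hε1 h ht q z r τ S gxv j l hj hjl hgxv
  have hmono : M (j, l) ≤ 1 + ∑ m ∈ midx2 N k, M m := by
    have := Finset.single_le_sum (fun m _ => (hM m).le) (mem_midx2.2 hjl : (j, l) ∈ midx2 N k)
    linarith
  refine (hE (j, l) hj hjl ε hε hε1 h ht q z r τ S gxv hgxv).trans ?_
  have h1 : (1 + ∑ m ∈ midx2 N k, M m)⁻¹ ≤ (M (j, l))⁻¹ := inv_anti₀ (hM _) hmono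
  have h2 := mul_le_mul_of_nonneg_right h1 (lamQ_nonneg nΛ h j l)
  have h3 := mul_le_mul_of_nonneg_right hmono (Finset.sum_nonneg fun n _ =>
    lamQ_nonneg nΛ h n.1 n.2 : 0 ≤ ∑ n ∈ (midx2 N k).filter
      (fun n => wt k n.1 n.2 < wt k j l), lamQ nΛ h n.1 n.2)
  have h4 := mul_le_mul_of_nonneg_right hmono (by positivity : 0 ≤ ε ^ 2 * gxv ^ 2)
  simp only
  linarith

end

/-! ### The estimate along solutions -/

section

variable {N k : ℕ} {L K Λ : L2v N →ₗ.[ℝ] L2v N} {nΛ : L2v N → ℝ≥0∞}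

/-- Solving the equation for `v·∇_x h` expresses it through terms already known to lie in `H^k`. Its
regularity therefore comes for free, although `v` is unbounded. -/
lemma snapshot_of_eqn {ε : ℝ} (hε : 0 < ε) (hk : 1 ≤ k) {h ht q z r : L2xv N} (hh : MemH k h)
    (hht : MemH k ht) (hq : MemH k q) (hz : MemH k z) (hr : MemH k r) (hL : Acts L h q)
    (hΛ : Acts Λ h z) (heq : ∀ᵐ p : Tor N × Vel N,
      ht p + ε⁻¹ * transport h p = (ε ^ 2)⁻¹ * q p + ε⁻¹ * r p) :
    Snapshot k ε L Λ h ht q z r (ε⁻¹ • q + r + (-ε) • ht) := by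
  refine ⟨hh, hq, hz, hr, ((hq.smul _).add hr).add (hht.smul _), hL, hΛ, ?_, ?_⟩
  · refine weak_tField_transport (hh.mono hk) ?_
    filter_upwards [heq, Lp.coeFn_add (ε⁻¹ • q + r) ((-ε) • ht), Lp.coeFn_add (ε⁻¹ • q) r,
      Lp.coeFn_smul ε⁻¹ q, Lp.coeFn_smul (-ε) ht] with p h1 h2 h3 h4 h5
    rw [h2, Pi.add_apply, h3, Pi.add_apply, h4, h5, Pi.smul_apply, Pi.smul_apply, smul_eq_mul,
      smul_eq_mul]
    have h6 : ht p = (ε ^ 2)⁻¹ * q p + ε⁻¹ * r p - ε⁻¹ * transport h p := by linarith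
    rw [h6]
    field_simp
    ring
  · have e1 : (-ε⁻¹) * ε⁻¹ = -(ε ^ 2)⁻¹ := by field_simp
    have e2 : (-ε⁻¹) * (-ε) = 1 := by field_simp
    rw [smul_add, smul_add, smul_smul, smul_smul, e1, e2, one_smul, neg_smul, neg_smul]
    abel

lemma ActsBilin.inner_ker_eq_zero {D : Submodule ℝ (L2v N)} {Γ : D →ₗ[ℝ] D →ₗ[ℝ] L2v N}
    (h5 : H5 L Γ) {u : L2v N} (hu : InKer L u) {g h r : L2xv N} (hr : ActsBilin Γ g h r) :
    ∀ᵐ x : Tor N, ⟪u, slice r x⟫_ℝ = 0 := by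
  filter_upwards [hr] with x ⟨hg, hh, e⟩
  rw [← e]
  exact h5 _ _ u hu

lemma Snapshot.inner_constX_eq_zero {ε : ℝ} {h ht q z r τ : L2xv N}
    (S : Snapshot k ε L Λ h ht q z r τ) (hL : IsSelfAdjoint L) {u : L2v N} (hu : InKer L u)
    (hr : ∀ᵐ x : Tor N, ⟪u, slice r x⟫_ℝ = 0) : ⟪constX u, ht⟫_ℝ = 0 := by
  have hq := integral_inner_ker_eq_zero hL hu S.actsL
  rw [S.eqn]
  simp only [inner_add_right, real_inner_smul_right]
  rw [inner_transport_constX u S.weak, inner_constX, inner_constX, integral_congr_ae hq,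
    integral_congr_ae hr]
  simp

/-- Conservation of the moments along the kernel of `L`. -/
lemma IsSolution.inner_constX_eq_zero {ε T : ℝ} (hε : 0 < ε) (hk : 1 ≤ k)
    {D : Submodule ℝ (L2v N)} {Γ : D →ₗ[ℝ] D →ₗ[ℝ] L2v N} (h5 : H5 L Γ) (hL : IsSelfAdjoint L)
    {hin : L2xv N} {g h : ℝ → L2xv N} (hs : IsSolution k ε T L Λ Γ hin g h) {u : L2v N}
    (hu : InKer L u) (h0 : ⟪constX u, hin⟫_ℝ = 0) {t : ℝ} (ht : t ∈ Ioo 0 T) :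
    ⟪constX u, h t⟫_ℝ = 0 := by
  rw [← h0, ← hs.init]
  refine eq_of_hasDerivAt_zero (F := fun s => ⟪constX u, h s⟫_ℝ)
    (continuousOn_const.inner hs.cont) (fun s hsT => ?_) ht
  obtain ⟨h', q, z, r, hh', hq, hz, hr, hder, hLq, hΛz, hΓ, heq⟩ := hs.eqn s hsT
  have S := snapshot_of_eqn hε hk (hs.mem s ⟨hsT.1.le, hsT.2⟩) hh' hq hz hr hLq hΛz heq
  have h1 := hder 0 0 (by simp [len_zero])
  simp only [pd_zero_zero] at h1
  have h2 := (hasDerivAt_const s (constX u)).inner ℝ h1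
  rw [S.inner_constX_eq_zero hL hu (hΓ.inner_ker_eq_zero h5 hu), inner_zero_left, add_zero] at h2
  exact h2

lemma hasDerivAt_hEpsSq (b : (Fin N → ℕ) → (Fin N → ℕ) → ℝ) (α : (Fin N → ℕ) → ℝ)
    (a : Fin N → (Fin N → ℕ) → ℝ) (ε : ℝ) {h : ℝ → L2xv N} {h' : L2xv N} {t : ℝ}
    (hder : ∀ j l : Fin N → ℕ, len j + len l ≤ k →
      HasDerivAt (fun s => pd j l (h s)) (pd j l h') t) :
    HasDerivAt (fun s => hEpsSq k b α a ε (h s))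
      ((∑ m ∈ (midx2 N k).filter (fun m => 1 ≤ len m.1),
          b m.1 m.2 * (ε ^ 2 * (2 * ⟪pd m.1 m.2 h', pd m.1 m.2 (h t)⟫_ℝ))) +
        (∑ l ∈ midx N k, α l * (2 * ⟪pd 0 l h', pd 0 l (h t)⟫_ℝ)) +
        ∑ l ∈ midx N k, ∑ i ∈ Finset.univ.filter (fun i => 0 < l i),
          a i l * (ε * (⟪pd (dl i) (l - dl i) h', pd 0 l (h t)⟫_ℝ +
            ⟪pd (dl i) (l - dl i) (h t), pd 0 l h'⟫_ℝ))) t := by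
  have h0 {l : Fin N → ℕ} (hl : l ∈ midx N k) : len (0 : Fin N → ℕ) + len l ≤ k := by
    rw [len_zero, zero_add]; exact mem_midx.1 hl
  unfold hEpsSq
  refine HasDerivAt.add (HasDerivAt.add ?_ ?_) ?_
  · refine HasDerivAt.fun_sum fun m hm => ?_
    have hm' := mem_midx2.1 (Finset.mem_of_mem_filter _ hm)
    refine ((hder m.1 m.2 hm').norm_sq.const_mul (b m.1 m.2 * ε ^ 2)).congr_deriv ?_
    rw [real_inner_comm, mul_assoc]
  · refine HasDerivAt.fun_sum fun l hl => ?_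
    refine ((hder 0 l (h0 hl)).norm_sq.const_mul (α l)).congr_deriv ?_
    rw [real_inner_comm]
  · refine HasDerivAt.fun_sum fun l hl => HasDerivAt.fun_sum fun i hi => ?_
    have hm := mem_midx2.1 (Finset.mem_of_mem_filter _ (mixed_mem (Finset.mem_filter.1 hi).2 hl))
    refine (((hder _ _ hm).inner ℝ (hder 0 l (h0 hl))).const_mul (a i l * ε)).congr_deriv ?_
    rw [mul_assoc, add_comm]

lemma hLamNorm_ne_top {f : L2xv N}
    (h : ∀ m ∈ midx2 N k, lamNorm nΛ (pd m.1 m.2 f) ≠ ⊤) : hLamNorm nΛ k f ≠ ⊤ := by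
  unfold hLamNorm
  refine ENNReal.rpow_ne_top_of_nonneg (by norm_num) ?_
  exact (ENNReal.sum_ne_top).2 fun m hm => ENNReal.pow_ne_top (h m hm)

lemma hLamNorm_toReal_sq {f : L2xv N}
    (h : ∀ m ∈ midx2 N k, lamNorm nΛ (pd m.1 m.2 f) ≠ ⊤) :
    (hLamNorm nΛ k f).toReal ^ 2 = ∑ m ∈ midx2 N k, lamR nΛ (pd m.1 m.2 f) ^ 2 := by
  unfold hLamNorm
  rw [← ENNReal.toReal_pow, ← ENNReal.rpow_natCast, ← ENNReal.rpow_mul]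
  norm_num
  rw [ENNReal.toReal_sum fun m hm => ENNReal.pow_ne_top (h m hm)]
  simp [ENNReal.toReal_pow, lamR]

lemma abs_inner_le_of_ofReal_le {G : ℝ≥0∞} (hG : G ≠ ⊤) {f : L2xv N} (hf : lamNorm nΛ f ≠ ⊤)
    {a : ℝ} (h : ENNReal.ofReal |a| ≤ G * lamNorm nΛ f) : |a| ≤ G.toReal * lamR nΛ f := by
  rw [ENNReal.ofReal_le_iff_le_toReal (ENNReal.mul_ne_top hG hf), ENNReal.toReal_mul] at h
  exact h

end

/-- The hypocoercive energy estimate. -/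
theorem hypocoercivity {N : ℕ} (L K Λ : L2v N →ₗ.[ℝ] L2v N) (nΛ : L2v N → ℝ≥0∞)
    (hH1 : H1' L K Λ nΛ) (hH2 : H2' K) (hH3 : H3 L nΛ) (k : ℕ) (hk : 1 ≤ k) :
    ∃ K₀ K₁ K₂ r : ℝ, 0 < r ∧ r ≤ 1 ∧ r * ((midx N k).card * N) ≤ 1 ∧ 0 < K₀ ∧ 0 < K₁ ∧ 0 < K₂ ∧
      ∀ (D : Submodule ℝ (L2v N)) (Γ : D →ₗ[ℝ] D →ₗ[ℝ] L2v N)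
        (Gxv Gx : ℕ → L2xv N → L2xv N → ℝ≥0∞), H4 nΛ Γ Gxv Gx → H5 L Γ →
        ∀ ε : ℝ, 0 < ε → ε ≤ 1 → ∀ hin : L2xv N, (∀ f, InKerG L ε f → ⟪f, hin⟫_ℝ = 0) →
        ∀ (T : ℝ) (g h : ℝ → L2xv N), (∀ t ∈ Ioo 0 T, MemH k (g t)) →
          IsSolution k ε T L Λ Γ hin g h → ∀ t ∈ Ioo 0 T,
            hLamNorm nΛ k (h t) ≠ ⊤ ∧ ∃ d : ℝ,
              HasDerivAt (fun s => hEpsSq k (coefB k r) (coefAlpha r) (coefA k r) ε (h s)) d t ∧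
              (Gx k (g t) (h t) ≠ ⊤ → Gxv k (g t) (h t) ≠ ⊤ →
                d ≤ -K₀ * (hLamNorm nΛ k (h t)).toReal ^ 2
                  + K₁ * (Gx k (g t) (h t)).toReal ^ 2
                  + ε ^ 2 * K₂ * (Gxv k (g t) (h t)).toReal ^ 2) := by
  have H := hH1.h1
  obtain ⟨d, φ, P, hφ, hker, hP, lam, hlam, hrel⟩ := hH3
  have hφk : ∀ i, InKer L (φ i) := fun i => (hker _).2 (Submodule.subset_span ⟨i, rfl⟩)
  obtain ⟨ν₀, ν₁, ν₂, hν₀, hν₁, hν₂, hc1, hc2⟩ := H.coercive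
  obtain ⟨CL, hCL, hb⟩ := H.bound
  -- Since `L = K - Λ`, the domain of `L` lies in that of `Λ`, where the `Λ`-norm is finite.
  have hφΛ : ∀ i, nΛ (φ i) ≠ ⊤ := by
    intro i
    obtain ⟨hi, -⟩ := hφk i
    rw [H.decomp] at hi
    exact (hc2 ⟨φ i, hi.2⟩).1
  obtain ⟨Cp, hCp, hperp⟩ := lamNorm_le_perp H.norm hφ hφΛ
  have hcn : 0 < ν₁ / ν₀ := by positivity
  have hle : ∀ f : L2xv N, lamNorm nΛ f ≠ ⊤ → ‖f‖ ^ 2 ≤ ν₁ / ν₀ * lamR nΛ f ^ 2 :=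
    fun f hf => norm_sq_le_lamR hν₀ hν₁ hc1 hf
  obtain ⟨M, hM, hv⟩ := exists_energy_v_uniform k hH1 hH2 hcn hle
  have hB : 0 < ((midx N k).card : ℝ) * N + 1 := by positivity
  obtain ⟨r, K₀, K₁, K₂, hr, hr1, hrr, hK₀, hK₁, hK₂, hE⟩ :=
    energy_combine N k hk (CL := CL) (inv_pos.2 hM) hM hlam
      (by positivity : 0 < 2 * (ν₁ / ν₀) + 2 * d) (by positivity : 0 < Cp + 1)
      -- This upper bound on `r` is the one required by the norm equivalence, so the same `r` serves
      -- both conclusions.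
      (inv_pos.2 hB)
  refine ⟨K₀, K₁, K₂, r, hr, hr1, ?_, hK₀, hK₁, hK₂, ?_⟩
  · have h1 := mul_le_mul_of_nonneg_right hrr hB.le
    rw [inv_mul_cancel₀ hB.ne'] at h1
    linarith
  intro D Γ Gxv Gx h4 h5 ε hε hε1 hin horth T g h hg hsol t ht
  obtain ⟨h', q, z, Γt, hh', hq, hz, hΓt, hder, hLq, hΛz, hΓ, heq⟩ := hsol.eqn t ht
  have hh := hsol.mem t ⟨ht.1.le, ht.2⟩
  have S := snapshot_of_eqn hε hk hh hh' hq hz hΓt hLq hΛz heq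
  have hfinP : ∀ l, len l ≤ k → lamNorm nΛ (perp φ (pd 0 l (h t))) ≠ ⊤ := fun l hl =>
    (coercive_perp hlam hrel (S.actsL.pd H.closed S.mem S.mem_q l hl)).1
  have hfin : ∀ m ∈ midx2 N k, lamNorm nΛ (pd m.1 m.2 (h t)) ≠ ⊤ := by
    intro m hm
    rw [mem_midx2] at hm
    by_cases hj : 1 ≤ len m.1
    · exact S.lamNorm_pd_ne_top hH1 hj hm
    · rw [len_eq_zero.1 (by omega : len m.1 = 0)]
      exact (hperp _ (hfinP _ (by omega))).1
  have hdl (i : Fin N) : dl i ≠ 0 := fun h0 => by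
    have := len_dl i
    rw [h0, len_zero] at this
    omega
  refine ⟨hLamNorm_ne_top hfin, _, hasDerivAt_hEpsSq _ _ _ ε hder, fun hGx hGxv => ?_⟩
  have hctl := h4.control k (g t) (h t) Γt (hg t ht) hh hΓ hΓt
  have hgx : ∀ l, len l ≤ k → ∀ f : L2xv N, lamNorm nΛ f ≠ ⊤ →
      |⟪pd 0 l Γt, f⟫_ℝ| ≤ (Gx k (g t) (h t)).toReal * lamR nΛ f := fun l hl f hf =>
    abs_inner_le_of_ofReal_le hGx hf ((hctl 0 l (by rw [len_zero]; omega) f hf).2 rfl)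
  refine hE ε hε hε1 (lamQ nΛ (h t))
    (fun j l => ε ^ 2 * (2 * ⟪pd j l h', pd j l (h t)⟫_ℝ))
    (fun l => lamR nΛ (perp φ (pd 0 l (h t))) ^ 2)
    (fun l => 2 * ⟪pd 0 l h', pd 0 l (h t)⟫_ℝ)
    (fun i l => ε * (⟪pd (dl i) (l - dl i) h', pd 0 l (h t)⟫_ℝ +
            ⟪pd (dl i) (l - dl i) (h t), pd 0 l h'⟫_ℝ))
    (Gx k (g t) (h t)).toReal (Gxv k (g t) (h t)).toReal _ (lamQ_nonneg nΛ (h t))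
    (fun l => sq_nonneg _) ?_ ?_ ?_ ?_ ?_
  · intro j l hj hjl
    refine hv ε hε hε1 _ _ _ _ _ _ S _ j l hj hjl fun f hf => ?_
    refine abs_inner_le_of_ofReal_le hGxv hf ((hctl j l hjl f hf).1 ?_)
    rintro rfl
    rw [len_zero] at hj
    omega
  · intro l hl
    exact S.energy_x hε H.closed hlam hrel (fun i => hΓ.inner_ker_eq_zero h5 (hφk i)) hl
      (hgx l hl)
  · intro i l hi hl s hs
    have hm := Finset.mem_of_mem_filter _ (mixed_mem hi (mem_midx.2 hl))
    have hw : lamNorm nΛ (pd (dl i) (l - dl i) (h t)) ≠ ⊤ := hfin (dl i, l - dl i) hm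
    have := S.energy_mixed hε H.closed H.norm hlam hφk hrel hCL hb hi hl hw
      (hgx l hl) hs
    simp only [lamQ, if_pos, if_neg (hdl i)]
    exact this
  -- Each `φ i`, viewed as constant in `x`, lies in `Ker G_ε`; orthogonality of the datum and
  -- conservation give the mean zero condition at time `t`.
  · have h0 : ∀ i, ∫ x : Tor N, ⟪φ i, slice (h t) x⟫_ℝ = 0 := by
      intro i
      rw [← inner_constX]
      exact hsol.inner_constX_eq_zero hε hk h5 H.selfAdjoint (hφk i)
        (horth _ (inKerG_constX ε (P i) (hP i) (hφk i))) ht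
    have h1 := norm_sq_le_perp hφ (hh.mono hk) h0
    have h2 := hle _ (hfinP 0 (by rw [len_zero]; omega))
    rw [pd_zero_zero] at h2
    simp only [lamQ, if_pos, pd_zero_zero]
    have h3 : 0 ≤ lamR nΛ (perp φ (h t)) ^ 2 := by positivity
    have h4 : 0 ≤ ∑ m, ‖pd 0 (dl m) (h t)‖ ^ 2 := Finset.sum_nonneg fun m _ => by positivity
    have h5 : 0 ≤ 2 * (d : ℝ) * lamR nΛ (perp φ (h t)) ^ 2 := by positivity
    have h6 : 0 ≤ 2 * (ν₁ / ν₀) * ∑ m, ‖pd 0 (dl m) (h t)‖ ^ 2 := by positivity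
    linarith
  · rw [hLamNorm_toReal_sq hfin, sum_midx2_split, sum_midx2_split, mul_add, add_assoc,
      Finset.mul_sum, Finset.mul_sum, Finset.mul_sum, ← Finset.sum_add_distrib]
    refine add_le_add (Finset.sum_le_sum fun m hm => ?_) (Finset.sum_le_sum fun l hl => ?_)
    · have hm0 : m.1 ≠ 0 := fun h0 => by
        have := (Finset.mem_filter.1 hm).2
        rw [h0, len_zero] at this
        omega
      simp only [lamQ, if_neg hm0]
      exact le_mul_of_one_le_left (sq_nonneg _) (by linarith)
    · have h1 := (hperp _ (hfinP l (mem_midx.1 hl))).2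
      simp only [lamQ, if_pos]
      have : 0 ≤ ‖pd 0 l (h t)‖ ^ 2 := by positivity
      linarith

end Hypo

end

theorem mainTheorem5 {N : ℕ} (hN : 2 ≤ N)
    (L K Λ : L2v N →ₗ.[ℝ] L2v N) (nΛ : L2v N → ENNReal)
    (hH1 : H1' L K Λ nΛ) (hH2 : H2' K) (hH3 : H3 L nΛ) :
    ∃ εN : ℝ, 0 < εN ∧ εN ≤ 1 ∧ ∀ k : ℕ, 1 ≤ k →
      ∃ (K₀ K₁ K₂ : ℝ) (b : (Fin N → ℕ) → (Fin N → ℕ) → ℝ) (α : (Fin N → ℕ) → ℝ)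
        (a : Fin N → (Fin N → ℕ) → ℝ),
        0 < K₀ ∧ 0 < K₁ ∧ 0 < K₂ ∧ (∀ j l, 0 < b j l) ∧ (∀ l, 0 < α l) ∧ (∀ i l, 0 < a i l) ∧
        (∃ c C : ℝ, 0 < c ∧ 0 < C ∧ ∀ ε : ℝ, 0 < ε → ε ≤ εN → ∀ f : L2xv N, MemH k f →
          c * weightedSq k ε f ≤ hEpsSq k b α a ε f ∧
            hEpsSq k b α a ε f ≤ C * weightedSq k ε f) ∧
        ∀ (D : Submodule ℝ (L2v N)) (Γ : D →ₗ[ℝ] D →ₗ[ℝ] L2v N)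
          (Gxv Gx : ℕ → L2xv N → L2xv N → ENNReal),
          H4 nΛ Γ Gxv Gx → H5 L Γ →
          ∀ ε : ℝ, 0 < ε → ε ≤ εN →
          ∀ hin : L2xv N, MemH k hin → (∀ f, InKerG L ε f → inner ℝ f hin = 0) →
          ∀ (T : ℝ) (g h : ℝ → L2xv N), (∀ t ∈ Set.Ioo 0 T, MemH k (g t)) →
            IsSolution k ε T L Λ Γ hin g h →
            ∀ t ∈ Set.Ioo 0 T,
              hLamNorm nΛ k (h t) ≠ ⊤ ∧
              ∃ d : ℝ, HasDerivAt (fun s => hEpsSq k b α a ε (h s)) d t ∧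
                (Gx k (g t) (h t) ≠ ⊤ → Gxv k (g t) (h t) ≠ ⊤ →
                  d ≤ -K₀ * (hLamNorm nΛ k (h t)).toReal ^ 2
                    + K₁ * (Gx k (g t) (h t)).toReal ^ 2
                    + ε ^ 2 * K₂ * (Gxv k (g t) (h t)).toReal ^ 2) := by
  -- Every estimate was closed using only `ε ≤ 1`; the smallness is carried by `r`, which may depend
  -- on `k`.
  refine ⟨1, one_pos, le_rfl, fun k hk => ?_⟩
  obtain ⟨K₀, K₁, K₂, r, hr, hr1, hrN, hK₀, hK₁, hK₂, h⟩ :=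
    hypocoercivity L K Λ nΛ hH1 hH2 hH3 k hk
  refine ⟨K₀, K₁, K₂, coefB k r, coefAlpha r, coefA k r, hK₀, hK₁, hK₂, fun j l => ?_, fun l => ?_,
    fun i l => ?_, ?_, ?_⟩
  · unfold coefB; positivity
  · unfold coefAlpha; positivity
  · unfold coefA; positivity
  · obtain ⟨c, C, hc, hC, hcC⟩ := hEpsSq_equiv N k hr hr1 hrN
    exact ⟨c, C, hc, hC, fun ε _ _ f _ => hcC ε f⟩
  · intro D Γ Gxv Gx h4 h5 ε hε hε1 hin _ horth
    exact h D Γ Gxv Gx h4 h5 ε hε hε1 hin horth
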